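/- For a finite set $P=\{p_1,\dots,p_n\}\subseteq\mathbb{R}^d$ and $r\ge 0$, let $\mathcal{C}_{\le r}(P)$ (the $r$-connectivity clustering) be the partition of $P$ into the connected components of the graph on $P$ in which two points are adjacent iff their Euclidean distance is at most $r$. A sketchable family on $P$ is a family $\mathcal{F}$ of subsets of $P$ that is upward closed (if $X\in\mathcal{F}$ and $X\subseteq Y\subseteq P$, then $Y\in\mathcal{F}$), together with a sketch $\mathrm{sk}(S)$ for every $S\subseteq P$, a procedure that computes $\mathrm{sk}(S\cup T)$ from $\mathrm{sk}(S)$ and $\mathrm{sk}(T)$ for all disjoint $S,T\subseteq P$, and a membership oracle that decides from $\mathrm{sk}(S)$ whether $S\in\mathcal{F}$; the size of a sketch and the running times of both procedures are at most a constant $\tau$. The model of computation is a randomized uniform-cost real RAM: arithmetic operations, square root, floor, comparisons, look-ups and updates in hash tables whose keys are integer vectors of fixed length, and the choice of a uniformly random integer from $\{0,\dots,m\}$ take constant time; copying a sketch, combining two sketches, or calling the oracle takes $O(1+\tau)$ time. **Theorem.** Let $d\ge 1$. There is a randomized algorithm (one program, depending only on $d$) and, for every $\tau$, a constant $C=C(d,\tau)$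 such that the following holds. Let $P\subseteq\mathbb{R}^d$ be a set of $n\ge 1$ distinct points, let $\mathcal{F}\neq\emptyset$ be a sketchable family on $P$ with constant $\tau$, and let $0<\varepsilon\le 1$. The algorithm is given $n$, $\varepsilon$, the coordinates of the points, and the sketches $\mathrm{sk}(\{p\})$ for $p\in P$. Then the minimum $$r_{\mathrm{opt}}=\min\{\,r\ge 0 : \text{some connected component in } \mathcal{C}_{\le r}(P)\text{ belongs to }\mathcal{F}\,\}$$ exists, the algorithm halts with probability $1$ and, with probability $1$, outputs a number $x$ with $r_{\mathrm{opt}}\le x\le(1+\varepsilon)\,r_{\mathrm{opt}}$, and its expected running time is at most $C\,n/\varepsilon^{d}$. -/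

import Mathlib

/-! ### Connectivity clustering -/

/-- The graph on the index set `V` of a point set `P`, in which two distinct points are adjacent
when their distance is at most `r` (equivalently: when the balls of radius `r / 2` centred at them
intersect). -/
def connectivityGraph {V E : Type*} [PseudoMetricSpace E] (P : V → E) (r : ℝ) : SimpleGraph V where
  Adj i j := i ≠ j ∧ dist (P i) (P j) ≤ r
  symm := ⟨fun _ _ h => ⟨h.1.symm, by rw [dist_comm]; exact h.2⟩⟩
  loopless := ⟨fun _ h => h.1 rfl⟩

/-- The `r`-connectivity clustering: the partition of the points (given by their indices) into the
vertex sets of the connected components of `connectivityGraph P r`. -/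
def connectivityClustering {V E : Type*} [PseudoMetricSpace E] (P : V → E) (r : ℝ) : Set (Set V) :=
  Set.range fun K : (connectivityGraph P r).ConnectedComponent => K.supp

/-- The radii `r ≥ 0` for which some cluster of the `r`-connectivity clustering lies in `F`. -/
def feasibleRadii {V E : Type*} [PseudoMetricSpace E] (P : V → E) (F : Set (Set V)) : Set ℝ :=
  {r | 0 ≤ r ∧ ∃ K ∈ connectivityClustering P r, K ∈ F}

/-! ### Sketchable families -/

/-- A sketchable family on the ground set `V`: an upward closed set system together with sketches
(values in `σ`), a procedure `merge` that computes the sketch of a disjoint union from the two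
sketches, and a membership procedure `oracle` that works on sketches. The size of a sketch and the
time taken by the two procedures are accounted for by the machine below, see `RealRAM.step`. -/
structure SketchableFamily (V σ : Type*) where
  family : Set (Set V)
  upward_closed : ∀ X ∈ family, ∀ Y, X ⊆ Y → Y ∈ family
  sketch : Set V → σ
  merge : σ → σ → σ
  oracle : σ → Bool
  sketch_union : ∀ S T, Disjoint S T → sketch (S ∪ T) = merge (sketch S) (sketch T)
  oracle_sketch : ∀ S, oracle (sketch S) = true ↔ S ∈ family

/-! ### A randomized real RAM with the floor function, hash tables and sketch registers -/

namespace RealRAM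

/-- An address: the name of a hash table together with a key, a list of integers. The entry with
the empty key serves as a scalar variable. -/
abbrev Addr := ℕ × List ℤ

/-- Expressions: rational constants, table look-ups (the key is the list of the floors of the index
expressions), the four arithmetic operations, square root and floor. -/
inductive RExpr : Type
  | const (q : ℚ)
  | read (tbl : ℕ) (k : ℕ) (idx : Fin k → RExpr)
  | add (a b : RExpr)
  | sub (a b : RExpr)
  | mul (a b : RExpr)
  | div (a b : RExpr)
  | sqrt (a : RExpr)
  | floor (a : RExpr)

/-- The value of an expression, when the memory has the contents `m`. -/
noncomputable def RExpr.eval (m : Addr → ℝ) : RExpr → ℝ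
  | .const q => (q : ℝ)
  | .read tbl _ idx => m (tbl, List.ofFn fun i => ⌊(idx i).eval m⌋)
  | .add a b => a.eval m + b.eval m
  | .sub a b => a.eval m - b.eval m
  | .mul a b => a.eval m * b.eval m
  | .div a b => a.eval m / b.eval m
  | .sqrt a => Real.sqrt (a.eval m)
  | .floor a => (⌊a.eval m⌋ : ℝ)

/-- The number of operations carried out in the evaluation of an expression. -/
def RExpr.size : RExpr → ℕ
  | .const _ => 1
  | .read _ _ idx => 1 + ∑ i, (idx i).size
  | .add a b => 1 + a.size + b.size
  | .sub a b => 1 + a.size + b.size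
  | .mul a b => 1 + a.size + b.size
  | .div a b => 1 + a.size + b.size
  | .sqrt a => 1 + a.size
  | .floor a => 1 + a.size

/-- A reference to a table entry, whose key is computed at run time. -/
structure Ref where
  tbl : ℕ
  arity : ℕ
  idx : Fin arity → RExpr

noncomputable def Ref.addr (m : Addr → ℝ) (x : Ref) : Addr :=
  (x.tbl, List.ofFn fun i => ⌊(x.idx i).eval m⌋)

def Ref.size (x : Ref) : ℕ := 1 + ∑ i, (x.idx i).size

/-- Programs. `rand x e` stores in `x` a uniformly random element of `{0, 1, …, ⌊e⌋}`; the
instructions `skCopy`, `skMerge` and `skTest` are the only ones that handle sketches, and `skTest`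
stores the answer of the membership oracle (1 for yes, 0 for no) in a real-valued entry. The
conditions of `ite` and `loop` (a while loop) are comparisons `a < b`. -/
inductive Prog : Type
  | skip
  | assign (x : Ref) (e : RExpr)
  | rand (x : Ref) (e : RExpr)
  | skCopy (dst src : Ref)
  | skMerge (dst src₁ src₂ : Ref)
  | skTest (x : Ref) (src : Ref)
  | seq (p q : Prog)
  | ite (a b : RExpr) (p q : Prog)
  | loop (a b : RExpr) (body : Prog)

/-- A configuration: the stack of programs still to be executed, the real-valued memory, the sketch
memory (`none` marks an empty entry), and the time used so far. -/
structure Config (σ : Type*) where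
  todo : List Prog
  mem : Addr → ℝ
  smem : Addr → Option σ
  time : ℕ

/-- One step of the machine. Every step takes one unit of time plus the number of operations in the
expressions that it evaluates; a step that handles sketches takes `τ` further units, so `τ` is the
bound on the size of a sketch and on the running times of `merge` and of the oracle. -/
noncomputable def step {V σ : Type*} (S : SketchableFamily V σ) (τ : ℕ) (c : Config σ) :
    PMF (Config σ) :=
  match c.todo with
  | [] => PMF.pure c
  | .skip :: k => PMF.pure ⟨k, c.mem, c.smem, c.time + 1⟩
  | .assign x e :: k =>
      PMF.pure ⟨k, Function.update c.mem (x.addr c.mem) (e.eval c.mem), c.smem,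
        c.time + 1 + x.size + e.size⟩
  | .rand x e :: k =>
      (PMF.uniformOfFinset (Finset.range (⌊e.eval c.mem⌋₊ + 1)) ⟨0, by simp⟩).map fun v =>
        ⟨k, Function.update c.mem (x.addr c.mem) (v : ℝ), c.smem, c.time + 1 + x.size + e.size⟩
  | .skCopy x y :: k =>
      PMF.pure ⟨k, c.mem, Function.update c.smem (x.addr c.mem) (c.smem (y.addr c.mem)),
        c.time + 1 + x.size + y.size + τ⟩
  | .skMerge x y z :: k =>
      PMF.pure ⟨k, c.mem, Function.update c.smem (x.addr c.mem)
          (Option.map₂ S.merge (c.smem (y.addr c.mem)) (c.smem (z.addr c.mem))),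
        c.time + 1 + x.size + y.size + z.size + τ⟩
  | .skTest x y :: k =>
      PMF.pure ⟨k, Function.update c.mem (x.addr c.mem)
          (if (c.smem (y.addr c.mem)).any S.oracle then 1 else 0), c.smem,
        c.time + 1 + x.size + y.size + τ⟩
  | .seq p q :: k => PMF.pure ⟨p :: q :: k, c.mem, c.smem, c.time + 1⟩
  | .ite a b p q :: k =>
      PMF.pure ⟨(open Classical in if a.eval c.mem < b.eval c.mem then p else q) :: k, c.mem,
        c.smem, c.time + 1 + a.size + b.size⟩
  | .loop a b p :: k =>
      PMF.pure ⟨(open Classical in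
          if a.eval c.mem < b.eval c.mem then p :: .loop a b p :: k else k), c.mem,
        c.smem, c.time + 1 + a.size + b.size⟩

/-- The distribution of the configuration after `t` steps from the configuration `c`. -/
noncomputable def stepN {V σ : Type*} (S : SketchableFamily V σ) (τ : ℕ) (c : Config σ) :
    ℕ → PMF (Config σ)
  | 0 => PMF.pure c
  | t + 1 => (stepN S τ c t).bind (step S τ)

/-- The expected total running time from the configuration `c`: the (increasing) limit of the
expected time used in the first `t` steps. -/
noncomputable def expectedTime {V σ : Type*} (S : SketchableFamily V σ) (τ : ℕ) (c : Config σ) :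
    ENNReal :=
  ⨆ t, ∑' c', stepN S τ c t c' * (c'.time : ENNReal)

/-- The output of a run is read off the scalar variable `3`. -/
def Config.output {σ : Type*} (c : Config σ) : ℝ := c.mem (3, [])

/-- The probability that the run from `c` halts with an output in `A`: the (increasing) limit of
the probabilities that it has done so within `t` steps. -/
noncomputable def probOutput {V σ : Type*} (S : SketchableFamily V σ) (τ : ℕ) (c : Config σ)
    (A : Set ℝ) : ENNReal :=
  ⨆ t, (stepN S τ c t).toOuterMeasure {c' | c'.todo = [] ∧ c'.output ∈ A}

/-- The real-valued input: the scalar variables `0` and `1` hold the number `n` of points and the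
parameter `ε`, the entry of table `2` with key `[i, j]` holds the `j`-th coordinate of the `i`-th
point, and everything else is `0`. -/
noncomputable def inputMem {n d : ℕ} (P : Fin n → EuclideanSpace ℝ (Fin d)) (ε : ℝ) : Addr → ℝ
  | (0, []) => n
  | (1, []) => ε
  | (2, [i, j]) =>
      if h : (0 ≤ i ∧ i < n) ∧ (0 ≤ j ∧ j < d) then
        P ⟨i.toNat, by omega⟩ ⟨j.toNat, by omega⟩
      else 0
  | _ => 0

/-- The sketch input: the entry of sketch table `0` with key `[i]` holds the sketch of the `i`-th
point, and all other entries are empty. -/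
noncomputable def inputSketches {n : ℕ} {σ : Type*} (S : SketchableFamily (Fin n) σ) :
    Addr → Option σ
  | (0, [i]) => if h : 0 ≤ i ∧ i < n then some (S.sketch {⟨i.toNat, by omega⟩}) else none
  | _ => none

/-- The initial configuration of the program `prog` on the points `P`, the sketchable family `S`
and the parameter `ε`. -/
noncomputable def start {n d : ℕ} {σ : Type*} (prog : Prog) (P : Fin n → EuclideanSpace ℝ (Fin d))
    (S : SketchableFamily (Fin n) σ) (ε : ℝ) : Config σ :=
  ⟨[prog], inputMem P ε, inputSketches S, 0⟩

end RealRAM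

namespace RealRAM

/-! ### Halting and expected time in the small-step semantics. -/

section Semantics

variable {V σ : Type*} (S : SketchableFamily V σ) (τ : ℕ)

/-! Round the points to a grid of mesh `side` and call two cells adjacent when their index vectors
differ by at most `K + d` in norm. Rounding moves a scaled difference vector by at most `d`. Hence
points at distance at most `side * K` lie in adjacent cells, and points of adjacent cells are at
distance at most `side * (K + 2 * d)`. A breadth-first search over the nonempty cells, which merges
the sketches of cells on its way, therefore tests a radius approximately, with work per cell
proportional to `(2 * (K + d) + 1) ^ d`. A positive answer bounds the optimum `R` from above
(`Cover.le_of_pos`), a negative one from below (`Cover.lt_of_neg`).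

The optimum is `0` exactly when some singleton belongs to the family. Otherwise a randomized
net-and-prune search finds it up to a constant factor. Let `r` be the nearest neighbour distance,
within the current list, of a random point of the list, and test two radii around `r`. If `R` is
much smaller than `r`, isolated points cannot contribute to a positive cluster and are dropped
(`Cover.prune`). If `R` is much larger than `r`, close points are merged into a net (`Cover.net`).
In the remaining case `r` itself determines `R` up to a constant.

Pruning removes every point whose nearest neighbour distance is at least `r`. Passing to a net
removes a constant fraction of the number of points whose nearest neighbour distance is at most `r`
(`Net.card_le`). So on average over the random point a constant fraction of the list disappears
(`sum_removed_ge`), and the rounds, each linear in the length of the list, have linear total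
expectation (`mainLoop_good`). The errors of successive nets do not pile up, because each net at
least doubles the scale `μ` in `Faithful`.

Finally the bracket `lo ≤ R ≤ lo * (1 + δ)` is tightened with `δ` shrinking by the factor `3 / 4`. A
round needs `K` of order `1 / δ` and time of order `n / δ ^ d`; for `1 ≤ d` these times form a
geometric series dominated by its last term (`improve_spec`).

All deterministic code is verified in a big-step logic (`Exec`, `Tri`) and carried over to the
machine by `Good.of_exec`; the single random instruction is handled by `Good.of_rand`. -/

theorem stepN_succ_left (c : Config σ) (t : ℕ) :
    stepN S τ c (t + 1) = (step S τ c).bind fun c' => stepN S τ c' t := by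
  induction t with
  | zero => simp [stepN]
  | succ t ih =>
    rw [stepN, ih, PMF.bind_bind]
    rfl

theorem stepN_of_halted {c : Config σ} (h : c.todo = []) (t : ℕ) :
    stepN S τ c t = PMF.pure c := by
  induction t with
  | zero => rfl
  | succ t ih =>
    rw [stepN, ih, PMF.pure_bind]
    unfold step
    rw [h]

/-- From `c` the machine surely halts, in a configuration satisfying `Q`, and the expected value of
its clock never exceeds `B`. -/
def Good (Q : Config σ → Prop) (c : Config σ) (B : ENNReal) : Prop :=
  (∃ N, ∀ c' ∈ (stepN S τ c N).support, c'.todo = [] ∧ Q c') ∧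
    ∀ t, ∑' c', stepN S τ c t c' * (c'.time : ENNReal) ≤ B

variable {S τ} {Q : Config σ → Prop}

theorem tsum_pure_mul {α : Type*} (a : α) (f : α → ENNReal) :
    ∑' b, (PMF.pure a) b * f b = f a := by
  rw [tsum_eq_single a]
  · simp
  · intro b hb
    simp [PMF.pure_apply, hb]

theorem Good.halted {c : Config σ} (h : c.todo = []) (hQ : Q c) {B : ENNReal}
    (hB : (c.time : ENNReal) ≤ B) : Good S τ Q c B := by
  refine ⟨⟨0, ?_⟩, fun t => ?_⟩
  · intro c' hc'
    simp only [stepN, PMF.support_pure, Set.mem_singleton_iff] at hc'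
    subst hc'
    exact ⟨h, hQ⟩
  · rw [stepN_of_halted S τ h, tsum_pure_mul]
    exact hB

theorem halted_mono {c : Config σ} {N M : ℕ} (hNM : N ≤ M)
    (h : ∀ c' ∈ (stepN S τ c N).support, c'.todo = [] ∧ Q c') :
    ∀ c' ∈ (stepN S τ c M).support, c'.todo = [] ∧ Q c' := by
  induction M, hNM using Nat.le_induction with
  | base => exact h
  | succ M _ ih =>
    intro c' hc'
    rw [stepN, PMF.mem_support_bind_iff] at hc'
    obtain ⟨c1, h1, h2⟩ := hc'
    have := ih c1 h1
    unfold step at h2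
    rw [this.1] at h2
    simp only [PMF.support_pure, Set.mem_singleton_iff] at h2
    subst h2
    exact this

theorem tsum_bind_mul {α β : Type*} (u : PMF α) (g : α → PMF β) (f : β → ENNReal) :
    ∑' b, (u.bind g) b * f b = ∑' a, u a * ∑' b, g a b * f b := by
  simp only [PMF.bind_apply, ← ENNReal.tsum_mul_right, ← ENNReal.tsum_mul_left, mul_assoc]
  exact ENNReal.tsum_comm

/-- Conditioning on the first step: the time bound is the law of total expectation. Since the step
has finitely many outcomes, the maximum of the halting times of the branches is a halting time for
all of them. -/
theorem Good.of_map {α : Type*} {c : Config σ} (u : PMF α) (g : α → Config σ)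
    (hstep : step S τ c = u.map g) (hfin : u.support.Finite) (B' : α → ENNReal) {B : ENNReal}
    (h : ∀ a ∈ u.support, Good S τ Q (g a) (B' a)) (h0 : (c.time : ENNReal) ≤ B)
    (hB : ∑' a, u a * B' a ≤ B) : Good S τ Q c B := by
  have key : ∀ t, stepN S τ c (t + 1) = u.bind fun a => stepN S τ (g a) t := by
    intro t
    rw [stepN_succ_left, hstep, PMF.map, PMF.bind_bind]
    simp
  refine ⟨?_, fun t => ?_⟩
  · have h1 : ∀ a, ∃ N, a ∈ u.support →
        ∀ c' ∈ (stepN S τ (g a) N).support, c'.todo = [] ∧ Q c' := by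
      intro a
      by_cases ha : a ∈ u.support
      · obtain ⟨N, hN⟩ := (h a ha).1
        exact ⟨N, fun _ => hN⟩
      · exact ⟨0, fun h => absurd h ha⟩
    choose N hN using h1
    refine ⟨hfin.toFinset.sup N + 1, ?_⟩
    intro c' hc'
    rw [key, PMF.mem_support_bind_iff] at hc'
    obtain ⟨a, ha, hc'⟩ := hc'
    exact halted_mono (Finset.le_sup (f := N) (hfin.mem_toFinset.2 ha)) (hN a ha) c' hc'
  · cases t with
    | zero =>
      rw [stepN, tsum_pure_mul]
      exact h0
    | succ t =>
      rw [key, tsum_bind_mul]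
      refine le_trans (ENNReal.tsum_le_tsum fun a => ?_) hB
      by_cases ha : a ∈ u.support
      · exact mul_le_mul_right ((h a ha).2 t) _
      · rw [PMF.apply_eq_zero_iff u a |>.2 ha]
        simp

theorem Good.time_le {c : Config σ} {B : ENNReal} (h : Good S τ Q c B) :
    (c.time : ENNReal) ≤ B := by
  have := h.2 0
  rwa [stepN, tsum_pure_mul] at this

theorem Good.of_pure {c c1 : Config σ} (hstep : step S τ c = PMF.pure c1)
    (ht : c.time ≤ c1.time) {B : ENNReal} (h : Good S τ Q c1 B) : Good S τ Q c B := by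
  refine Good.of_map (PMF.pure ()) (fun _ => c1) ?_ ?_ (fun _ => B) (fun _ _ => h) ?_ ?_
  · rw [hstep, PMF.pure_map]
  · simp
  · exact le_trans (by exact_mod_cast ht) h.time_le
  · rw [tsum_pure_mul]

theorem Good.mono {c : Config σ} {B B' : ENNReal} (h : Good S τ Q c B) (hB : B ≤ B') :
    Good S τ Q c B' := ⟨h.1, fun t => (h.2 t).trans hB⟩

/-- All runs halt within a common number of steps, so one term of the supremum is already `1`. -/
theorem Good.probOutput {c : Config σ} {A : Set ℝ} {B : ENNReal}
    (h : Good S τ (fun c => c.output ∈ A) c B) : probOutput S τ c A = 1 := by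
  apply le_antisymm
  · refine iSup_le fun t => ?_
    rw [← (PMF.toOuterMeasure_apply_eq_one_iff (stepN S τ c t) Set.univ).2 (Set.subset_univ _)]
    exact (stepN S τ c t).toOuterMeasure.mono (Set.subset_univ _)
  · obtain ⟨N, hN⟩ := h.1
    refine le_iSup_of_le N (le_of_eq ?_)
    symm
    rw [PMF.toOuterMeasure_apply_eq_one_iff]
    exact fun c' hc' => hN c' hc'

theorem Good.expectedTime {c : Config σ} {B : ENNReal} (h : Good S τ Q c B) :
    expectedTime S τ c ≤ B := iSup_le h.2

end Semantics

/-- The contents of the two memories. -/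
structure St (σ : Type*) where
  m : Addr → ℝ
  sm : Addr → Option σ

/-! ### Big-step semantics and a logic of total correctness with running times. -/

section Exec

variable {V σ : Type*} (S : SketchableFamily V σ) (τ : ℕ)

/-- Store a real number. -/
noncomputable def St.set (s : St σ) (a : Addr) (x : ℝ) : St σ := ⟨Function.update s.m a x, s.sm⟩

/-- Store a sketch. -/
noncomputable def St.sset (s : St σ) (a : Addr) (x : Option σ) : St σ :=
  ⟨s.m, Function.update s.sm a x⟩

/-- Big-step semantics of the deterministic part of the language: `Exec p s s' t` says that `p`
transforms `s` into `s'` within time `t`. -/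
inductive Exec : Prog → St σ → St σ → ℕ → Prop
  | skip (s) : Exec .skip s s 1
  | assign (x e) (s : St σ) :
      Exec (.assign x e) s (s.set (x.addr s.m) (e.eval s.m)) (1 + x.size + e.size)
  | skCopy (x y) (s : St σ) :
      Exec (.skCopy x y) s (s.sset (x.addr s.m) (s.sm (y.addr s.m))) (1 + x.size + y.size + τ)
  | skMerge (x y z) (s : St σ) :
      Exec (.skMerge x y z) s
        (s.sset (x.addr s.m) (Option.map₂ S.merge (s.sm (y.addr s.m)) (s.sm (z.addr s.m))))
        (1 + x.size + y.size + z.size + τ)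
  | skTest (x y) (s : St σ) :
      Exec (.skTest x y) s
        (s.set (x.addr s.m) (if (s.sm (y.addr s.m)).any S.oracle then 1 else 0))
        (1 + x.size + y.size + τ)
  | seq (p q s s' s'' t t') : Exec p s s' t → Exec q s' s'' t' → Exec (.seq p q) s s'' (1 + t + t')
  | iteT (a b p q s s' t) : a.eval s.m < b.eval s.m → Exec p s s' t →
      Exec (.ite a b p q) s s' (1 + a.size + b.size + t)
  | iteF (a b p q s s' t) : ¬ a.eval s.m < b.eval s.m → Exec q s s' t →
      Exec (.ite a b p q) s s' (1 + a.size + b.size + t)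
  | loopT (a b p s s' s'' t t') : a.eval s.m < b.eval s.m → Exec p s s' t →
      Exec (.loop a b p) s' s'' t' → Exec (.loop a b p) s s'' (1 + a.size + b.size + t + t')
  | loopF (a b p s) : ¬ a.eval s.m < b.eval s.m → Exec (.loop a b p) s s (1 + a.size + b.size)

variable {S τ}

/-- The bridge between the two semantics: under any stack `k`, a big-step execution may be replaced
by its final state and an advanced clock. -/
theorem Good.of_exec {Q : Config σ → Prop} {p : Prog} {s s' : St σ} {t : ℕ}
    (h : Exec S τ p s s' t) : ∀ (k : List Prog) (T : ℕ) (B : ENNReal),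
      Good S τ Q ⟨k, s'.m, s'.sm, T + t⟩ B → Good S τ Q ⟨p :: k, s.m, s.sm, T⟩ B := by
  induction h with
  | skip s =>
    intro k T B h
    exact Good.of_pure (by simp only [step]) (by simp) h
  | assign x e s =>
    intro k T B h
    refine Good.of_pure (by simp only [step]; rfl) ?_ (by simpa [St.set, add_assoc] using h)
    simp only; omega
  | skCopy x y s =>
    intro k T B h
    refine Good.of_pure (by simp only [step]; rfl) ?_ (by simpa [St.sset, add_assoc] using h)
    simp only; omega
  | skMerge x y z s =>
    intro k T B h
    refine Good.of_pure (by simp only [step]; rfl) ?_ (by simpa [St.sset, add_assoc] using h)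
    simp only; omega
  | skTest x y s =>
    intro k T B h
    refine Good.of_pure (by simp only [step]; rfl) ?_ (by simpa [St.set, add_assoc] using h)
    simp only; omega
  | seq p q s s' s'' t t' _ _ ih1 ih2 =>
    intro k T B h
    refine Good.of_pure (by simp only [step]; rfl) ?_
      (ih1 _ _ _ (ih2 _ _ _ (by simpa [add_assoc] using h)))
    simp
  | iteT a b p q s s' t hc _ ih =>
    intro k T B h
    refine Good.of_pure (by simp only [step, hc, if_true]; rfl) ?_
      (ih _ _ _ (by simpa [add_assoc] using h))
    simp only; omega
  | iteF a b p q s s' t hc _ ih =>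
    intro k T B h
    refine Good.of_pure (by simp only [step, hc, if_false]; rfl) ?_
      (ih _ _ _ (by simpa [add_assoc] using h))
    simp only; omega
  | loopT a b p s s' s'' t t' hc _ _ ih1 ih2 =>
    intro k T B h
    refine Good.of_pure (by simp only [step, hc, if_true]; rfl) ?_
      (ih1 _ _ _ (ih2 _ _ _ (by simpa [add_assoc] using h)))
    simp only; omega
  | loopF a b p s hc =>
    intro k T B h
    refine Good.of_pure (by simp only [step, hc, if_false]; rfl) ?_
      (by simpa [add_assoc] using h)
    simp only; omega

variable (S τ)

/-- Total correctness: `p` started in `s` terminates in a state `s'` after time `t` such that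
`Q s' t` holds. -/
def Tri (p : Prog) (s : St σ) (Q : St σ → ℕ → Prop) : Prop :=
  ∃ s' t, Exec S τ p s s' t ∧ Q s' t

variable {S τ}

theorem Tri.mono {p : Prog} {s : St σ} {Q Q' : St σ → ℕ → Prop} (h : Tri S τ p s Q)
    (hQ : ∀ s' t, Q s' t → Q' s' t) : Tri S τ p s Q' := by
  obtain ⟨s', t, h1, h2⟩ := h
  exact ⟨s', t, h1, hQ _ _ h2⟩

theorem Tri.seq {p q : Prog} {s : St σ} {Q : St σ → ℕ → Prop}
    (h : Tri S τ p s fun s' t => Tri S τ q s' fun s'' t' => Q s'' (1 + t + t')) :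
    Tri S τ (.seq p q) s Q := by
  obtain ⟨s', t, h1, s'', t', h2, h3⟩ := h
  exact ⟨s'', _, Exec.seq _ _ _ _ _ _ _ h1 h2, h3⟩

theorem Tri.ite {a b : RExpr} {p q : Prog} {s : St σ} {Q : St σ → ℕ → Prop}
    (hT : a.eval s.m < b.eval s.m →
      Tri S τ p s fun s' t => Q s' (1 + a.size + b.size + t))
    (hF : ¬ a.eval s.m < b.eval s.m →
      Tri S τ q s fun s' t => Q s' (1 + a.size + b.size + t)) :
    Tri S τ (.ite a b p q) s Q := by
  by_cases h : a.eval s.m < b.eval s.m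
  · obtain ⟨s', t, h1, h2⟩ := hT h
    exact ⟨s', _, Exec.iteT _ _ _ _ _ _ _ h h1, h2⟩
  · obtain ⟨s', t, h1, h2⟩ := hF h
    exact ⟨s', _, Exec.iteF _ _ _ _ _ _ _ h h1, h2⟩

/-- The rule for while loops, with a ghost variable `i` and a bound `Φ i` on the remaining time. -/
theorem Tri.loop {ι : Type*} {a b : RExpr} {p : Prog} (I : ι → St σ → Prop) (Φ : ι → ℕ)
    (h : ∀ i s, I i s → a.eval s.m < b.eval s.m →
      Tri S τ p s fun s' t => ∃ i', I i' s' ∧ 1 + a.size + b.size + t + Φ i' ≤ Φ i)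
    (i : ι) (s : St σ) (hI : I i s) :
    Tri S τ (.loop a b p) s fun s' t => ∃ i', I i' s' ∧ ¬ a.eval s'.m < b.eval s'.m ∧
      t + Φ i' ≤ Φ i + (1 + a.size + b.size) := by
  -- The test alone costs a positive amount of time, so `Φ` strictly decreases and bounds the number
  -- of iterations too.
  induction hn : Φ i using Nat.strong_induction_on generalizing i s with
  | _ n ih =>
    by_cases hc : a.eval s.m < b.eval s.m
    · obtain ⟨s', t, h1, i', h2, h3⟩ := h i s hI hc
      obtain ⟨s'', t', h4, i'', h5, h6, h7⟩ := ih (Φ i') (by omega) i' s' h2 rfl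
      exact ⟨s'', _, Exec.loopT _ _ _ _ _ _ _ _ hc h1 h4, i'', h5, h6, by omega⟩
    · exact ⟨s, _, Exec.loopF _ _ _ _ hc, i, hI, hc, by omega⟩

/-- Programs without loops and random choices. -/
def Prog.Straight : Prog → Prop
  | .rand _ _ => False
  | .seq p q => p.Straight ∧ q.Straight
  | .ite _ _ p q => p.Straight ∧ q.Straight
  | .loop _ _ _ => False
  | _ => True

/-- A bound on the running time of a straight program. -/
def Prog.cost (τ : ℕ) : Prog → ℕ
  | .skip => 1
  | .assign x e => 1 + x.size + e.size
  | .rand _ _ => 0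
  | .skCopy x y => 1 + x.size + y.size + τ
  | .skMerge x y z => 1 + x.size + y.size + z.size + τ
  | .skTest x y => 1 + x.size + y.size + τ
  | .seq p q => 1 + p.cost τ + q.cost τ
  | .ite a b p q => 1 + a.size + b.size + (p.cost τ + q.cost τ)
  | .loop _ _ _ => 0

open Classical in
/-- The effect of a straight program. -/
noncomputable def run (S : SketchableFamily V σ) : Prog → St σ → St σ
  | .skip, s => s
  | .assign x e, s => s.set (x.addr s.m) (e.eval s.m)
  | .rand _ _, s => s
  | .skCopy x y, s => s.sset (x.addr s.m) (s.sm (y.addr s.m))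
  | .skMerge x y z, s =>
      s.sset (x.addr s.m) (Option.map₂ S.merge (s.sm (y.addr s.m)) (s.sm (z.addr s.m)))
  | .skTest x y, s => s.set (x.addr s.m) (if (s.sm (y.addr s.m)).any S.oracle then 1 else 0)
  | .seq p q, s => run S q (run S p s)
  | .ite a b p q, s => if a.eval s.m < b.eval s.m then run S p s else run S q s
  | .loop _ _ _, s => s

/-- Reduces loop-free code to computing `run`. The bound `cost` charges both branches of a
conditional, so it does not depend on the state. -/
theorem exec_run (p : Prog) (hp : p.Straight) (s : St σ) :
    ∃ t ≤ p.cost τ, Exec S τ p s (run S p s) t := by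
  induction p generalizing s with
  | skip => exact ⟨_, le_refl _, Exec.skip s⟩
  | assign x e => exact ⟨_, le_refl _, Exec.assign x e s⟩
  | rand x e => exact hp.elim
  | skCopy x y => exact ⟨_, le_refl _, Exec.skCopy x y s⟩
  | skMerge x y z => exact ⟨_, le_refl _, Exec.skMerge x y z s⟩
  | skTest x y => exact ⟨_, le_refl _, Exec.skTest x y s⟩
  | seq p q ih1 ih2 =>
    obtain ⟨t1, h1, e1⟩ := ih1 hp.1 s
    obtain ⟨t2, h2, e2⟩ := ih2 hp.2 (run S p s)
    exact ⟨_, by simp only [Prog.cost]; omega, Exec.seq _ _ _ _ _ _ _ e1 e2⟩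
  | ite a b p q ih1 ih2 =>
    by_cases hc : a.eval s.m < b.eval s.m
    · obtain ⟨t1, h1, e1⟩ := ih1 hp.1 s
      rw [run, if_pos hc]
      exact ⟨_, by simp only [Prog.cost]; omega, Exec.iteT _ _ _ _ _ _ _ hc e1⟩
    · obtain ⟨t1, h1, e1⟩ := ih2 hp.2 s
      rw [run, if_neg hc]
      exact ⟨_, by simp only [Prog.cost]; omega, Exec.iteF _ _ _ _ _ _ _ hc e1⟩
  | loop a b p => exact hp.elim

theorem Tri.straight {p : Prog} (hp : p.Straight) {s : St σ} {Q : St σ → ℕ → Prop}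
    (h : ∀ t ≤ p.cost τ, Q (run S p s) t) : Tri S τ p s Q := by
  obtain ⟨t, ht, e⟩ := exec_run (S := S) (τ := τ) p hp s
  exact ⟨_, t, e, h t ht⟩

end Exec

end RealRAM

namespace RealRAM

/-! ### Building blocks of programs -/

section Expressions

/-- The scalar variable `x`. -/
def sv (x : ℕ) : RExpr := .read x 0 ![]

/-- A reference to the scalar variable `x`. -/
def sr (x : ℕ) : Ref := ⟨x, 0, ![]⟩

/-- The natural number `a` as an expression. -/
def nat (a : ℕ) : RExpr := .const a

/-- The entry with key `[a]` of table `x`. -/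
def ref1 (x : ℕ) (a : RExpr) : Ref := ⟨x, 1, ![a]⟩

/-- The entry with key `[a, b]` of table `x`. -/
def ref2 (x : ℕ) (a b : RExpr) : Ref := ⟨x, 2, ![a, b]⟩

/-- The entry with key `g :: f` of table `x`. -/
def refC (x : ℕ) (g : RExpr) {d : ℕ} (f : Fin d → RExpr) : Ref := ⟨x, d + 1, Fin.cons g f⟩

/-- The value stored at a reference. -/
def Ref.get (x : Ref) : RExpr := .read x.tbl x.arity x.idx

/-- The sum of finitely many expressions. -/
def sumE : (k : ℕ) → (Fin k → RExpr) → RExpr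
  | 0, _ => .const 0
  | k + 1, f => .add (f 0) (sumE k fun i => f i.succ)

/-- A power with a fixed exponent. -/
def powE (a : RExpr) : ℕ → RExpr
  | 0 => .const 1
  | k + 1 => .mul (powE a k) a

variable (m : Addr → ℝ)

@[simp] theorem eval_sv (x : ℕ) : (sv x).eval m = m (x, []) := by simp [sv, RExpr.eval]
@[simp] theorem eval_nat (a : ℕ) : (nat a).eval m = a := by simp [nat, RExpr.eval]
@[simp] theorem addr_sr (x : ℕ) : (sr x).addr m = (x, []) := by simp [sr, Ref.addr]
@[simp] theorem addr_ref1 (x : ℕ) (a : RExpr) : (ref1 x a).addr m = (x, [⌊a.eval m⌋]) := by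
  simp [ref1, Ref.addr]
@[simp] theorem addr_ref2 (x : ℕ) (a b : RExpr) :
    (ref2 x a b).addr m = (x, [⌊a.eval m⌋, ⌊b.eval m⌋]) := by
  simp [ref2, Ref.addr]
@[simp] theorem addr_refC (x : ℕ) (g : RExpr) {d : ℕ} (f : Fin d → RExpr) :
    (refC x g f).addr m = (x, ⌊g.eval m⌋ :: List.ofFn fun j => ⌊(f j).eval m⌋) := by
  simp [refC, Ref.addr, List.ofFn_succ]
@[simp] theorem eval_get (x : Ref) : x.get.eval m = m (x.addr m) := by
  simp [Ref.get, RExpr.eval, Ref.addr]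
@[simp] theorem eval_sumE (k : ℕ) (f : Fin k → RExpr) :
    (sumE k f).eval m = ∑ i, (f i).eval m := by
  induction k with
  | zero => simp [sumE, RExpr.eval]
  | succ k ih => simp [sumE, RExpr.eval, ih, Fin.sum_univ_succ]
@[simp] theorem eval_powE (a : RExpr) (k : ℕ) : (powE a k).eval m = a.eval m ^ k := by
  induction k with
  | zero => simp [powE, RExpr.eval]
  | succ k ih => simp [powE, RExpr.eval, ih, pow_succ]
@[simp] theorem eval_add (a b : RExpr) : (RExpr.add a b).eval m = a.eval m + b.eval m := rfl
@[simp] theorem eval_sub (a b : RExpr) : (RExpr.sub a b).eval m = a.eval m - b.eval m := rfl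
@[simp] theorem eval_mul (a b : RExpr) : (RExpr.mul a b).eval m = a.eval m * b.eval m := rfl
@[simp] theorem eval_div (a b : RExpr) : (RExpr.div a b).eval m = a.eval m / b.eval m := rfl
@[simp] theorem eval_sqrt (a : RExpr) : (RExpr.sqrt a).eval m = √(a.eval m) := rfl
@[simp] theorem eval_floor (a : RExpr) : (RExpr.floor a).eval m = (⌊a.eval m⌋ : ℝ) := rfl
@[simp] theorem eval_const (q : ℚ) : (RExpr.const q).eval m = (q : ℝ) := rfl

@[simp] theorem size_sr (x : ℕ) : (sr x).size = 1 := by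
  change 1 + ∑ i : Fin 0, _ = 1
  simp
@[simp] theorem size_sv (x : ℕ) : (sv x).size = 1 := by
  change 1 + ∑ i : Fin 0, _ = 1
  simp
@[simp] theorem size_nat (a : ℕ) : (nat a).size = 1 := rfl

end Expressions

/-! ### Frame reasoning -/

section Frame

variable {V σ : Type*} {S : SketchableFamily V σ} {τ : ℕ}

@[simp] theorem St.set_m (s : St σ) (a : Addr) (x : ℝ) (b : Addr) :
    (s.set a x).m b = if b = a then x else s.m b := by
  simp [St.set, Function.update_apply]
@[simp] theorem St.set_sm (s : St σ) (a : Addr) (x : ℝ) : (s.set a x).sm = s.sm := rfl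
@[simp] theorem St.sset_sm (s : St σ) (a : Addr) (x : Option σ) (b : Addr) :
    (s.sset a x).sm b = if b = a then x else s.sm b := by
  simp [St.sset, Function.update_apply]
@[simp] theorem St.sset_m (s : St σ) (a : Addr) (x : Option σ) : (s.sset a x).m = s.m := rfl

/-- A counting loop: `x` runs from `0` up to (excluding) `e`. -/
def forP (x : ℕ) (e : RExpr) (p : Prog) : Prog :=
  .seq (.assign (sr x) (nat 0))
    (.loop (sv x) e (.seq p (.assign (sr x) (.add (sv x) (nat 1)))))

/-- The body must leave the counter alone, and `J (i + 1)` is demanded of the state after the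
increment that follows it. The summand `20` generously covers initialisation, test and increment. -/
theorem Tri.forP {x : ℕ} {e : RExpr} {p : Prog} (N T : ℕ) (J : ℕ → St σ → Prop)
    (hN : ∀ i s, J i s → e.eval s.m = N)
    (hx : ∀ i s, J i s → s.m (x, []) = i)
    (hp : ∀ i < N, ∀ s, J i s → Tri S τ p s fun s' t =>
      t ≤ T ∧ s'.m (x, []) = i ∧ J (i + 1) (s'.set (x, []) (i + 1)))
    (s : St σ) (h0 : J 0 (s.set (x, []) 0)) :
    Tri S τ (forP x e p) s fun s' t => J N s' ∧ t ≤ (N + 1) * (T + 20 + e.size) := by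
  refine Tri.seq (Tri.straight (by simp [Prog.Straight]) fun t ht => ?_)
  have h1 : run S (.assign (sr x) (nat 0)) s = s.set (x, []) 0 := by simp [run]
  rw [h1]
  have ht' : t ≤ 3 := by simpa [Prog.cost] using ht
  refine (Tri.loop (fun i s => i ≤ N ∧ J i s) (fun i => (N - i) * (T + 12 + e.size)) ?_ 0 _
    ⟨Nat.zero_le _, h0⟩).mono ?_
  · rintro i s ⟨hi, hJ⟩ hc
    rw [hN i s hJ, eval_sv, hx i s hJ] at hc
    have hi' : i < N := by exact_mod_cast hc
    refine Tri.seq ((hp i hi' s hJ).mono ?_)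
    rintro s' t' ⟨ht', hx', hJ'⟩
    refine Tri.straight (by simp [Prog.Straight]) fun t'' ht'' => ⟨i + 1, ⟨hi', ?_⟩, ?_⟩
    · simpa [run, hx'] using hJ'
    · simp [Prog.cost, RExpr.size] at ht'' ⊢
      obtain ⟨q, hq⟩ : ∃ q, N = i + 1 + q := ⟨N - (i + 1), by omega⟩
      have h2 : N - (i + 1) = q := by omega
      have h3 : N - i = q + 1 := by omega
      rw [h2, h3, add_mul]
      omega
  · rintro s' t' ⟨i, ⟨hi, hJ⟩, hc, hT⟩
    rw [hN i s' hJ, eval_sv, hx i s' hJ] at hc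
    have hi' : i = N := le_antisymm hi (by exact_mod_cast not_lt.1 hc)
    subst hi'
    refine ⟨hJ, ?_⟩
    simp at hT
    nlinarith

end Frame

end RealRAM

namespace RealRAM

/-! ### Enumerating the offsets in a box -/

section Offsets

/-- The `j`-th coordinate of the `e`-th vector of the box `{-M, …, M}^d`. -/
def off (M e j : ℕ) : ℤ := (e / (2 * M + 1) ^ j % (2 * M + 1) : ℕ) - M

/-- Completeness of the enumeration: shifted by `M`, a vector of the box is the string of base `2 *
M + 1` digits of some number `e`. -/
theorem exists_off {d : ℕ} (M : ℕ) (o : Fin d → ℤ) (ho : ∀ j, |o j| ≤ M) :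
    ∃ e < (2 * M + 1) ^ d, ∀ j : Fin d, off M e j = o j := by
  let f : Fin d → Fin (2 * M + 1) := fun j => ⟨(o j + M).toNat, by
    have := abs_le.1 (ho j); omega⟩
  refine ⟨finFunctionFinEquiv f, (finFunctionFinEquiv f).2, fun j => ?_⟩
  have h := congrArg (fun g : Fin d → Fin (2 * M + 1) => ((g j : ℕ) : ℤ))
    (finFunctionFinEquiv.symm_apply_apply f)
  simp only [finFunctionFinEquiv_symm_apply_val] at h
  rw [off, h]
  have := abs_le.1 (ho j)
  simp only [f]
  omega

/-- The side of the box of offsets that has to be searched. -/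
def boxM (d : ℕ) : RExpr := .add (sv 7) (nat d)

def boxB (d : ℕ) : RExpr := .add (.mul (nat 2) (boxM d)) (nat 1)

/-- The `j`-th coordinate of the offset with the number stored in the variable `15`. -/
def offE (d j : ℕ) : RExpr :=
  .sub (.sub (.floor (.div (sv 15) (powE (boxB d) j)))
    (.mul (boxB d) (.floor (.div (sv 15) (powE (boxB d) (j + 1)))))) (boxM d)

theorem eval_boxM {m : Addr → ℝ} {d K : ℕ} (hK : m (7, []) = K) :
    (boxM d).eval m = (K + d : ℕ) := by simp [boxM, hK]

theorem eval_boxB {m : Addr → ℝ} {d K : ℕ} (hK : m (7, []) = K) :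
    (boxB d).eval m = (2 * (K + d) + 1 : ℕ) := by simp [boxB, boxM, hK]

/-- With real division and floor only, the `j`-th digit in base `B` is computed as `⌊e / B ^ j⌋ - B
* ⌊e / B ^ (j + 1)⌋`. -/
theorem eval_offE {m : Addr → ℝ} {d K e : ℕ} (hK : m (7, []) = K) (he : m (15, []) = e) (j : ℕ) :
    (offE d j).eval m = off (K + d) e j := by
  have hB := eval_boxB (d := d) hK
  have hM := eval_boxM (d := d) hK
  set B := 2 * (K + d) + 1 with hBdef
  have h1 : ∀ i : ℕ, ⌊(e : ℝ) / (B : ℝ) ^ i⌋ = ((e / B ^ i : ℕ) : ℤ) := by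
    intro i
    have := Nat.floor_div_eq_div (K := ℝ) e (B ^ i)
    push_cast at this
    rw [← this]
    exact (Int.natCast_floor_eq_floor (by positivity)).symm
  simp only [offE, eval_sub, eval_floor, eval_div, eval_sv, eval_powE, eval_mul, he, hB, hM, h1]
  rw [off, ← hBdef]
  have h2 := Nat.div_add_mod (e / B ^ j) B
  rw [Nat.div_div_eq_div_mul, ← pow_succ] at h2
  generalize e / B ^ j % B = r at *
  generalize e / B ^ j = a at *
  rw [← h2]
  push_cast
  ring

end Offsets

/-! ### The state of the search on the grid -/

section Grid

/-- Two cells of the grid are adjacent when their distance is at most `K + d`. -/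
def CellAdj (K : ℕ) {d : ℕ} (z w : Fin d → ℤ) : Prop :=
  ∑ j, (w j - z j) * (w j - z j) ≤ ((K + d : ℕ) : ℤ) * (K + d : ℕ)

/-- Everything outside the tables in `X` and the sketch tables in `Y` is unchanged. -/
def Keeps {σ : Type*} (X Y : List ℕ) (s s' : St σ) : Prop :=
  (∀ a, a.1 ∉ X → s'.m a = s.m a) ∧ ∀ a, a.1 ∉ Y → s'.sm a = s.sm a

theorem Keeps.refl {σ : Type*} (X Y : List ℕ) (s : St σ) : Keeps X Y s s :=
  ⟨fun _ _ => rfl, fun _ _ => rfl⟩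

theorem Keeps.trans {σ : Type*} {X Y : List ℕ} {s s' s'' : St σ} (h : Keeps X Y s s')
    (h' : Keeps X Y s' s'') : Keeps X Y s s'' :=
  ⟨fun a ha => (h'.1 a ha).trans (h.1 a ha), fun a ha => (h'.2 a ha).trans (h.2 a ha)⟩

theorem Keeps.mono {σ : Type*} {X Y X' Y' : List ℕ} {s s' : St σ} (h : Keeps X Y s s')
    (hX : X ⊆ X') (hY : Y ⊆ Y') : Keeps X' Y' s s' :=
  ⟨fun a ha => h.1 a fun hh => ha (hX hh), fun a ha => h.2 a fun hh => ha (hY hh)⟩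

variable {V σ : Type*} {n d : ℕ}

/-- The points of the current list, the parameters of the grid, and the coordinates. -/
structure Env (s : St σ) (P : Fin n → EuclideanSpace ℝ (Fin d)) (k L K g : ℕ) (side : ℝ)
    (idx : ℕ → Fin n) : Prop where
  size : s.m (4, []) = k
  list : s.m (5, []) = L
  side : s.m (6, []) = side
  K : s.m (7, []) = K
  grid : s.m (11, []) = g
  entry : ∀ j < k, s.m (10, [(L : ℤ), (j : ℤ)]) = (idx j : ℕ)
  coord : ∀ (i : Fin n) (j : Fin d), s.m (2, [((i : ℕ) : ℤ), ((j : ℕ) : ℤ)]) = P i j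

theorem Env.congr {s s' : St σ} {P : Fin n → EuclideanSpace ℝ (Fin d)} {k L K g : ℕ} {side : ℝ}
    {idx : ℕ → Fin n} (h : Env s P k L K g side idx)
    (h' : ∀ a, a.1 ∈ [2, 4, 5, 6, 7, 10, 11] → s'.m a = s.m a) : Env s' P k L K g side idx where
  size := by rw [h' _ (by simp), h.size]
  list := by rw [h' _ (by simp), h.list]
  side := by rw [h' _ (by simp), h.side]
  K := by rw [h' _ (by simp), h.K]
  grid := by rw [h' _ (by simp), h.grid]
  entry j hj := by rw [h' _ (by simp), h.entry j hj]
  coord i j := by rw [h' _ (by simp), h.coord i j]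

/-- The cell of the `j`-th point of the list. -/
noncomputable def cellOf (P : Fin n → EuclideanSpace ℝ (Fin d)) (side : ℝ) (idx : ℕ → Fin n)
    (i : ℕ) : Fin d → ℤ := fun j => ⌊P (idx i) j / side⌋

/-- The `j`-th coordinate of the point with position `i` in the list. -/
def coordE (i : RExpr) (j : ℕ) : RExpr := (ref2 2 (ref2 10 (sv 5) i).get (nat j)).get

/-- The `j`-th coordinate of that point, in units of the grid. -/
def cellE (i : RExpr) (j : ℕ) : RExpr := .div (coordE i j) (sv 6)

theorem Env.eval_coordE {s : St σ} {P : Fin n → EuclideanSpace ℝ (Fin d)} {k L K g : ℕ} {side : ℝ}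
    {idx : ℕ → Fin n} (h : Env s P k L K g side idx) {e : RExpr} {i : ℕ} (he : e.eval s.m = i)
    (hi : i < k) (j : Fin d) : (coordE e j).eval s.m = P (idx i) j := by
  have h1 : ⌊(((j : ℕ) : ℕ) : ℝ)⌋ = ((j : ℕ) : ℤ) := by simp
  simp only [coordE, eval_get, addr_ref2, eval_sv, he, eval_nat, h.list, Int.floor_natCast,
    h.entry i hi, h.coord]

theorem Env.floor_cellE {s : St σ} {P : Fin n → EuclideanSpace ℝ (Fin d)} {k L K g : ℕ} {side : ℝ}
    {idx : ℕ → Fin n} (h : Env s P k L K g side idx) {e : RExpr} {i : ℕ} (he : e.eval s.m = i)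
    (hi : i < k) (j : Fin d) : ⌊(cellE e j).eval s.m⌋ = cellOf P side idx i j := by
  rw [cellE, eval_div, h.eval_coordE he hi, eval_sv, h.side, cellOf]

/-- The union of the sets of the points in the cells in `Z`. -/
def unionOf (k : ℕ) (cell : ℕ → Fin d → ℤ) (A : ℕ → Set V) (Z : Finset (Fin d → ℤ)) : Set V :=
  {v | ∃ j < k, cell j ∈ Z ∧ v ∈ A j}

theorem unionOf_insert (k : ℕ) (cell : ℕ → Fin d → ℤ) (A : ℕ → Set V) (z : Fin d → ℤ)
    (Z : Finset (Fin d → ℤ)) :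
    unionOf k cell A (insert z Z) = unionOf k cell A Z ∪ unionOf k cell A {z} := by
  ext v
  simp only [unionOf, Finset.mem_insert, Set.mem_ofPred_eq, Set.mem_union, Finset.mem_singleton]
  constructor
  · rintro ⟨j, hj, h | h, hv⟩
    · exact .inr ⟨j, hj, h, hv⟩
    · exact .inl ⟨j, hj, h, hv⟩
  · rintro (⟨j, hj, h, hv⟩ | ⟨j, hj, h, hv⟩)
    · exact ⟨j, hj, .inr h, hv⟩
    · exact ⟨j, hj, .inl h, hv⟩

/-- The sets of the first `k` points are pairwise disjoint. -/
def DisjointSets (k : ℕ) (A : ℕ → Set V) : Prop :=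
  ∀ i < k, ∀ j < k, i ≠ j → Disjoint (A i) (A j)

/-- Sketches can be combined only for disjoint sets; this supplies the disjointness whenever a new
cell joins a cluster. -/
theorem unionOf_disjoint {k : ℕ} {cell : ℕ → Fin d → ℤ} {A : ℕ → Set V} (hA : DisjointSets k A)
    {z : Fin d → ℤ} {Z : Finset (Fin d → ℤ)} (hz : z ∉ Z) :
    Disjoint (unionOf k cell A Z) (unionOf k cell A {z}) := by
  rw [Set.disjoint_left]
  rintro v ⟨i, hi, h, hv⟩ ⟨j, hj, h', hv'⟩
  rw [Finset.mem_singleton] at h'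
  have hij : i ≠ j := by
    rintro rfl
    exact hz (h' ▸ h)
  exact Set.disjoint_left.1 (hA i hi j hj hij) hv hv'

/-- The hash tables hold exactly the (nonempty) cells in `W`, with one point of each cell and the
sketch of the union of the sets of its points. -/
structure Grid (S : SketchableFamily V σ) (s : St σ) (k g : ℕ) (cell : ℕ → Fin d → ℤ)
    (A : ℕ → Set V) (W : Finset (Fin d → ℤ)) : Prop where
  mem : ∀ z ∈ W, ∃ j < k, cell j = z ∧ s.m (12, (g : ℤ) :: List.ofFn z) = j + 1
  not_mem : ∀ z ∉ W, s.m (12, (g : ℤ) :: List.ofFn z) = 0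
  sketch : ∀ z ∈ W, s.sm (2, (g : ℤ) :: List.ofFn z) = some (S.sketch (unionOf k cell A {z}))

/-- Tables of grids with numbers above `g` have not been used. -/
def Fresh (s : St σ) (g : ℕ) : Prop :=
  ∀ g' : ℤ, (g : ℤ) < g' → ∀ z, s.m (12, g' :: z) = 0 ∧ s.m (13, g' :: z) = 0

/-- The queue holds the positions `q 0, …, q (t - 1)`. -/
structure Queue (s : St σ) (k t : ℕ) (q : ℕ → ℕ) : Prop where
  tail : s.m (17, []) = t
  entry : ∀ p < t, s.m (18, [(p : ℤ)]) = q p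
  lt : ∀ p < t, q p < k

/-- The key of the neighbouring cell of the cell of the point in `20` with the current offset. -/
def nbKey (d : ℕ) (j : Fin d) : RExpr := .add (.floor (cellE (sv 20) j)) (offE d j)

def nbRep (d : ℕ) : Ref := refC 12 (sv 11) (nbKey d)
def nbSketch (d : ℕ) : Ref := refC 2 (sv 11) (nbKey d)

/-- Is the current offset at most `K + d` in length? -/
def inBall (d : ℕ) (p : Prog) : Prog :=
  .ite (sumE d fun j => .mul (offE d j) (offE d j)) (.add (.mul (boxM d) (boxM d)) (nat 1)) p .skip

/-- Move the current neighbouring cell from the hash table to the queue, and add its sketch to the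
sketch of the current cluster. -/
def pushNb (d : ℕ) : Prog :=
  .seq (.assign (ref1 18 (sv 17)) (.sub (nbRep d).get (nat 1)))
    (.seq (.assign (sr 17) (.add (sv 17) (nat 1)))
      (.seq (.assign (nbRep d) (nat 0)) (.skMerge (sr 3) (sr 3) (nbSketch d))))

def expandBody (d : ℕ) : Prog :=
  inBall d (.ite (nat 0) (nbRep d).get (pushNb d) .skip)

/-- Move all the cells in the hash table that are adjacent to the cell of the point in `20` to the
queue. -/
def expand (d : ℕ) : Prog := forP 15 (powE (boxB d) d) (expandBody d)

end Grid

end RealRAM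

namespace RealRAM

/-! ### Collecting all unvisited cells adjacent to a given one. -/

section Expand

variable {V σ : Type*} {n d : ℕ} {S : SketchableFamily V σ} {τ : ℕ}
  {P : Fin n → EuclideanSpace ℝ (Fin d)} {k L K g : ℕ} {side : ℝ} {idx : ℕ → Fin n}

/-- The neighbouring cell of the cell of the point with position `i` for the offset number `e`. -/
noncomputable def nbCell (P : Fin n → EuclideanSpace ℝ (Fin d)) (K : ℕ) (side : ℝ)
    (idx : ℕ → Fin n) (i e : ℕ) : Fin d → ℤ :=
  fun j => cellOf P side idx i j + off (K + d) e j

theorem Env.floor_nbKey {s : St σ} (h : Env s P k L K g side idx) {i e : ℕ} (hi : i < k)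
    (hv : s.m (20, []) = i) (he : s.m (15, []) = e) (j : Fin d) :
    ⌊(nbKey d j).eval s.m⌋ = nbCell P K side idx i e j := by
  rw [nbKey, eval_add, eval_floor, h.floor_cellE (by rw [eval_sv, hv]) hi, eval_offE h.K he,
    nbCell, ← Int.cast_add, Int.floor_intCast]

theorem Env.addr_nb {s : St σ} (h : Env s P k L K g side idx) {i e : ℕ} (hi : i < k)
    (hv : s.m (20, []) = i) (he : s.m (15, []) = e) (x : ℕ) :
    (refC x (sv 11) (nbKey d)).addr s.m =
      (x, (g : ℤ) :: List.ofFn (nbCell P K side idx i e)) := by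
  rw [addr_refC]
  simp only [h.floor_nbKey hi hv he, eval_sv, h.grid, Int.floor_natCast]

theorem Env.run_inBall {s : St σ} (h : Env s P k L K g side idx) {i e : ℕ}
    (he : s.m (15, []) = e) (p : Prog) :
    (CellAdj K (cellOf P side idx i) (nbCell P K side idx i e) →
      run S (inBall d p) s = run S p s) ∧
    (¬ CellAdj K (cellOf P side idx i) (nbCell P K side idx i e) →
      run S (inBall d p) s = s) := by
  have h1 : (sumE d fun j => .mul (offE d j) (offE d j)).eval s.m <
      (RExpr.add (.mul (boxM d) (boxM d)) (nat 1)).eval s.m ↔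
      CellAdj K (cellOf P side idx i) (nbCell P K side idx i e) := by
    simp only [eval_sumE, eval_mul, eval_offE h.K he, eval_add, eval_boxM h.K, eval_nat, CellAdj,
      nbCell, add_sub_cancel_left]
    -- The machine compares by `<` only; between integers `a ≤ b` is tested as `a < b + 1`.
    rw [← Int.lt_add_one_iff]
    exact_mod_cast Iff.rfl
  constructor
  · intro h2
    rw [inBall, run, if_pos (h1.2 h2)]
  · intro h2
    rw [inBall, run, if_neg fun h3 => h2 (h1.1 h3), run]

/-- The effect of `pushNb`. -/
theorem Env.run_pushNb {s : St σ} (h : Env s P k L K g side idx) {i e t : ℕ} (hi : i < k)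
    (hv : s.m (20, []) = i) (he : s.m (15, []) = e) (ht : s.m (17, []) = t) {r : ℕ}
    (hr : s.m (12, (g : ℤ) :: List.ofFn (nbCell P K side idx i e)) = r + 1) :
    run S (pushNb d) s = (((s.set (18, [(t : ℤ)]) r).set (17, []) (t + 1 : ℕ)).set
      (12, (g : ℤ) :: List.ofFn (nbCell P K side idx i e)) 0).sset (3, [])
      (Option.map₂ S.merge (s.sm (3, []))
        (s.sm (2, (g : ℤ) :: List.ofFn (nbCell P K side idx i e)))) := by
  have e1 : run S (.assign (ref1 18 (sv 17)) (.sub (nbRep d).get (nat 1))) s =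
      s.set (18, [(t : ℤ)]) r := by
    simp [run, nbRep, h.addr_nb hi hv he, ht, hr]
  have e2 : run S (.assign (sr 17) (.add (sv 17) (nat 1))) (s.set (18, [(t : ℤ)]) r) =
      (s.set (18, [(t : ℤ)]) r).set (17, []) (t + 1 : ℕ) := by
    simp [run, ht]
  have h2 : Env ((s.set (18, [(t : ℤ)]) r).set (17, []) (t + 1 : ℕ)) P k L K g side idx := by
    refine h.congr fun a ha => ?_
    rw [St.set_m, if_neg, St.set_m, if_neg] <;> rintro rfl <;> simp at ha
  have e3 := h2.addr_nb hi (e := e) (by simp [hv]) (by simp [he]) 12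
  have h3 : Env (((s.set (18, [(t : ℤ)]) r).set (17, []) (t + 1 : ℕ)).set
      (12, (g : ℤ) :: List.ofFn (nbCell P K side idx i e)) 0) P k L K g side idx := by
    refine h2.congr fun a ha => ?_
    rw [St.set_m, if_neg]; rintro rfl; simp at ha
  have e4 := h3.addr_nb hi (e := e) (by simp [hv]) (by simp [he]) 2
  rw [pushNb, run, e1, run, e2, run]
  rw [run, nbRep, e3, eval_nat, Nat.cast_zero, run, nbSketch, e4]
  simp

/-- The part of the state that a search on the grid changes: the unvisited cells `W`, the visited
cells `C` of the current cluster, and the queue. -/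
structure Walk (S : SketchableFamily V σ) (s : St σ) (k g : ℕ) (cell : ℕ → Fin d → ℤ)
    (A : ℕ → Set V) (W C : Finset (Fin d → ℤ)) (t : ℕ) (q : ℕ → ℕ) : Prop where
  grid : Grid S s k g cell A W
  cluster : s.sm (3, []) = some (S.sketch (unionOf k cell A C))
  queue : Queue s k t q

theorem Grid.congr {s s' : St σ} {cell : ℕ → Fin d → ℤ} {A : ℕ → Set V}
    {W : Finset (Fin d → ℤ)} (h : Grid S s k g cell A W)
    (h1 : ∀ a, a.1 = 12 → s'.m a = s.m a) (h2 : ∀ a, a.1 = 2 → s'.sm a = s.sm a) :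
    Grid S s' k g cell A W where
  mem z hz := by rw [h1 _ rfl]; exact h.mem z hz
  not_mem z hz := by rw [h1 _ rfl]; exact h.not_mem z hz
  sketch z hz := by rw [h2 _ rfl]; exact h.sketch z hz

theorem Queue.congr {s s' : St σ} {t : ℕ} {q : ℕ → ℕ} (h : Queue s k t q)
    (h1 : ∀ a, a.1 ∈ [17, 18] → s'.m a = s.m a) : Queue s' k t q where
  tail := by rw [h1 _ (by simp)]; exact h.tail
  entry p hp := by rw [h1 _ (by simp)]; exact h.entry p hp
  lt := h.lt

theorem Walk.congr {s s' : St σ} {cell : ℕ → Fin d → ℤ} {A : ℕ → Set V}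
    {W C : Finset (Fin d → ℤ)} {t : ℕ} {q : ℕ → ℕ} (h : Walk S s k g cell A W C t q)
    (h1 : ∀ a, a.1 ∈ [12, 17, 18] → s'.m a = s.m a) (h2 : ∀ a, a.1 ∈ [2, 3] → s'.sm a = s.sm a) :
    Walk S s' k g cell A W C t q where
  grid := h.grid.congr (fun a ha => h1 a (by simp [ha])) (fun a ha => h2 a (by simp [ha]))
  cluster := by rw [h2 _ (by simp)]; exact h.cluster
  queue := h.queue.congr fun a ha => h1 a (by
    simp only [List.mem_cons, List.not_mem_nil, or_false] at ha ⊢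
    exact .inr ha)

/-- Moving a cell `z` from the hash table to the queue. -/
theorem Walk.push {s : St σ} {cell : ℕ → Fin d → ℤ} {A : ℕ → Set V} (hA : DisjointSets k A)
    {W C : Finset (Fin d → ℤ)} {t : ℕ} {q : ℕ → ℕ} (h : Walk S s k g cell A W C t q)
    (hWC : Disjoint W C) {z : Fin d → ℤ} (hz : z ∈ W) {r : ℕ} (hr : r < k) :
    Walk S ((((s.set (18, [(t : ℤ)]) r).set (17, []) (t + 1 : ℕ)).set
      (12, (g : ℤ) :: List.ofFn z) 0).sset (3, []) (Option.map₂ S.merge (s.sm (3, []))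
        (s.sm (2, (g : ℤ) :: List.ofFn z)))) k g cell A (W.erase z) (insert z C) (t + 1)
      (Function.update q t r) where
  grid := by
    refine ⟨fun w hw => ?_, fun w hw => ?_, fun w hw => ?_⟩
    · rw [Finset.mem_erase] at hw
      obtain ⟨j, hj, hc, hm⟩ := h.grid.mem w hw.2
      refine ⟨j, hj, hc, ?_⟩
      simp [hm, List.ofFn_inj, hw.1]
    · by_cases hwz : w = z
      · subst hwz
        simp
      · have hw' : w ∉ W := fun h' => hw (Finset.mem_erase.2 ⟨hwz, h'⟩)
        simp [List.ofFn_inj, hwz, h.grid.not_mem w hw']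
    · rw [Finset.mem_erase] at hw
      simpa using h.grid.sketch w hw.2
  cluster := by
    have hzC : z ∉ C := fun h' => Finset.disjoint_left.1 hWC hz h'
    rw [St.sset_sm, if_pos rfl, h.cluster, h.grid.sketch z hz, Option.map₂_some_some,
      unionOf_insert, S.sketch_union _ _ (unionOf_disjoint hA hzC)]
  queue := by
    refine ⟨by simp, fun p hp => ?_, fun p hp => ?_⟩
    · rcases eq_or_ne p t with rfl | hpt
      · simp
      · have := h.queue.entry p (by omega)
        simp [hpt, this]
    · rcases eq_or_ne p t with rfl | hpt
      · simpa using hr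
      · rw [Function.update_of_ne hpt]
        exact h.queue.lt p (by omega)

theorem straight_expandBody : (expandBody d).Straight :=
  ⟨⟨⟨trivial, trivial, trivial, trivial⟩, trivial⟩, trivial⟩

/-- The ball of adjacent offsets lies in the enumerated box, so running through the box misses no
adjacent cell. -/
theorem abs_le_of_cellAdj {z w : Fin d → ℤ} (h : CellAdj K z w) (j : Fin d) :
    |w j - z j| ≤ (K + d : ℕ) := by
  have h1 : (w j - z j) * (w j - z j) ≤ ∑ j, (w j - z j) * (w j - z j) :=
    Finset.single_le_sum (f := fun j => (w j - z j) * (w j - z j))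
      (fun i _ => mul_self_nonneg _) (Finset.mem_univ j)
  have h2 := h1.trans h
  exact abs_le_of_sq_le_sq (by rw [sq, sq]; exact h2) (Nat.cast_nonneg _)

/-- What a call of `expand` at the position `i` achieves. -/
structure Expanded (K : ℕ) (cell : ℕ → Fin d → ℤ) (i : ℕ) (W C W' C' : Finset (Fin d → ℤ))
    (t t' : ℕ) (q q' : ℕ → ℕ) : Prop where
  adj : ∀ z ∈ W, z ∉ W' → CellAdj K (cell i) z
  sub : W' ⊆ W
  union : ∀ z, z ∈ C' ↔ z ∈ C ∨ z ∈ W ∧ z ∉ W'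
  le : t ≤ t'
  old : ∀ p < t, q' p = q p
  new : ∀ p, t ≤ p → p < t' → cell (q' p) ∈ W ∧ cell (q' p) ∉ W'
  all : ∀ z ∈ W, z ∉ W' → ∃ p, t ≤ p ∧ p < t' ∧ cell (q' p) = z
  -- A cell leaves the table exactly when it enters the queue; this is what keeps the length of the
  -- queue at most `k`.
  card : t' + W'.card = t + W.card

theorem Expanded.refl (cell : ℕ → Fin d → ℤ) (i : ℕ) (W C : Finset (Fin d → ℤ)) (t : ℕ)
    (q : ℕ → ℕ) : Expanded K cell i W C W C t t q q where
  adj z h h' := absurd h h'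
  sub := Finset.Subset.refl _
  union z := ⟨.inl, by rintro (h | ⟨h, h'⟩); exacts [h, absurd h h']⟩
  le := le_rfl
  old _ _ := rfl
  new p h h' := absurd h (by omega)
  all z h h' := absurd h h'
  card := rfl

theorem Expanded.push {cell : ℕ → Fin d → ℤ} {i : ℕ} {W C W' C' : Finset (Fin d → ℤ)}
    {t t' : ℕ} {q q' : ℕ → ℕ} (h : Expanded K cell i W C W' C' t t' q q') {z : Fin d → ℤ}
    (hz : z ∈ W') (ha : CellAdj K (cell i) z) {r : ℕ} (hr : cell r = z) :
    Expanded K cell i W C (W'.erase z) (insert z C') t (t' + 1) q (Function.update q' t' r) where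
  adj w hw hw' := by
    by_cases hwz : w = z
    · rw [hwz]; exact ha
    · exact h.adj w hw fun h' => hw' (Finset.mem_erase.2 ⟨hwz, h'⟩)
  sub := (Finset.erase_subset _ _).trans h.sub
  union w := by
    rw [Finset.mem_insert, h.union, Finset.mem_erase]
    have := @h.sub w
    by_cases hwz : w = z
    · subst hwz
      simp [h.sub hz]
    · simp [hwz]
  le := by have := h.le; omega
  old p hp := by
    have := h.le
    rw [Function.update_of_ne (by omega), h.old p hp]
  new p hp hp' := by
    rcases eq_or_ne p t' with rfl | hpt
    · simp [hr, h.sub hz]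
    · rw [Function.update_of_ne hpt]
      have := h.new p hp (by omega)
      exact ⟨this.1, fun h' => this.2 (Finset.mem_of_mem_erase h')⟩
  all w hw hw' := by
    by_cases hwz : w = z
    · subst hwz
      exact ⟨t', h.le, by omega, by simp [hr]⟩
    · obtain ⟨p, h1, h2, h3⟩ := h.all w hw fun h' => hw' (Finset.mem_erase.2 ⟨hwz, h'⟩)
      exact ⟨p, h1, by omega, by rw [Function.update_of_ne (by omega), h3]⟩
  card := by
    have := Finset.card_erase_add_one hz
    have := h.card
    omega

theorem Expanded.disjoint {cell : ℕ → Fin d → ℤ} {i : ℕ} {W C W' C' : Finset (Fin d → ℤ)}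
    {t t' : ℕ} {q q' : ℕ → ℕ} (h : Expanded K cell i W C W' C' t t' q q') (hWC : Disjoint W C) :
    Disjoint W' C' := by
  rw [Finset.disjoint_left]
  intro z hz hz'
  rcases (h.union z).1 hz' with h1 | h1
  · exact Finset.disjoint_left.1 hWC (h.sub hz) h1
  · exact h1.2 hz

/-- The invariant says that every adjacent cell with a smaller offset number has left `W'`;
`exists_off` turns its final form into the absence of all adjacent cells. -/
theorem expand_spec (hA : DisjointSets k A) {s : St σ} (h : Env s P k L K g side idx)
    {W C : Finset (Fin d → ℤ)} (hWC : Disjoint W C) {t : ℕ} {q : ℕ → ℕ} {i : ℕ} (hi : i < k)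
    (hv : s.m (20, []) = i) (hw : Walk S s k g (cellOf P side idx) A W C t q) :
    Tri S τ (expand d) s fun s' T =>
      Keeps [12, 15, 17, 18] [3] s s' ∧
      T ≤ ((2 * (K + d) + 1) ^ d + 1) * ((expandBody d).cost τ + 20 + (powE (boxB d) d).size) ∧
      (∀ g' ≠ (g : ℤ), ∀ z, s'.m (12, g' :: z) = s.m (12, g' :: z)) ∧
      ∃ W' C' t' q', Walk S s' k g (cellOf P side idx) A W' C' t' q' ∧
        Expanded K (cellOf P side idx) i W C W' C' t t' q q' ∧
        ∀ z ∈ W', ¬ CellAdj K (cellOf P side idx i) z := by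
  have hK : ∀ {s' : St σ}, Keeps [12, 15, 17, 18] [3] s s' → Env s' P k L K g side idx :=
    fun {s'} hs => h.congr fun a ha => hs.1 a (by
      intro hb
      simp only [List.mem_cons, List.not_mem_nil, or_false] at ha hb
      omega)
  have hset : ∀ {s' : St σ} (x : ℝ), Keeps [12, 15, 17, 18] [3] s s' →
      Keeps [12, 15, 17, 18] [3] s (s'.set (15, []) x) := fun x hs =>
    hs.trans ⟨fun a ha => by rw [St.set_m, if_neg]; rintro rfl; simp at ha, fun a ha => rfl⟩
  refine (Tri.forP ((2 * (K + d) + 1) ^ d) ((expandBody d).cost τ)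
    (fun e s' => s'.m (15, []) = e ∧ Keeps [12, 15, 17, 18] [3] s s' ∧
      (∀ g' ≠ (g : ℤ), ∀ z, s'.m (12, g' :: z) = s.m (12, g' :: z)) ∧
      ∃ W' C' t' q', Walk S s' k g (cellOf P side idx) A W' C' t' q' ∧
        Expanded K (cellOf P side idx) i W C W' C' t t' q q' ∧
        ∀ e' < e, CellAdj K (cellOf P side idx i) (nbCell P K side idx i e') →
          nbCell P K side idx i e' ∉ W')
    ?_ (fun e s' hs => hs.1) ?_ s ?_).mono ?_
  · rintro e s' ⟨-, hs, -⟩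
    rw [eval_powE, eval_boxB (hK hs).K]
    push_cast
    ring
  · rintro e he s' ⟨h15, hs, hg, W', C', t', q', hw', hx, hdone⟩
    have hE := hK hs
    have hv' : s'.m (20, []) = i := by rw [hs.1 _ (by simp), hv]
    refine Tri.straight straight_expandBody fun T hT => ⟨hT, ?_⟩
    -- The common continuation of the two cases in which nothing moves: the neighbouring cell is not
    -- in the table, or the offset is too long.
    have hstay : nbCell P K side idx i e ∉ W' ∨
        ¬ CellAdj K (cellOf P side idx i) (nbCell P K side idx i e) →
        run S (expandBody d) s' = s' → 
        (run S (expandBody d) s').m (15, []) = e ∧ 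
        (((run S (expandBody d) s').set (15, []) (e + 1)).m (15, []) = (e + 1 : ℕ) ∧
        Keeps [12, 15, 17, 18] [3] s ((run S (expandBody d) s').set (15, []) (e + 1)) ∧
        (∀ g' ≠ (g : ℤ), ∀ z, ((run S (expandBody d) s').set (15, []) (e + 1)).m (12, g' :: z) =
          s.m (12, g' :: z)) ∧
        ∃ W' C' t' q', Walk S ((run S (expandBody d) s').set (15, []) (e + 1)) k g
            (cellOf P side idx) A W' C' t' q' ∧
          Expanded K (cellOf P side idx) i W C W' C' t t' q q' ∧
          ∀ e' < e + 1, CellAdj K (cellOf P side idx i) (nbCell P K side idx i e') →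
            nbCell P K side idx i e' ∉ W') := by
      intro h1 h2
      rw [h2]
      refine ⟨h15, by simp, hset _ hs, fun g' hg' z => by simp [hg g' hg'], W', C', t', q',
        hw'.congr (fun a ha => ?_) (fun a ha => rfl), hx, fun e' he' ha => ?_⟩
      · rw [St.set_m, if_neg]; rintro rfl; simp at ha
      · rcases (Nat.lt_succ_iff_lt_or_eq.1 he') with h3 | rfl
        · exact hdone e' h3 ha
        · exact h1.resolve_right fun h4 => h4 ha
    have hb := hE.run_inBall (S := S) (i := i) h15 (.ite (nat 0) (nbRep d).get (pushNb d) .skip)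
    by_cases hadj : CellAdj K (cellOf P side idx i) (nbCell P K side idx i e)
    · have hrep : (nbRep d).get.eval s'.m =
          s'.m (12, (g : ℤ) :: List.ofFn (nbCell P K side idx i e)) := by
        rw [eval_get, nbRep, hE.addr_nb hi hv' h15]
      by_cases hmem : nbCell P K side idx i e ∈ W'
      · obtain ⟨r, hr, hrc, hrm⟩ := hw'.grid.mem _ hmem
        have hrun : run S (expandBody d) s' = run S (pushNb d) s' := by
          rw [expandBody, hb.1 hadj, run, if_pos]
          rw [hrep, hrm, eval_nat, Nat.cast_zero]
          positivity
        rw [hrun, hE.run_pushNb hi hv' h15 hw'.queue.tail hrm]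
        refine ⟨by simp [h15], by simp, hset _ (hs.trans ⟨fun a ha => ?_, fun a ha => ?_⟩),
          fun g' hg' z => by simp [hg', hg g' hg'], _, _, _, _,
          (hw'.push hA (hx.disjoint hWC) hmem hr).congr (fun a ha => ?_) (fun a ha => rfl),
          hx.push hmem hadj hrc, fun e' he' ha => ?_⟩
        · simp only [St.sset_m, St.set_m]
          rw [if_neg, if_neg, if_neg] <;> rintro rfl <;> simp at ha
        · rw [St.sset_sm, if_neg] <;> [skip; (rintro rfl; simp at ha)]
          rfl
        · rw [St.set_m, if_neg]; rintro rfl; simp at ha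
        · rcases (Nat.lt_succ_iff_lt_or_eq.1 he') with h3 | rfl
          · exact fun h4 => hdone e' h3 ha (Finset.mem_of_mem_erase h4)
          · exact Finset.notMem_erase _ _
      · refine hstay (.inl hmem) ?_
        rw [expandBody, hb.1 hadj, run, if_neg, run]
        rw [hrep, hw'.grid.not_mem _ hmem, eval_nat]
        simp
    · exact hstay (.inr hadj) (hb.2 hadj)
  · refine ⟨by simp, hset _ (Keeps.refl _ _ _), fun g' _ z => by simp, W, C, t, q,
      hw.congr (fun a ha => ?_) (fun a ha => rfl), Expanded.refl _ _ _ _ _ _, by simp⟩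
    rw [St.set_m, if_neg]; rintro rfl; simp at ha
  · rintro s' T ⟨⟨-, hs, hg, W', C', t', q', hw', hx, hdone⟩, hT⟩
    refine ⟨hs, hT, hg, W', C', t', q', hw', hx, fun z hz ha => ?_⟩
    obtain ⟨e, he, hoff⟩ := exists_off (K + d) (fun j => z j - cellOf P side idx i j)
      (abs_le_of_cellAdj ha)
    have hze : nbCell P K side idx i e = z := by
      funext j
      rw [nbCell, hoff j]
      ring
    exact hdone e he (hze ▸ ha) (hze ▸ hz)

end Expand

end RealRAM

namespace RealRAM

/-! ### Breadth-first search on cells, independently of the machine. -/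

section Search

variable {V σ : Type*} {n d : ℕ} {K : ℕ}

theorem CellAdj.symm {z w : Fin d → ℤ} (h : CellAdj K z w) : CellAdj K w z := by
  refine le_of_eq_of_le (Finset.sum_congr rfl fun j _ => ?_) h
  ring

/-- `w` can be reached from `z` through adjacent cells in `cells`. -/
def CellReach (K : ℕ) (cells : Finset (Fin d → ℤ)) : (Fin d → ℤ) → (Fin d → ℤ) → Prop :=
  Relation.ReflTransGen fun z w => (z ∈ cells ∧ w ∈ cells) ∧ CellAdj K z w

theorem CellReach.symm {cells : Finset (Fin d → ℤ)} {z w : Fin d → ℤ}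
    (h : CellReach K cells z w) : CellReach K cells w z := by
  induction h with
  | refl => exact .refl
  | tail _ h2 ih => exact .head ⟨h2.1.symm, h2.2.symm⟩ ih

open Classical in
/-- The connected component of a cell. -/
noncomputable def compOf (K : ℕ) (cells : Finset (Fin d → ℤ)) (z : Fin d → ℤ) :
    Finset (Fin d → ℤ) := cells.filter (CellReach K cells z)

theorem mem_compOf {cells : Finset (Fin d → ℤ)} {z w : Fin d → ℤ} :
    w ∈ compOf K cells z ↔ w ∈ cells ∧ CellReach K cells z w := by
  simp [compOf]

theorem CellReach.mem_of_closed {cells C : Finset (Fin d → ℤ)} {z w : Fin d → ℤ}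
    (hcl : ∀ z ∈ C, ∀ w ∈ cells, CellAdj K z w → w ∈ C) (hz : z ∈ C)
    (h : CellReach K cells z w) : w ∈ C := by
  induction h with
  | refl => exact hz
  | tail _ h2 ih => exact hcl _ ih _ h2.1.2 h2.2

/-- Closedness under adjacency makes `C` large enough to contain the component, and reachability
makes it small enough. -/
theorem eq_compOf {cells C : Finset (Fin d → ℤ)} {z : Fin d → ℤ} (hsub : C ⊆ cells)
    (hcl : ∀ z ∈ C, ∀ w ∈ cells, CellAdj K z w → w ∈ C) (hz : z ∈ C)
    (hr : ∀ w ∈ C, CellReach K cells z w) : compOf K cells z = C := by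
  ext w
  rw [mem_compOf]
  exact ⟨fun h => h.2.mem_of_closed hcl hz, fun h => ⟨hsub h, hr w h⟩⟩

/-- The invariant of the breadth-first search on the cells: `W` are the unvisited cells, `C` the
cells of the current component found so far, `O` the cells of completed components, and the
positions `q h, …, q (t - 1)` are waiting. `Pr Z` says that the cells in `Z` form a positive set,
and `b` that a positive component has been found. -/
structure Search (K k : ℕ) (cell : ℕ → Fin d → ℤ) (Pr : Finset (Fin d → ℤ) → Prop)
    (cells W C O : Finset (Fin d → ℤ)) (t h i : ℕ) (q : ℕ → ℕ) (b : Prop) : Prop where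
  mem : ∀ z, z ∈ cells ↔ z ∈ W ∨ z ∈ C ∨ z ∈ O
  disjWC : Disjoint W C
  disjWO : Disjoint W O
  disjCO : Disjoint C O
  closed : ∀ z ∈ O, ∀ w ∈ cells, CellAdj K z w → w ∈ O
  neg : ¬ b → ∀ z ∈ O, ¬ Pr (compOf K cells z)
  pos : b → ∃ z ∈ cells, Pr (compOf K cells z)
  reach : ∀ z ∈ C, ∀ w ∈ C, CellReach K cells z w
  frontier : ∀ z ∈ C, (∃ p, h ≤ p ∧ p < t ∧ cell (q p) = z) ∨
    ∀ w ∈ cells, CellAdj K z w → w ∈ C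
  queue : ∀ p, h ≤ p → p < t → cell (q p) ∈ C
  empty : h = t → C = ∅
  le : h ≤ t
  card : t + W.card ≤ k
  seen : ∀ j < i, cell j ∉ W

variable {k : ℕ} {cell : ℕ → Fin d → ℤ} {Pr : Finset (Fin d → ℤ) → Prop}
  {cells W C O : Finset (Fin d → ℤ)} {t h i : ℕ} {q : ℕ → ℕ} {b : Prop}

theorem Search.skip (H : Search K k cell Pr cells W C O t h i q b) (hi : cell i ∉ W) :
    Search K k cell Pr cells W C O t h (i + 1) q b :=
  { H with
    seen := fun j hj => by
      rcases Nat.lt_succ_iff_lt_or_eq.1 hj with h1 | rfl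
      · exact H.seen j h1
      · exact hi }

/-- With an empty queue the current component is complete and has been moved to `O`, so an unvisited
cell opens a new one. -/
theorem Search.start (H : Search K k cell Pr cells W C O t h i q b) (hi : cell i ∈ W)
    (hht : h = t) : Search K k cell Pr cells (W.erase (cell i)) {cell i} O (t + 1) h (i + 1)
      (Function.update q t i) b := by
  have hC := H.empty hht
  subst hht
  refine {
    mem := fun z => ?_, disjWC := (by simp), disjWO := ?_, disjCO := ?_, closed := H.closed,
    neg := H.neg, pos := H.pos, reach := ?_, frontier := ?_, queue := ?_,
    empty := fun h => absurd h (by omega), le := (by omega), card := ?_, seen := fun j hj => ?_ }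
  · rw [H.mem z, hC]
    by_cases hz : z = cell i
    · subst hz; simp [hi]
    · simp [hz]
  · exact H.disjWO.mono_left (Finset.erase_subset _ _)
  · rw [Finset.disjoint_singleton_left]
    exact fun h' => Finset.disjoint_left.1 H.disjWO hi h'
  · intro z hz w hw
    rw [Finset.mem_singleton] at hz hw
    rw [hz, hw]
    exact .refl
  · intro z hz
    rw [Finset.mem_singleton] at hz
    exact .inl ⟨h, le_rfl, by omega, by simp [hz]⟩
  · intro p hp hp'
    have : p = h := by omega
    simp [this]
  · have := Finset.card_erase_add_one hi
    have := H.card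
    omega
  · rcases Nat.lt_succ_iff_lt_or_eq.1 hj with h1 | rfl
    · exact fun h' => H.seen j h1 (Finset.mem_of_mem_erase h')
    · exact Finset.notMem_erase _ _

/-- The oracle is consulted after every expansion, on the possibly incomplete component `C'`. A
positive answer is valid because `Pr` is monotone. Negative answers are used only once the queue has
run empty: then `C'` is closed under adjacency, hence a full component, and is moved to `O`. -/
theorem Search.pop (H : Search K k cell Pr cells W C O t h i q b) (hht : h < t)
    (hmono : ∀ Z Z' : Finset (Fin d → ℤ), Z ⊆ Z' → Pr Z → Pr Z')
    {W' C' : Finset (Fin d → ℤ)} {t' : ℕ} {q' : ℕ → ℕ}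
    (hx : Expanded K cell (q h) W C W' C' t t' q q')
    (hW' : ∀ z ∈ W', ¬ CellAdj K (cell (q h)) z) :
    ∃ C'' O', (h + 1 < t' → C'' = C') ∧
      Search K k cell Pr cells W' C'' O' t' (h + 1) i q' (b ∨ Pr C') := by
  have hCC' : C ⊆ C' := fun z hz => (hx.union z).2 (.inl hz)
  have hqC : cell (q h) ∈ C := H.queue h le_rfl hht
  have hmem : ∀ z, z ∈ cells ↔ z ∈ W' ∨ z ∈ C' ∨ z ∈ O := by
    intro z
    rw [H.mem, hx.union]
    have := @hx.sub z
    by_cases hz : z ∈ W'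
    · simp [hz, this hz]
    · simp only [hz, not_false_eq_true, and_true, false_or]
      tauto
  have hCO' : Disjoint C' O := by
    rw [Finset.disjoint_left]
    intro z hz hz'
    rcases (hx.union z).1 hz with h1 | h1
    · exact Finset.disjoint_left.1 H.disjCO h1 hz'
    · exact Finset.disjoint_left.1 H.disjWO h1.1 hz'
  have hCc : C' ⊆ cells := fun z hz => (hmem z).2 (.inr (.inl hz))
  have hreach0 : ∀ z ∈ C', CellReach K cells (cell (q h)) z := by
    intro z hz
    rcases (hx.union z).1 hz with h1 | h1
    · exact H.reach _ hqC z h1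
    · exact .single ⟨⟨hCc (hCC' hqC), hCc hz⟩, hx.adj z h1.1 h1.2⟩
  have hreach : ∀ z ∈ C', ∀ w ∈ C', CellReach K cells z w :=
    fun z hz w hw => (hreach0 z hz).symm.trans (hreach0 w hw)
  have hnO : ∀ z ∈ C', ∀ w ∈ cells, CellAdj K z w → w ∉ O := by
    intro z hz w hw ha hwO
    exact Finset.disjoint_left.1 hCO' hz (H.closed w hwO z (hCc hz) ha.symm)
  have hfront : ∀ z ∈ C', (∃ p, h + 1 ≤ p ∧ p < t' ∧ cell (q' p) = z) ∨
      ∀ w ∈ cells, CellAdj K z w → w ∈ C' := by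
    intro z hz
    rcases (hx.union z).1 hz with h1 | h1
    · rcases H.frontier z h1 with ⟨p, hp, hpt, hpz⟩ | h2
      -- The head of the queue stops waiting, but by `hW'` all its neighbours have been visited;
      -- other waiting cells keep their places.
      · rcases eq_or_lt_of_le hp with rfl | hp'
        · refine .inr fun w hw ha => ?_
          rcases (hmem w).1 hw with h3 | h3 | h3
          · exact absurd (hpz ▸ ha) (hW' w h3)
          · exact h3
          · exact absurd h3 (hnO z hz w hw ha)
        · exact .inl ⟨p, hp', lt_of_lt_of_le hpt hx.le, by rw [hx.old p hpt, hpz]⟩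
      · exact .inr fun w hw ha => hCC' (h2 w hw ha)
    · obtain ⟨p, hp, hpt, hpz⟩ := hx.all z h1.1 h1.2
      exact .inl ⟨p, by omega, hpt, hpz⟩
  have hpos : b ∨ Pr C' → ∃ z ∈ cells, Pr (compOf K cells z) := by
    rintro (hb | hb)
    · exact H.pos hb
    · exact ⟨cell (q h), hCc (hCC' hqC), hmono _ _
        (fun z hz => mem_compOf.2 ⟨hCc hz, hreach0 z hz⟩) hb⟩
  have hcard : t' + W'.card ≤ k := by
    have := hx.card
    have := H.card
    omega
  have hseen : ∀ j < i, cell j ∉ W' := fun j hj hj' => H.seen j hj (hx.sub hj')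
  have hle := hx.le
  by_cases hlt : h + 1 < t'
  · refine ⟨C', O, fun _ => rfl, {
      mem := hmem, disjWC := hx.disjoint H.disjWC,
      disjWO := H.disjWO.mono_left hx.sub, disjCO := hCO', closed := H.closed,
      neg := fun hb => H.neg fun h' => hb (.inl h'), pos := hpos, reach := hreach,
      frontier := hfront, queue := fun p hp hp' => ?_, empty := fun h' => absurd h' (by omega),
      le := hlt.le, card := hcard, seen := hseen }⟩
    rcases lt_or_ge p t with h1 | h1
    · rw [hx.old p h1]
      exact hCC' (H.queue p (by omega) h1)
    · have := hx.new p h1 hp'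
      exact (hx.union _).2 (.inr this)
  · have hclosed : ∀ z ∈ C', ∀ w ∈ cells, CellAdj K z w → w ∈ C' := by
      intro z hz
      rcases hfront z hz with ⟨p, hp, hpt, -⟩ | h2
      · omega
      · exact h2
    refine ⟨∅, O ∪ C', fun h' => absurd h' hlt, {
      mem := fun z => ?_, disjWC := (by simp),
      disjWO := ?_, disjCO := (by simp), closed := ?_, neg := ?_, pos := hpos, reach := (by simp),
      frontier := (by simp), queue := fun p hp hp' => absurd hp' (by omega), empty := fun _ => rfl,
      le := (by omega), card := hcard, seen := hseen }⟩
    · rw [hmem z]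
      simp only [Finset.notMem_empty, Finset.mem_union, false_or]
      tauto
    · rw [Finset.disjoint_union_right]
      exact ⟨H.disjWO.mono_left hx.sub, hx.disjoint H.disjWC⟩
    · intro z hz w hw ha
      rw [Finset.mem_union] at hz ⊢
      exact hz.imp (fun h1 => H.closed z h1 w hw ha) (fun h1 => hclosed z h1 w hw ha)
    · intro hb z hz
      rcases Finset.mem_union.1 hz with h1 | h1
      · exact H.neg (fun h' => hb (.inl h')) z h1
      · rw [eq_compOf hCc hclosed h1 (hreach z h1)]
        exact fun h' => hb (.inr h')

/-- After the scan has passed all positions and the queue is empty, nothing is left in `W` or `C`,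
so every component is complete and `neg` and `pos` settle the answer. -/
theorem Search.finish (H : Search K k cell Pr cells W C O t h i q b)
    (hcells : cells = (Finset.range k).image cell) (hik : k ≤ i) (hht : h = t) :
    b ↔ ∃ j < k, Pr (compOf K cells (cell j)) := by
  constructor
  · intro hb
    obtain ⟨z, hz, hp⟩ := H.pos hb
    rw [hcells, Finset.mem_image] at hz
    obtain ⟨j, hj, rfl⟩ := hz
    exact ⟨j, Finset.mem_range.1 hj, hp⟩
  · rintro ⟨j, hj, hp⟩
    by_contra hb
    refine H.neg hb (cell j) ?_ hp
    have h1 : cell j ∈ cells := by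
      rw [hcells]
      exact Finset.mem_image_of_mem _ (Finset.mem_range.2 hj)
    rcases (H.mem _).1 h1 with h2 | h2 | h2
    · exact absurd h2 (H.seen j (by omega))
    · rw [H.empty hht] at h2
      simp at h2
    · exact h2

end Search

end RealRAM

namespace RealRAM

/-! ### Distributing the points of a list to the cells of a new grid. -/

section Build

variable {V σ : Type*} {n d : ℕ} {S : SketchableFamily V σ} {τ : ℕ}
  {P : Fin n → EuclideanSpace ℝ (Fin d)} {k L K g : ℕ} {side : ℝ} {idx : ℕ → Fin n}
  {A : ℕ → Set V}

theorem Keeps.set {X Y : List ℕ} (s : St σ) {a : Addr} (x : ℝ) (h : a.1 ∈ X) :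
    Keeps X Y s (s.set a x) :=
  ⟨fun b hb => by rw [St.set_m, if_neg]; rintro rfl; exact hb h, fun _ _ => rfl⟩

theorem Keeps.sset {X Y : List ℕ} (s : St σ) {a : Addr} (x : Option σ) (h : a.1 ∈ Y) :
    Keeps X Y s (s.sset a x) :=
  ⟨fun _ _ => rfl, fun b hb => by rw [St.sset_sm, if_neg]; rintro rfl; exact hb h⟩

theorem Env.keeps {s s' : St σ} (h : Env s P k L K g side idx) {X Y : List ℕ}
    (hs : Keeps X Y s s') (hX : ∀ x ∈ [2, 4, 5, 6, 7, 10, 11], x ∉ X) :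
    Env s' P k L K g side idx :=
  h.congr fun a ha => hs.1 a (hX _ ha)

theorem Walk.keeps {s s' : St σ} {cell : ℕ → Fin d → ℤ} {W C : Finset (Fin d → ℤ)} {t : ℕ}
    {q : ℕ → ℕ} (h : Walk S s k g cell A W C t q) {X Y : List ℕ} (hs : Keeps X Y s s')
    (hX : ∀ x ∈ [12, 17, 18], x ∉ X) (hY : ∀ x ∈ [2, 3], x ∉ Y) :
    Walk S s' k g cell A W C t q :=
  h.congr (fun a ha => hs.1 a (hX _ ha)) fun a ha => hs.2 a (hY _ ha)

/-- The sketches of the sets `A j` of the points of the list. -/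
def ListSketches (S : SketchableFamily V σ) (s : St σ) (k L : ℕ) (A : ℕ → Set V) : Prop :=
  ∀ j < k, s.sm (1, [(L : ℤ), (j : ℤ)]) = some (S.sketch (A j))

theorem Fresh.congr {s s' : St σ} (h : Fresh s g)
    (hs : ∀ a, a.1 = 12 ∨ a.1 = 13 → s'.m a = s.m a) : Fresh s' g := fun g' hg' z => by
  rw [hs _ (.inl rfl), hs _ (.inr rfl)]
  exact h g' hg' z

/-- The entry of the hash table `x` for the cell of the point in `14`. -/
def own (d x : ℕ) : Ref := refC x (sv 11) fun j : Fin d => cellE (sv 14) j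

theorem Env.addr_own {s : St σ} (h : Env s P k L K g side idx) {i : ℕ} (hi : i < k)
    (hv : s.m (14, []) = i) (x : ℕ) :
    (own d x).addr s.m = (x, (g : ℤ) :: List.ofFn (cellOf P side idx i)) := by
  rw [own, addr_refC]
  congr 2
  · simp [h.grid]
  · congr 1
    funext j
    exact h.floor_cellE (by rw [eval_sv, hv]) hi j

/-- Table `12` stores a position plus one, so that the default value `0` marks an absent cell. Table
`13` counts the points of a cell, and sketch table `2` holds the sketch of their union. -/
def buildBody (d : ℕ) : Prog :=
  .seq (.ite (nat 0) (own d 12).get (.skMerge (own d 2) (own d 2) (ref2 1 (sv 5) (sv 14)))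
      (.skCopy (own d 2) (ref2 1 (sv 5) (sv 14))))
    (.seq (.assign (own d 13) (.add (own d 13).get (nat 1)))
      (.assign (own d 12) (.add (sv 14) (nat 1))))

/-- Distribute the points of the list to the cells of a new grid. -/
def build (d : ℕ) : Prog :=
  .seq (.assign (sr 11) (.add (sv 11) (nat 1))) (forP 14 (sv 4) (buildBody d))

theorem straight_buildBody : (buildBody d).Straight :=
  ⟨⟨trivial, trivial⟩, trivial, trivial⟩

open Classical in
theorem Env.run_buildBody {s : St σ} (h : Env s P k L K g side idx) {i : ℕ} (hi : i < k)
    (hv : s.m (14, []) = i) {key : List ℤ}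
    (hkey : key = (g : ℤ) :: List.ofFn (cellOf P side idx i)) :
    run S (buildBody d) s = ((s.sset (2, key) (if 0 < s.m (12, key) then
      Option.map₂ S.merge (s.sm (2, key)) (s.sm (1, [(L : ℤ), (i : ℤ)])) else
        s.sm (1, [(L : ℤ), (i : ℤ)]))).set (13, key) (s.m (13, key) + 1)).set
          (12, key) (i + 1) := by
  have e1 : run S (.ite (nat 0) (own d 12).get
      (.skMerge (own d 2) (own d 2) (ref2 1 (sv 5) (sv 14)))
      (.skCopy (own d 2) (ref2 1 (sv 5) (sv 14)))) s = s.sset (2, key)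
      (if 0 < s.m (12, key) then
        Option.map₂ S.merge (s.sm (2, key)) (s.sm (1, [(L : ℤ), (i : ℤ)])) else
        s.sm (1, [(L : ℤ), (i : ℤ)])) := by
    simp only [run, eval_get, h.addr_own hi hv, ← hkey, addr_ref2, eval_sv, h.list, hv,
      Int.floor_natCast, eval_nat, Nat.cast_zero]
    split_ifs <;> rfl
  rw [buildBody, run, e1]
  set s1 := s.sset (2, key) (if 0 < s.m (12, key) then
        Option.map₂ S.merge (s.sm (2, key)) (s.sm (1, [(L : ℤ), (i : ℤ)])) else
        s.sm (1, [(L : ℤ), (i : ℤ)]))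
  have h1 : Env s1 P k L K g side idx :=
    h.keeps (Keeps.sset (X := []) (Y := [2]) s _ (by simp)) (by simp)
  have e2 := h1.addr_own hi hv 13
  have h2 : Env (s1.set (13, key) (s1.m (13, key) + 1)) P k L K g side idx :=
    h1.keeps (Keeps.set (X := [13]) (Y := []) s1 _ (by simp)) (by simp)
  have hv2 : (s1.set (13, key) (s1.m (13, key) + 1)).m (14, []) = i := by simp [s1, hv]
  have e3 : run S (.assign (own d 13) (.add (own d 13).get (nat 1))) s1 =
      s1.set (13, key) (s1.m (13, key) + 1) := by
    rw [run, eval_add, eval_get, e2, ← hkey, eval_nat, Nat.cast_one]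
  rw [run, e3, run, h2.addr_own hi hv2, ← hkey, eval_add, eval_sv, hv2, eval_nat, Nat.cast_one]
  rfl

-- Raising the grid number makes all keys new, so no table is ever cleared; `Fresh` guarantees that
-- the entries with these keys are still `0`. The loop invariant is the conclusion for the first `i`
-- points.
open Classical in
theorem build_spec (hA : DisjointSets k A) {s : St σ} (h : Env s P k L K g side idx)
    (hsk : ListSketches S s k L A) (hfr : Fresh s g) :
    Tri S τ (build d) s fun s' T =>
      T ≤ (k + 1) * ((buildBody d).cost τ + 30) ∧ Keeps [11, 12, 13, 14] [2] s s' ∧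
      Env s' P k L K (g + 1) side idx ∧ Fresh s' (g + 1) ∧
      Grid S s' k (g + 1) (cellOf P side idx) A ((Finset.range k).image (cellOf P side idx)) ∧
      ∀ z, s'.m (13, ((g + 1 : ℕ) : ℤ) :: List.ofFn z) =
        ((Finset.range k).filter fun j => cellOf P side idx j = z).card := by
  set cell := cellOf P side idx with hcell
  have e1 : run S (.assign (sr 11) (.add (sv 11) (nat 1))) s = s.set (11, []) (g + 1 : ℕ) := by
    simp [run, h.grid]
  refine Tri.seq (Tri.straight (by simp [Prog.Straight]) fun t ht => ?_)
  have ht' : t ≤ 5 := by simpa [Prog.cost, RExpr.size] using ht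
  rw [e1]
  set s1 := s.set (11, []) (g + 1 : ℕ) with hs1
  have hk1 : Keeps [11, 12, 13, 14] [2] s s1 := Keeps.set s _ (by simp)
  have hE1 : Env s1 P k L K (g + 1) side idx := by
    refine ⟨?_, ?_, ?_, ?_, by simp [hs1], fun j hj => ?_, fun i j => ?_⟩
    · simpa [hs1] using h.size
    · simpa [hs1] using h.list
    · simpa [hs1] using h.side
    · simpa [hs1] using h.K
    · simpa [hs1] using h.entry j hj
    · simpa [hs1] using h.coord i j
  have hE : ∀ {s' : St σ}, Keeps [12, 13, 14] [2] s1 s' → Env s' P k L K (g + 1) side idx :=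
    fun hs => hE1.keeps hs (by simp)
  refine (Tri.forP k ((buildBody d).cost τ) (fun i s' => s'.m (14, []) = i ∧
      Keeps [12, 13, 14] [2] s1 s' ∧ Fresh s' (g + 1) ∧
      Grid S s' i (g + 1) cell A ((Finset.range i).image cell) ∧
      ∀ z, s'.m (13, ((g + 1 : ℕ) : ℤ) :: List.ofFn z) =
        ((Finset.range i).filter fun j => cell j = z).card) ?_ (fun i s' hs => hs.1) ?_ s1 ?_).mono ?_
  · rintro i s' ⟨-, hs, -⟩
    rw [eval_sv, (hE hs).size]
  · rintro i hi s' ⟨h14, hs, hf, hG, hN⟩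
    refine Tri.straight straight_buildBody fun T hT => ⟨hT, ?_⟩
    set key : List ℤ := ((g + 1 : ℕ) : ℤ) :: List.ofFn (cell i) with hkey
    rw [(hE hs).run_buildBody hi h14 hkey]
    have hsl : s'.sm (1, [(L : ℤ), (i : ℤ)]) = some (S.sketch (A i)) := by
      rw [hs.2 _ (by simp)]
      exact hsk i hi
    have hne : ∀ z, z ≠ cell i → List.ofFn z ≠ List.ofFn (cell i) :=
      fun z hz h' => hz (List.ofFn_injective h')
    have hU : ∀ z, z ≠ cell i → unionOf (i + 1) cell A {z} = unionOf i cell A {z} := by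
      intro z hz
      ext v
      simp only [unionOf, Finset.mem_singleton, Set.mem_ofPred_eq]
      constructor
      · rintro ⟨j, hj, hjz, hv⟩
        rcases Nat.lt_succ_iff_lt_or_eq.1 hj with h1 | rfl
        · exact ⟨j, h1, hjz, hv⟩
        · exact absurd hjz.symm hz
      · rintro ⟨j, hj, hjz, hv⟩
        exact ⟨j, by omega, hjz, hv⟩
    have hU' : unionOf (i + 1) cell A {cell i} = unionOf i cell A {cell i} ∪ A i := by
      ext v
      simp only [unionOf, Finset.mem_singleton, Set.mem_ofPred_eq, Set.mem_union]
      constructor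
      · rintro ⟨j, hj, hjz, hv⟩
        rcases Nat.lt_succ_iff_lt_or_eq.1 hj with h1 | rfl
        · exact .inl ⟨j, h1, hjz, hv⟩
        · exact .inr hv
      · rintro (⟨j, hj, hjz, hv⟩ | hv)
        · exact ⟨j, by omega, hjz, hv⟩
        · exact ⟨i, by omega, rfl, hv⟩
    have hsk' : (if 0 < s'.m (12, key) then
        Option.map₂ S.merge (s'.sm (2, key)) (s'.sm (1, [(L : ℤ), (i : ℤ)])) else
        s'.sm (1, [(L : ℤ), (i : ℤ)])) = some (S.sketch (unionOf (i + 1) cell A {cell i})) := by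
      by_cases hz : cell i ∈ (Finset.range i).image cell
      · obtain ⟨j, hj, hjc, hm⟩ := hG.mem _ hz
        rw [if_pos (by rw [hm]; positivity), hG.sketch _ hz, hsl, Option.map₂_some_some, hU',
          S.sketch_union]
        rw [Set.disjoint_left]
        rintro v ⟨j', hj', -, hv⟩ hv'
        exact Set.disjoint_left.1 (hA j' (by omega) i hi (by omega)) hv hv'
      · rw [if_neg (by rw [hG.not_mem _ hz]; exact lt_irrefl _), hsl, hU']
        congr 2
        symm
        rw [Set.union_eq_right]
        rintro v ⟨j, hj, hjz, -⟩
        rw [Finset.mem_singleton] at hjz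
        exact absurd (hjz ▸ Finset.mem_image_of_mem cell (Finset.mem_range.2 hj)) hz
    rw [hsk']
    refine ⟨by simp [h14], by simp, ?_, ?_, ⟨fun z hz => ?_, fun z hz => ?_, fun z hz => ?_⟩,
      fun z => ?_⟩
    · exact (((hs.trans (Keeps.sset _ _ (by simp))).trans (Keeps.set _ _ (by simp))).trans
        (Keeps.set _ _ (by simp))).trans (Keeps.set _ _ (by simp))
    · intro g' hg' z
      have := hf g' hg' z
      have hg'' : g' ≠ ((g + 1 : ℕ) : ℤ) := hg'.ne'
      push_cast at hg''
      simp [hkey, hg'', this]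
    · by_cases hzi : z = cell i
      · exact ⟨i, by omega, hzi.symm, by simp [hkey, hzi]⟩
      · rw [Finset.mem_image] at hz
        obtain ⟨j, hj, hjz⟩ := hz
        have hj' : j < i := by
          rcases Nat.lt_succ_iff_lt_or_eq.1 (Finset.mem_range.1 hj) with h1 | rfl
          · exact h1
          · exact absurd hjz.symm hzi
        obtain ⟨r, hr, hrz, hrm⟩ := hG.mem z (hjz ▸ Finset.mem_image_of_mem cell
          (Finset.mem_range.2 hj'))
        exact ⟨r, by omega, hrz, by simpa [hkey, hne z hzi] using hrm⟩
    · have hzi : z ≠ cell i := by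
        rintro rfl
        exact hz (Finset.mem_image_of_mem cell (Finset.mem_range.2 (by omega)))
      have hz' : z ∉ (Finset.range i).image cell := fun h' =>
        hz (Finset.image_subset_image (Finset.range_mono (by omega)) h')
      simpa [hkey, hne z hzi] using hG.not_mem z hz'
    · by_cases hzi : z = cell i
      · simp [hkey, hzi]
      · rw [Finset.mem_image] at hz
        obtain ⟨j, hj, hjz⟩ := hz
        have hj' : j < i := by
          rcases Nat.lt_succ_iff_lt_or_eq.1 (Finset.mem_range.1 hj) with h1 | rfl
          · exact h1
          · exact absurd hjz.symm hzi
        have := hG.sketch z (hjz ▸ Finset.mem_image_of_mem cell (Finset.mem_range.2 hj'))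
        rw [hU z hzi]
        simpa [hkey, hne z hzi] using this
    · rw [Finset.range_add_one, Finset.filter_insert]
      by_cases hzi : z = cell i
      · rw [if_pos hzi.symm, Finset.card_insert_of_notMem (by simp)]
        have := hN (cell i)
        push_cast at this
        simp [hkey, hzi, this]
      · rw [if_neg (Ne.symm hzi)]
        have := hN z
        push_cast at this
        simp [hkey, hne z hzi, this]
  · refine ⟨by simp, Keeps.set _ _ (by simp), fun g' hg' z => ?_,
      ⟨fun z hz => by simp at hz, fun z _ => ?_, fun z hz => by simp at hz⟩, fun z => ?_⟩
    · have := hfr g' (by push_cast at hg'; omega) z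
      simpa [hs1] using this
    · have := (hfr (g + 1 : ℕ) (by push_cast; omega) (List.ofFn z)).1
      push_cast at this
      simpa [hs1] using this
    · have := (hfr (g + 1 : ℕ) (by push_cast; omega) (List.ofFn z)).2
      push_cast at this
      simpa [hs1] using this
  · rintro s' T ⟨⟨-, hs, hf, hG, hN⟩, hT⟩
    refine ⟨?_, hk1.trans (hs.mono (by simp) (by simp)), hE hs, hf, hG, hN⟩
    simp only [size_sv] at hT
    nlinarith

end Build

end RealRAM

namespace RealRAM

/-! ### The approximate decision procedure. -/

section Decide

variable {V σ : Type*} {n d : ℕ} {S : SketchableFamily V σ} {τ : ℕ}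
  {P : Fin n → EuclideanSpace ℝ (Fin d)} {k L K g : ℕ} {side : ℝ} {idx : ℕ → Fin n}
  {A : ℕ → Set V}

/-- Test the sketch of the current cluster. -/
def popTail : Prog :=
  .seq (.assign (sr 16) (.add (sv 16) (nat 1)))
    (.seq (.skTest (sr 21) (sr 3)) (.ite (nat 0) (sv 21) (.assign (sr 19) (nat 1)) .skip))

/-- Make the cell of the point in `14` the current cluster. -/
def startCluster (d : ℕ) : Prog :=
  .seq (.skCopy (sr 3) (own d 2)) (.assign (own d 12) (nat 0))

def startBody (d : ℕ) : Prog :=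
  .seq (.ite (nat 0) (own d 12).get
    (.seq (startCluster d) (.seq (.assign (ref1 18 (sv 17)) (sv 14))
      (.assign (sr 17) (.add (sv 17) (nat 1))))) .skip)
    (.assign (sr 14) (.add (sv 14) (nat 1)))

/-- The queue occupies the positions from `16` up to `17` of table `18`. Its head is expanded if
there is one; otherwise the scan over the list, with position in `14`, moves on by one point. -/
def searchBody (d : ℕ) : Prog :=
  .ite (sv 16) (sv 17)
    (.seq (.assign (sr 20) (ref1 18 (sv 16)).get) (.seq (expand d) popTail))
    (startBody d)

def searchInit : Prog :=
  .seq (.assign (sr 16) (nat 0)) (.seq (.assign (sr 17) (nat 0))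
    (.seq (.assign (sr 14) (nat 0)) (.assign (sr 19) (nat 0))))

/-- Decide whether a connected component of the cells of the list is positive. -/
def decide (d : ℕ) : Prog :=
  .seq (build d) (.seq searchInit
    (.loop (.add (sv 14) (sv 16)) (.add (sv 4) (sv 17)) (searchBody d)))

theorem run_popTail {s : St σ} {h : ℕ} (hh : s.m (16, []) = h) {X : Set V}
    (hX : s.sm (3, []) = some (S.sketch X)) :
    Keeps [16, 19, 21] [] s (run S popTail s) ∧ (run S popTail s).m (16, []) = (h + 1 : ℕ) ∧
      (0 < (run S popTail s).m (19, []) ↔ 0 < s.m (19, []) ∨ X ∈ S.family) := by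
  classical
  have h1 := S.oracle_sketch X
  by_cases hF : X ∈ S.family
  · have hr : run S popTail s = ((s.set (16, []) (h + 1 : ℕ)).set (21, []) 1).set (19, []) 1 := by
      simp [popTail, run, hh, hX, h1.2 hF]
    rw [hr]
    refine ⟨((Keeps.set _ _ (by simp)).trans (Keeps.set _ _ (by simp))).trans
      (Keeps.set _ _ (by simp)), by simp, by simp [hF]⟩
  · have h2 : S.oracle (S.sketch X) = false := by
      rw [Bool.eq_false_iff]
      exact fun h3 => hF (h1.1 h3)
    have hr : run S popTail s = ((s.set (16, []) (h + 1 : ℕ)).set (21, []) 0) := by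
      simp [popTail, run, hh, hX, h2]
    rw [hr]
    exact ⟨(Keeps.set _ _ (by simp)).trans (Keeps.set _ _ (by simp)), by simp, by simp [hF]⟩

theorem Env.run_startCluster {s : St σ} (h : Env s P k L K g side idx) {i : ℕ} (hi : i < k)
    (hv : s.m (14, []) = i) {key : List ℤ}
    (hkey : key = (g : ℤ) :: List.ofFn (cellOf P side idx i)) :
    run S (startCluster d) s = (s.sset (3, []) (s.sm (2, key))).set (12, key) 0 := by
  have h1 : Env (s.sset (3, []) (s.sm (2, key))) P k L K g side idx :=
    h.keeps (Keeps.sset (X := []) (Y := [3]) s _ (by simp)) (by simp)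
  have e1 : run S (.skCopy (sr 3) (own d 2)) s = s.sset (3, []) (s.sm (2, key)) := by
    rw [run, addr_sr, h.addr_own hi hv, ← hkey]
  rw [startCluster, run, e1, run, h1.addr_own hi hv, ← hkey]
  simp

theorem Env.run_startBody {s : St σ} (h : Env s P k L K g side idx) {i t : ℕ} (hi : i < k)
    (hv : s.m (14, []) = i) (ht : s.m (17, []) = t) {key : List ℤ}
    (hkey : key = (g : ℤ) :: List.ofFn (cellOf P side idx i)) :
    (0 < s.m (12, key) → run S (startBody d) s =
      ((((s.sset (3, []) (s.sm (2, key))).set (12, key) 0).set (18, [(t : ℤ)]) i).set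
        (17, []) (t + 1 : ℕ)).set (14, []) (i + 1 : ℕ)) ∧
    (¬ 0 < s.m (12, key) → run S (startBody d) s = s.set (14, []) (i + 1 : ℕ)) := by
  subst hkey
  have e0 : s.m ((own d 12).addr s.m) =
      s.m (12, (g : ℤ) :: List.ofFn (cellOf P side idx i)) := by
    rw [h.addr_own hi hv]
  constructor
  · intro hc
    simp [startBody, run, e0, hc, h.run_startCluster hi hv rfl, hv, ht]
  · intro hc
    simp [startBody, run, e0, hc, hv]

/-- The time of a search step, up to the number of offsets. -/
def searchC (d τ : ℕ) : ℕ :=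
  2 * ((expandBody d).cost τ + 20 + (powE (boxB d) d).size) +
    (Prog.assign (sr 20) (ref1 18 (sv 16)).get).cost τ + popTail.cost τ + (startBody d).cost τ + 30

/-- The time of `decide`, up to the numbers of points and offsets. -/
def decideC (d τ : ℕ) : ℕ := 2 * searchC d τ + (buildBody d).cost τ + 80

/-- Each iteration advances the scan or the head of the queue, and neither can exceed `k`. So there
are at most `2 * k` iterations, each of cost proportional to the number of offsets. -/
theorem decide_spec (hA : DisjointSets k A) {s : St σ} (h : Env s P k L K g side idx)
    (hsk : ListSketches S s k L A) (hfr : Fresh s g) :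
    Tri S τ (decide d) s fun s' T =>
      T ≤ (k + 1) * (2 * (K + d) + 1) ^ d * decideC d τ ∧
      Keeps [11, 12, 13, 14, 15, 16, 17, 18, 19, 20, 21] [2, 3] s s' ∧
      Env s' P k L K (g + 1) side idx ∧ Fresh s' (g + 1) ∧
      (0 < s'.m (19, []) ↔ ∃ j < k, unionOf k (cellOf P side idx) A
        (compOf K ((Finset.range k).image (cellOf P side idx)) (cellOf P side idx j)) ∈
          S.family) := by
  set cell := cellOf P side idx with hcell
  set cells := (Finset.range k).image cell with hcells
  set B := (2 * (K + d) + 1) ^ d with hB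
  have hB1 : 1 ≤ B := Nat.one_le_pow _ _ (by omega)
  refine Tri.seq ((build_spec hA h hsk hfr).mono ?_)
  rintro s0 T0 ⟨hT0, hs0, hE0, hf0, hG0, -⟩
  refine Tri.seq (Tri.straight (by simp [searchInit, Prog.Straight]) fun T1 hT1 => ?_)
  have hT1' : T1 ≤ 20 := by
    refine hT1.trans ?_
    simp [searchInit, Prog.cost]
  have e1 : run S searchInit s0 =
      (((s0.set (16, []) 0).set (17, []) 0).set (14, []) 0).set (19, []) 0 := by
    simp [searchInit, run]
  rw [e1]
  set s1 := (((s0.set (16, []) 0).set (17, []) 0).set (14, []) 0).set (19, []) 0 with hs1def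
  have hs1 : Keeps [14, 16, 17, 19] [] s0 s1 :=
    (((Keeps.set _ _ (by simp)).trans (Keeps.set _ _ (by simp))).trans
        (Keeps.set _ _ (by simp))).trans (Keeps.set _ _ (by simp))
  have hE1 : Env s1 P k L K (g + 1) side idx := hE0.keeps hs1 (by simp)
  have hG1 : Grid S s1 k (g + 1) cell A cells := hG0.congr
    (fun a ha => hs1.1 a (by rw [ha]; simp)) (fun a ha => hs1.2 a (by simp))
  have hf1 : Fresh s1 (g + 1) := hf0.congr fun a ha => hs1.1 a (by
    rcases ha with ha | ha <;> rw [ha] <;> simp)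
  let Pr : Finset (Fin d → ℤ) → Prop := fun Z => unionOf k cell A Z ∈ S.family
  have hPr : ∀ Z Z' : Finset (Fin d → ℤ), Z ⊆ Z' → Pr Z → Pr Z' := by
    intro Z Z' hZ hp
    refine S.upward_closed _ hp _ ?_
    rintro v ⟨j, hj, hjz, hv⟩
    exact ⟨j, hj, hZ hjz, hv⟩
  let X : List ℕ := [12, 14, 15, 16, 17, 18, 19, 20, 21]
  have hEX : ∀ {s' : St σ}, Keeps X [3] s1 s' → Env s' P k L K (g + 1) side idx :=
    fun hs => hE1.keeps hs (by simp [X])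
  refine (Tri.loop (ι := ℕ × ℕ) (fun p s' => p.1 ≤ k ∧ s'.m (14, []) = p.1 ∧
      s'.m (16, []) = p.2 ∧ Keeps X [3] s1 s' ∧
      (∀ g' ≠ ((g + 1 : ℕ) : ℤ), ∀ z, s'.m (12, g' :: z) = s1.m (12, g' :: z)) ∧
      ∃ W C O t q, Search K k cell Pr cells W C O t p.2 p.1 q (0 < s'.m (19, [])) ∧
        Grid S s' k (g + 1) cell A W ∧ Queue s' k t q ∧
        -- Once the queue is empty, `C` is reset while the sketch of the finished component remains
        -- in memory; hence the condition.
        (p.2 < t → s'.sm (3, []) = some (S.sketch (unionOf k cell A C))))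
    (fun p => ((k - p.1) + (k - p.2)) * (B * searchC d τ)) ?_ (0, 0) s1 ?_).mono ?_
  · rintro ⟨i, h'⟩ s' ⟨hik, h14, h16, hs, hg, W, C, O, t, q, hS, hG, hQ, hcl⟩ hc
    dsimp only at hik h14 h16 hS hcl ⊢
    have hE := hEX hs
    have htk : t ≤ k := by have := hS.card; omega
    have hle := hS.le
    have hsize : 1 + (RExpr.add (sv 14) (sv 16)).size + (RExpr.add (sv 4) (sv 17)).size = 7 := by
      simp [RExpr.size]
    rw [hsize]
    refine Tri.ite (fun hlt => ?_) (fun hlt => ?_)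
    · rw [eval_sv, eval_sv, h16, hQ.tail] at hlt
      have hlt' : h' < t := by exact_mod_cast hlt
      refine Tri.seq (Tri.straight (by simp [Prog.Straight]) fun T2 hT2 => ?_)
      have e2 : run S (.assign (sr 20) (ref1 18 (sv 16)).get) s' = s'.set (20, []) (q h') := by
        simp [run, h16, hQ.entry h' hlt']
      rw [e2]
      have hs2 : Keeps [20] [] s' (s'.set (20, []) (q h')) := Keeps.set _ _ (by simp)
      have hW2 : Walk S (s'.set (20, []) (q h')) k (g + 1) cell A W C t q :=
        Walk.keeps ⟨hG, hcl hlt', hQ⟩ hs2 (by simp) (by simp)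
      refine Tri.seq ((expand_spec hA (hE.keeps hs2 (by simp)) hS.disjWC (hQ.lt h' hlt')
        (by simp) hW2).mono ?_)
      rintro s3 T3 ⟨hs3, hT3, hg3, W', C', t', q', hw3, hx, hna⟩
      obtain ⟨hk4, h164, h194⟩ := run_popTail (S := S) (s := s3) (h := h')
        (by rw [hs3.1 _ (by simp), St.set_m, if_neg (by simp), h16]) hw3.cluster
      obtain ⟨C'', O', hC'', hS'⟩ := hS.pop hlt' hPr hx hna
      refine Tri.straight (by simp [popTail, Prog.Straight]) fun T4 hT4 => ?_
      refine ⟨(i, h' + 1), ⟨hik, ?_, h164, ?_, fun g' hg' z => ?_, W', C'', O', t', q', ?_, ?_, ?_,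
        fun hlt'' => ?_⟩, ?_⟩
      · rw [hk4.1 _ (by simp), hs3.1 _ (by simp), St.set_m, if_neg (by simp), h14]
      · exact ((hs.trans (hs2.mono (by simp [X]) (by simp))).trans
          (hs3.mono (by simp [X]) (by simp))).trans (hk4.mono (by simp [X]) (by simp))
      · rw [hk4.1 _ (by simp), hg3 g' hg', St.set_m, if_neg (by simp), hg g' hg']
      · have e5 : (0 < (run S popTail s3).m (19, []) : Prop) =
            (0 < s'.m (19, []) ∨ Pr C') := by
          rw [eq_iff_iff, h194, hs3.1 _ (by simp), St.set_m, if_neg (by simp)]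
        rw [e5]
        exact hS'
      · exact hw3.grid.congr (fun a ha => hk4.1 a (by rw [ha]; simp)) fun a ha => hk4.2 a (by simp)
      · exact hw3.queue.congr fun a ha => hk4.1 a (by
          simp only [List.mem_cons, List.not_mem_nil, or_false] at ha ⊢
          omega)
      · rw [hC'' hlt'', hk4.2 _ (by simp), hw3.cluster]
      · have hT3' : T3 ≤ B * (2 * ((expandBody d).cost τ + 20 + (powE (boxB d) d).size)) := by
          refine hT3.trans ?_
          rw [← hB]
          nlinarith
        obtain ⟨r, hr⟩ : ∃ r, k - h' = r + 1 := ⟨k - h' - 1, by omega⟩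
        have hr' : k - (h' + 1) = r := by omega
        simp only [hr, hr', size_sv]
        have h7 : T2 + T4 + 30 ≤ B * ((Prog.assign (sr 20) (ref1 18 (sv 16)).get).cost τ +
            popTail.cost τ + (startBody d).cost τ + 30) := by
          refine le_trans ?_ (Nat.le_mul_of_pos_left _ hB1)
          omega
        have h8 : B * searchC d τ =
            B * (2 * ((expandBody d).cost τ + 20 + (powE (boxB d) d).size)) +
            B * ((Prog.assign (sr 20) (ref1 18 (sv 16)).get).cost τ +
            popTail.cost τ + (startBody d).cost τ + 30) := by
          rw [searchC]; ring
        rw [← add_assoc (k - i) r 1, add_mul (k - i + r) 1, one_mul]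
        omega
    · rw [eval_sv, eval_sv, h16, hQ.tail] at hlt
      have hht : h' = t := le_antisymm hS.le (by exact_mod_cast not_lt.1 hlt)
      have hik' : i < k := by
        simp only [eval_add, eval_sv, h14, h16, hE.size, hQ.tail] at hc
        have : i + h' < k + t := by exact_mod_cast hc
        omega
      refine Tri.straight (by simp [startBody, startCluster, Prog.Straight]) fun T2 hT2 => ?_
      have htime : 7 + (1 + (sv 16).size + (sv 17).size + T2) +
          ((k - (i + 1)) + (k - h')) * (B * searchC d τ) ≤
          ((k - i) + (k - h')) * (B * searchC d τ) := by
        obtain ⟨r, hr⟩ : ∃ r, k - i = r + 1 := ⟨k - i - 1, by omega⟩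
        have hr' : k - (i + 1) = r := by omega
        rw [hr, hr']
        have h7 : searchC d τ ≤ B * searchC d τ := Nat.le_mul_of_pos_left _ hB1
        have h8 : T2 + 30 ≤ searchC d τ := by rw [searchC]; omega
        rw [show r + 1 + (k - h') = (r + (k - h')) + 1 by ring, add_mul (r + (k - h')) 1, one_mul]
        simp only [size_sv]
        omega
      obtain ⟨hpos, hneg⟩ := hE.run_startBody (S := S) hik' h14 hQ.tail rfl
      by_cases hiW : cell i ∈ W
      · obtain ⟨r, hr, hrc, hrm⟩ := hG.mem _ hiW
        rw [hpos (by rw [hrm]; positivity), hG.sketch _ hiW]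
        set key : List ℤ := ((g + 1 : ℕ) : ℤ) :: List.ofFn (cell i) with hkey
        refine ⟨(i + 1, h'), ⟨hik', by simp, by simp [h16], ?_, fun g' hg' z => ?_,
          W.erase (cell i), {cell i}, O, t + 1, Function.update q t i, ?_,
          ⟨fun z hz => ?_, fun z hz => ?_, fun z hz => ?_⟩, ?_, fun _ => by simp⟩, htime⟩
        · exact (((((hs.trans (Keeps.sset _ _ (by simp))).trans (Keeps.set _ _ (by simp [X]))).trans
            (Keeps.set _ _ (by simp [X]))).trans (Keeps.set _ _ (by simp [X]))).trans
            (Keeps.set _ _ (by simp [X])))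
        · have hg'' := hg'
          push_cast at hg''
          simp [hkey, hg'', hg g' hg']
        · have := hS.start hiW hht
          simpa using this
        · rw [Finset.mem_erase] at hz
          obtain ⟨j, hj, hjc, hm⟩ := hG.mem z hz.2
          refine ⟨j, hj, hjc, ?_⟩
          have hm' := hm
          push_cast at hm'
          simp [hkey, hm', List.ofFn_inj, hz.1]
        · by_cases hzi : z = cell i
          · simp [hzi, hkey]
          · have hm' := hG.not_mem z fun h' => hz (Finset.mem_erase.2 ⟨hzi, h'⟩)
            push_cast at hm'
            simp [hkey, hm']
        · rw [Finset.mem_erase] at hz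
          simpa using hG.sketch z hz.2
        · refine ⟨by simp, fun p hp => ?_, fun p hp => ?_⟩
          · rcases eq_or_ne p t with rfl | hpt
            · simp
            · have := hQ.entry p (by omega)
              simp [hpt, this]
          · rcases eq_or_ne p t with rfl | hpt
            · simpa using hik'
            · rw [Function.update_of_ne hpt]
              exact hQ.lt p (by omega)
      · rw [hneg (by rw [hG.not_mem _ hiW]; exact lt_irrefl _)]
        refine ⟨(i + 1, h'), ⟨hik', by simp, by simp [h16], ?_, fun g' hg' z => ?_,
          W, C, O, t, q, ?_, ?_, ?_, fun h'' => absurd h'' (by dsimp only; omega)⟩, htime⟩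
        · exact hs.trans (Keeps.set _ _ (by simp [X]))
        · simp [hg g' hg']
        · simpa using hS.skip hiW
        · exact hG.congr (fun a ha => by rw [St.set_m, if_neg]; rintro rfl; simp at ha)
            fun a ha => rfl
        · exact hQ.congr fun a ha => by rw [St.set_m, if_neg]; rintro rfl; simp at ha
  · refine ⟨Nat.zero_le _, by simp [hs1def], by simp [hs1def], Keeps.refl _ _ _,
      fun _ _ _ => rfl, cells, ∅, ∅, 0, fun _ => 0, ?_, hG1, ⟨by simp [hs1def], by simp, by simp⟩,
      by simp⟩
    have h19 : (0 < s1.m (19, []) : Prop) = False := by simp [hs1def]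
    rw [h19]
    refine ⟨by simp, by simp, by simp, by simp, by simp, by simp, by simp, by simp, by simp,
      by simp, by simp, by simp, ?_, by simp⟩
    rw [zero_add]
    exact Finset.card_image_le.trans (by simp)
  · rintro s' T ⟨⟨i, h'⟩, ⟨hik, h14, h16, hs, hg, W, C, O, t, q, hS, hG, hQ, -⟩, hc, hT⟩
    dsimp only at hik h14 h16 hS hT
    have hE := hEX hs
    have htk : t ≤ k := by have := hS.card; omega
    have hle := hS.le
    simp only [eval_add, eval_sv, h14, h16, hE.size, hQ.tail] at hc
    -- Since `i ≤ k` and `h' ≤ t`, this one inequality forces both the end of the scan and an empty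
    -- queue.
    have hc' : k + t ≤ i + h' := by exact_mod_cast not_lt.1 hc
    refine ⟨?_, ?_, hE, ?_, hS.finish rfl (by omega) (by omega)⟩
    · have h1 : T ≤ (k + k) * (B * searchC d τ) + 10 := by
        have h2 : 0 ≤ (k - i + (k - h')) * (B * searchC d τ) := Nat.zero_le _
        simp [RExpr.size] at hT
        omega
      have h3 : (k + 1) * ((buildBody d).cost τ + 30) ≤
          (k + 1) * B * ((buildBody d).cost τ + 30) := by
        rw [mul_assoc]
        exact Nat.mul_le_mul_left _ (Nat.le_mul_of_pos_left _ hB1)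
      have h4 : (k + k) * (B * searchC d τ) ≤ (k + 1) * B * (2 * searchC d τ) := by
        nlinarith [Nat.zero_le (B * searchC d τ)]
      have h5 : 50 ≤ (k + 1) * B * 50 := Nat.le_mul_of_pos_left _ (by positivity)
      have h6 : (k + 1) * B * decideC d τ = (k + 1) * B * ((buildBody d).cost τ + 30) +
          (k + 1) * B * (2 * searchC d τ) + (k + 1) * B * 50 := by rw [decideC]; ring
      omega
    · exact ((hs0.mono (by simp) (by simp)).trans (hs1.mono (by simp) (by simp))).trans
        (hs.mono (by simp [X]) (by simp))
    · intro g' hg' z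
      rw [hg g' hg'.ne', hs.1 (13, _) (by simp [X])]
      exact hf1 g' hg' z

end Decide

end RealRAM

namespace RealRAM

/-! ### Writing a new list next to the current one. -/

section NewList

variable {V σ : Type*} {n d : ℕ} {S : SketchableFamily V σ} {τ : ℕ}
  {P : Fin n → EuclideanSpace ℝ (Fin d)} {k L K g : ℕ} {side : ℝ} {idx : ℕ → Fin n}
  {A : ℕ → Set V}

/-- Append the point in `14` with the sketch in `src` to the list with the number of the current
grid. -/
def emit (src : Ref) : Prog :=
  .seq (.assign (ref2 10 (sv 11) (sv 22)) (ref2 10 (sv 5) (sv 14)).get)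
    (.seq (.skCopy (ref2 1 (sv 11) (sv 22)) src) (.assign (sr 22) (.add (sv 22) (nat 1))))

/-- The list with number `g` under construction has the entries `idx' j`, with the sets `A' j`, for
`j < c`. -/
structure NewList (S : SketchableFamily V σ) (s : St σ) (g c : ℕ) (idx' : ℕ → Fin n)
    (A' : ℕ → Set V) : Prop where
  count : s.m (22, []) = c
  entry : ∀ j < c, s.m (10, [(g : ℤ), (j : ℤ)]) = (idx' j : ℕ)
  sketch : ∀ j < c, s.sm (1, [(g : ℤ), (j : ℤ)]) = some (S.sketch (A' j))

theorem NewList.congr {s s' : St σ} {c : ℕ} {idx' : ℕ → Fin n} {A' : ℕ → Set V}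
    (h : NewList S s g c idx' A') (h1 : ∀ a, a.1 = 10 ∨ a.1 = 22 → s'.m a = s.m a)
    (h2 : ∀ a, a.1 = 1 → s'.sm a = s.sm a) : NewList S s' g c idx' A' where
  count := by rw [h1 _ (by simp), h.count]
  entry j hj := by rw [h1 _ (by simp), h.entry j hj]
  sketch j hj := by rw [h2 _ rfl, h.sketch j hj]

/-- The lists with numbers other than `g` are the same in `s` and `s'`. -/
def KeepsLists (g : ℕ) (s s' : St σ) : Prop :=
  ∀ L' : ℤ, L' ≠ g → ∀ z, s'.m (10, L' :: z) = s.m (10, L' :: z) ∧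
    s'.sm (1, L' :: z) = s.sm (1, L' :: z)

theorem KeepsLists.refl (g : ℕ) (s : St σ) : KeepsLists g s s := fun _ _ _ => ⟨rfl, rfl⟩

theorem KeepsLists.trans {s s' s'' : St σ} (h : KeepsLists g s s') (h' : KeepsLists g s' s'') :
    KeepsLists g s s'' := fun L' hL z =>
  ⟨(h' L' hL z).1.trans (h L' hL z).1, (h' L' hL z).2.trans (h L' hL z).2⟩

theorem Keeps.keepsLists {X Y : List ℕ} {s s' : St σ} (h : Keeps X Y s s') (hX : 10 ∉ X)
    (hY : 1 ∉ Y) : KeepsLists g s s' := fun _ _ _ => ⟨h.1 _ hX, h.2 _ hY⟩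

/-- The current list survives the construction of another one because the two carry different
numbers in the same tables. -/
theorem Env.keepsLists {s s' : St σ} (h : Env s P k L K g side idx) {X Y : List ℕ}
    (hs : Keeps X Y s s') (hX : ∀ x ∈ [2, 4, 5, 6, 7, 11], x ∉ X) {g' : ℕ}
    (hl : KeepsLists g' s s') (hL : L ≠ g') : Env s' P k L K g side idx where
  size := by rw [hs.1 _ (hX _ (by simp)), h.size]
  list := by rw [hs.1 _ (hX _ (by simp)), h.list]
  side := by rw [hs.1 _ (hX _ (by simp)), h.side]
  K := by rw [hs.1 _ (hX _ (by simp)), h.K]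
  grid := by rw [hs.1 _ (hX _ (by simp)), h.grid]
  entry j hj := by rw [(hl L (by exact_mod_cast hL) _).1, h.entry j hj]
  coord i j := by rw [hs.1 _ (hX _ (by simp)), h.coord i j]

/-- The entry in table `10` is written before the sketch is copied; `hsrc` says that this does not
change the address of the source. -/
theorem Env.run_emit {s : St σ} (h : Env s P k L K g side idx) {i c : ℕ} (hi : i < k)
    (hv : s.m (14, []) = i) {idx' : ℕ → Fin n} {A' : ℕ → Set V} (hl : NewList S s g c idx' A')
    {src : Ref} {a : Addr} (hsrc : ∀ m : Addr → ℝ,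
      (∀ x ≠ 10, ∀ z, m (x, z) = s.m (x, z)) → src.addr m = a) {X : Set V}
    (hX : s.sm a = some (S.sketch X)) :
    Keeps [10, 22] [1] s (run S (emit src) s) ∧ KeepsLists g s (run S (emit src) s) ∧
      NewList S (run S (emit src) s) g (c + 1) (Function.update idx' c (idx i))
        (Function.update A' c X) := by
  have e1 : run S (.assign (ref2 10 (sv 11) (sv 22)) (ref2 10 (sv 5) (sv 14)).get) s =
      s.set (10, [(g : ℤ), (c : ℤ)]) (idx i : ℕ) := by
    simp [run, h.grid, hl.count, h.list, hv, h.entry i hi]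
  have hr : run S (emit src) s = ((s.set (10, [(g : ℤ), (c : ℤ)]) (idx i : ℕ)).sset
      (1, [(g : ℤ), (c : ℤ)]) (some (S.sketch X))).set (22, []) (c + 1 : ℕ) := by
    have h1 : src.addr (s.set (10, [(g : ℤ), (c : ℤ)]) (idx i : ℕ)).m = a :=
      hsrc _ fun x hx z => by simp [hx]
    have e2 : run S (.skCopy (ref2 1 (sv 11) (sv 22)) src)
        (s.set (10, [(g : ℤ), (c : ℤ)]) (idx i : ℕ)) =
        (s.set (10, [(g : ℤ), (c : ℤ)]) (idx i : ℕ)).sset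
      (1, [(g : ℤ), (c : ℤ)]) (some (S.sketch X)) := by
      rw [run, h1]
      simp [h.grid, hl.count, hX]
    rw [emit, run, e1, run, e2]
    simp [run, hl.count]
  rw [hr]
  refine ⟨((Keeps.set _ _ (by simp)).trans (Keeps.sset _ _ (by simp))).trans
    (Keeps.set _ _ (by simp)), fun L' hL z => ⟨by simp [hL], by simp [hL]⟩, by simp,
    fun j hj => ?_, fun j hj => ?_⟩
  · rcases eq_or_ne j c with rfl | hjc
    · simp
    · have := hl.entry j (by omega)
      simp [hjc, this]
  · rcases eq_or_ne j c with rfl | hjc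
    · simp
    · have := hl.sketch j (by omega)
      simp [hjc, this]

/-- Make the list under construction the current one. -/
def commit : Prog := .seq (.assign (sr 5) (sv 11)) (.assign (sr 4) (sv 22))

theorem Env.run_commit {s : St σ} (h : Env s P k L K g side idx) {c : ℕ} {idx' : ℕ → Fin n}
    {A' : ℕ → Set V} (hl : NewList S s g c idx' A') :
    Keeps [4, 5] [] s (run S commit s) ∧ Env (run S commit s) P c g K g side idx' ∧
      ListSketches S (run S commit s) c g A' := by
  have hr : run S commit s = (s.set (5, []) g).set (4, []) c := by
    simp [commit, run, h.grid, hl.count]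
  rw [hr]
  refine ⟨(Keeps.set _ _ (by simp)).trans (Keeps.set _ _ (by simp)), ⟨by simp, by simp, ?_, ?_, ?_,
    fun j hj => ?_, fun i j => ?_⟩, fun j hj => by simpa using hl.sketch j hj⟩
  · simpa using h.side
  · simpa using h.K
  · simpa using h.grid
  · simpa using hl.entry j hj
  · simpa using h.coord i j

end NewList

/-! ### Removing isolated points. -/

section Prune

variable {V σ : Type*} {n d : ℕ} {S : SketchableFamily V σ} {τ : ℕ}
  {P : Fin n → EuclideanSpace ℝ (Fin d)} {k L K g : ℕ} {side : ℝ} {idx : ℕ → Fin n}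
  {A : ℕ → Set V}

/-- Note whether the neighbouring cell with the current offset is nonempty and different. -/
def scanBody (d : ℕ) : Prog :=
  inBall d (.ite (nat 0) (sumE d fun j => .mul (offE d j) (offE d j))
    (.ite (nat 0) (refC 13 (sv 11) (nbKey d)).get (.assign (sr 23) (nat 1)) .skip) .skip)

def scanInit (d : ℕ) : Prog :=
  .seq (.assign (sr 20) (sv 14)) (.ite (nat 1) (own d 13).get (.assign (sr 23) (nat 1))
    (.assign (sr 23) (nat 0)))

/-- Find out whether the point in `14` has a neighbour, and append it to the new list if so. -/
def pruneBody (d : ℕ) : Prog :=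
  .seq (scanInit d) (.seq (forP 15 (powE (boxB d) d) (scanBody d))
    (.ite (nat 0) (sv 23) (emit (ref2 1 (sv 5) (sv 14))) .skip))

/-- Remove the points of the list that have no other point in an adjacent cell. -/
def prune (d : ℕ) : Prog :=
  .seq (build d) (.seq (.assign (sr 22) (nat 0)) (.seq (forP 14 (sv 4) (pruneBody d)) commit))

/-- The position `i` of the list has a neighbour at another position. -/
def HasNb (k K : ℕ) (cell : ℕ → Fin d → ℤ) (i : ℕ) : Prop :=
  ∃ j < k, j ≠ i ∧ CellAdj K (cell i) (cell j)

theorem CellAdj.refl (K : ℕ) (z : Fin d → ℤ) : CellAdj K z z := by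
  rw [CellAdj]
  simp only [sub_self, mul_zero, Finset.sum_const_zero]
  positivity

/-- A neighbour lies in the same cell or in a different adjacent one. The first possibility is
already recorded in the flag `23`, and the scan looks for the second. It skips the zero offset
because the cell of the point itself is never empty. -/
theorem scan_spec {s : St σ} (h : Env s P k L K g side idx) {i : ℕ} (hi : i < k)
    (hv : s.m (20, []) = i) (hN : ∀ z, s.m (13, (g : ℤ) :: List.ofFn z) =
      ((Finset.range k).filter fun j => cellOf P side idx j = z).card)
    (h23 : 0 < s.m (23, []) ↔ ∃ j < k, j ≠ i ∧ cellOf P side idx j = cellOf P side idx i) :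
    Tri S τ (forP 15 (powE (boxB d) d) (scanBody d)) s fun s' T =>
      T ≤ ((2 * (K + d) + 1) ^ d + 1) * ((scanBody d).cost τ + 20 + (powE (boxB d) d).size) ∧
      Keeps [15, 23] [] s s' ∧ (0 < s'.m (23, []) ↔ HasNb k K (cellOf P side idx) i) := by
  set cell := cellOf P side idx with hcell
  have hE : ∀ {s' : St σ}, Keeps [15, 23] [] s s' → Env s' P k L K g side idx :=
    fun hs => h.keeps hs (by simp)
  refine (Tri.forP ((2 * (K + d) + 1) ^ d) ((scanBody d).cost τ)
    (fun e s' => s'.m (15, []) = e ∧ Keeps [15, 23] [] s s' ∧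
      (0 < s'.m (23, []) → HasNb k K cell i) ∧
      ((∃ j < k, j ≠ i ∧ cell j = cell i) → 0 < s'.m (23, [])) ∧
      ∀ e' < e, ∀ j < k, nbCell P K side idx i e' = cell j → cell j ≠ cell i →
        CellAdj K (cell i) (cell j) → 0 < s'.m (23, []))
    ?_ (fun e s' hs => hs.1) ?_ s ?_).mono ?_
  · rintro e s' ⟨-, hs, -⟩
    rw [eval_powE, eval_boxB (hE hs).K]
    push_cast
    ring
  · rintro e - s' ⟨h15, hs, h1, h2, h3⟩
    have hv' : s'.m (20, []) = i := by rw [hs.1 _ (by simp), hv]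
    refine Tri.straight (by simp [scanBody, inBall, Prog.Straight]) fun T hT => ⟨hT, ?_⟩
    have hb := (hE hs).run_inBall (S := S) (i := i) h15
      (.ite (nat 0) (sumE d fun j => .mul (offE d j) (offE d j))
        (.ite (nat 0) (refC 13 (sv 11) (nbKey d)).get (.assign (sr 23) (nat 1)) .skip) .skip)
    have hnorm : (sumE d fun j => .mul (offE d j) (offE d j)).eval s'.m =
        ((∑ j : Fin d, off (K + d) e j * off (K + d) e j : ℤ) : ℝ) := by
      simp only [eval_sumE, eval_mul, eval_offE (hE hs).K h15]
      push_cast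
      rfl
    have hnorm0 : 0 < ∑ j : Fin d, off (K + d) e j * off (K + d) e j ↔
        nbCell P K side idx i e ≠ cell i := by
      rw [lt_iff_le_and_ne, and_iff_right (Finset.sum_nonneg fun j _ => mul_self_nonneg _), ne_comm,
        not_iff_not, Finset.sum_eq_zero_iff_of_nonneg fun j _ => mul_self_nonneg _]
      simp [funext_iff, nbCell, hcell]
    have hcn : (refC 13 (sv 11) (nbKey d)).get.eval s'.m =
        ((Finset.range k).filter fun j => cell j = nbCell P K side idx i e).card := by
      rw [eval_get, (hE hs).addr_nb hi hv' h15, hs.1 _ (by simp), hN]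
    have hcn0 : 0 < (((Finset.range k).filter fun j =>
        cell j = nbCell P K side idx i e).card : ℝ) ↔
        ∃ j < k, cell j = nbCell P K side idx i e := by
      rw [Nat.cast_pos, Finset.card_pos]
      simp [Finset.Nonempty]
    have hstep : (run S (scanBody d) s' = s' ∧ ∀ j < k, nbCell P K side idx i e = cell j →
        cell j ≠ cell i → ¬ CellAdj K (cell i) (cell j)) ∨
        run S (scanBody d) s' = s'.set (23, []) 1 ∧ HasNb k K cell i := by
      by_cases hadj : CellAdj K (cell i) (nbCell P K side idx i e)
      · by_cases hne : nbCell P K side idx i e ≠ cell i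
        · by_cases hex : ∃ j < k, cell j = nbCell P K side idx i e
          · right
            constructor
            · rw [scanBody, hb.1 hadj, run, if_pos, run, if_pos]
              · simp [run]
              · rw [hcn, eval_nat, Nat.cast_zero]
                exact hcn0.2 hex
              · rw [hnorm, eval_nat, Nat.cast_zero]
                exact_mod_cast hnorm0.2 hne
            · obtain ⟨j, hj, hjc⟩ := hex
              refine ⟨j, hj, ?_, hjc ▸ hadj⟩
              rintro rfl
              exact hne hjc.symm
          · left
            constructor
            · rw [scanBody, hb.1 hadj, run, if_pos, run, if_neg]
              · rfl
              · rw [hcn, eval_nat, Nat.cast_zero]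
                exact fun h' => hex (hcn0.1 h')
              · rw [hnorm, eval_nat, Nat.cast_zero]
                exact_mod_cast hnorm0.2 hne
            · intro j hj hjc
              exact absurd ⟨j, hj, hjc.symm⟩ hex
        · left
          constructor
          · rw [scanBody, hb.1 hadj, run, if_neg]
            · rfl
            · rw [hnorm, eval_nat, Nat.cast_zero]
              exact fun h' => hne (hnorm0.1 (by exact_mod_cast h'))
          · intro j hj hjc hji
            exact absurd (hjc ▸ hji) hne
      · left
        exact ⟨hb.2 hadj, fun j _ hjc _ ha => hadj (hjc ▸ ha)⟩
    rcases hstep with ⟨hr, hn⟩ | ⟨hr, hn⟩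
    · rw [hr]
      refine ⟨h15, by simp, hs.trans (Keeps.set _ _ (by simp)), by simpa using h1, by simpa using h2,
        fun e' he' j hj hje hji ha => ?_⟩
      rw [St.set_m, if_neg (by simp)]
      rcases Nat.lt_succ_iff_lt_or_eq.1 he' with h4 | rfl
      · exact h3 e' h4 j hj hje hji ha
      · exact absurd ha (hn j hj hje hji)
    · rw [hr]
      exact ⟨by simp [h15], by simp, (hs.trans (Keeps.set _ _ (by simp))).trans
        (Keeps.set _ _ (by simp)), fun _ => hn, by simp, by simp⟩
  · refine ⟨by simp, Keeps.set _ _ (by simp), ?_, ?_, by simp⟩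
    · simp only [St.set_m]
      rw [if_neg (by simp), h23]
      rintro ⟨j, hj, hji, hjc⟩
      refine ⟨j, hj, hji, ?_⟩
      rw [hjc]
      exact CellAdj.refl _ _
    · simp only [St.set_m]
      rw [if_neg (by simp), h23]
      exact id
  · rintro s' T ⟨⟨-, hs, h1, h2, h3⟩, hT⟩
    refine ⟨hT, hs, h1, ?_⟩
    rintro ⟨j, hj, hji, ha⟩
    by_cases hjc : cell j = cell i
    · exact h2 ⟨j, hj, hji, hjc⟩
    · obtain ⟨e, he, hoff⟩ := exists_off (K + d) (fun l => cell j l - cell i l)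
        (abs_le_of_cellAdj ha)
      refine h3 e he j hj ?_ hjc ha
      funext l
      rw [nbCell, hoff l]
      ring

/-- The time of `prune`, up to the numbers of points and offsets. -/
def pruneC (d τ : ℕ) : ℕ :=
  (buildBody d).cost τ + 2 * ((scanBody d).cost τ + 20 + (powE (boxB d) d).size) +
    (scanInit d).cost τ + (Prog.ite (nat 0) (sv 23) (emit (ref2 1 (sv 5) (sv 14))) .skip).cost τ +
    120

/-- Here `ctr` lists the surviving positions without repetition, and `hL` ensures that the new list,
numbered `g + 1`, does not overwrite the current one. -/
theorem prune_spec (hA : DisjointSets k A) {s : St σ} (h : Env s P k L K g side idx)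
    (hsk : ListSketches S s k L A) (hfr : Fresh s g) (hL : L ≤ g) :
    Tri S τ (prune d) s fun s' T =>
      T ≤ (k + 1) * (2 * (K + d) + 1) ^ d * pruneC d τ ∧
      Keeps [4, 5, 10, 11, 12, 13, 14, 15, 20, 22, 23] [1, 2] s s' ∧ KeepsLists (g + 1) s s' ∧
      Fresh s' (g + 1) ∧ ∃ c, ∃ ctr : ℕ → ℕ, Env s' P c (g + 1) K (g + 1) side (idx ∘ ctr) ∧
        ListSketches S s' c (g + 1) (A ∘ ctr) ∧
        (∀ a < c, ∀ b < c, ctr a = ctr b → a = b) ∧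
        ∀ i, (∃ a < c, ctr a = i) ↔ i < k ∧ HasNb k K (cellOf P side idx) i := by
  set cell := cellOf P side idx with hcell
  set B := (2 * (K + d) + 1) ^ d with hB
  have hB1 : 1 ≤ B := Nat.one_le_pow _ _ (by omega)
  refine Tri.seq ((build_spec hA h hsk hfr).mono ?_)
  rintro s0 T0 ⟨hT0, hs0, hE0, hf0, -, hN0⟩
  refine Tri.seq (Tri.straight (by simp [Prog.Straight]) fun T1 hT1 => ?_)
  have hT1' : T1 ≤ 3 := by simpa [Prog.cost] using hT1
  have e1 : run S (.assign (sr 22) (nat 0)) s0 = s0.set (22, []) 0 := by simp [run]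
  rw [e1]
  set s1 := s0.set (22, []) 0 with hs1def
  have hs1 : Keeps [22] [] s0 s1 := Keeps.set _ _ (by simp)
  have hE1 : Env s1 P k L K (g + 1) side idx := hE0.keeps hs1 (by simp)
  let X : List ℕ := [10, 14, 15, 20, 22, 23]
  have hEX : ∀ {s' : St σ}, Keeps X [1] s1 s' → KeepsLists (g + 1) s1 s' →
      Env s' P k L K (g + 1) side idx :=
    fun hs hl => hE1.keepsLists hs (by simp [X]) hl (by omega)
  have hsk1 : ∀ j < k, s1.sm (1, [(L : ℤ), (j : ℤ)]) = some (S.sketch (A j)) := fun j hj => by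
    rw [hs1.2 _ (by simp), hs0.2 _ (by simp), hsk j hj]
  set Ts := 2 * ((scanBody d).cost τ + 20 + (powE (boxB d) d).size)
  set Te := (Prog.ite (nat 0) (sv 23) (emit (ref2 1 (sv 5) (sv 14))) .skip).cost τ
  refine Tri.seq ((Tri.forP k (B * Ts + (scanInit d).cost τ + Te + 2)
    (fun i s' => s'.m (14, []) = i ∧
      Keeps X [1] s1 s' ∧ KeepsLists (g + 1) s1 s' ∧ ∃ c, ∃ ctr : ℕ → ℕ,
      NewList S s' (g + 1) c (idx ∘ ctr) (A ∘ ctr) ∧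
      (∀ a < c, ∀ b < c, ctr a = ctr b → a = b) ∧
      ∀ j, (∃ a < c, ctr a = j) ↔ j < i ∧ HasNb k K cell j) ?_ (fun i s' hs => hs.1)
    ?_ s1 ?_).mono ?_)
  · rintro i s' ⟨-, hs, hl, -⟩
    rw [eval_sv, (hEX hs hl).size]
  · rintro i hi s' ⟨h14, hs, hl, c, ctr, hnl, hinj, hmem⟩
    have hE := hEX hs hl
    have hN : ∀ z, s'.m (13, ((g + 1 : ℕ) : ℤ) :: List.ofFn z) =
        ((Finset.range k).filter fun j => cell j = z).card := fun z => by
      rw [hs.1 _ (by simp [X]), hs1.1 _ (by simp), hN0]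
    refine Tri.seq (Tri.straight (by simp [scanInit, Prog.Straight]) fun T2 hT2 => ?_)
    have e2 : Keeps [20, 23] [] s' (run S (scanInit d) s') ∧
        (run S (scanInit d) s').m (20, []) = i ∧ (0 < (run S (scanInit d) s').m (23, []) ↔
          ∃ j < k, j ≠ i ∧ cell j = cell i) := by
      have h2 : Env (s'.set (20, []) i) P k L K (g + 1) side idx :=
        hE.keeps (Keeps.set (X := [20]) (Y := []) s' _ (by simp)) (by simp)
      have h3 : (own d 13).get.eval (s'.set (20, []) i).m =
          ((Finset.range k).filter fun j => cell j = cell i).card := by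
        rw [eval_get, h2.addr_own hi (by simp [h14]), St.set_m, if_neg (by simp), hN]
      have h4 : 1 < ((Finset.range k).filter fun j => cell j = cell i).card ↔
          ∃ j < k, j ≠ i ∧ cell j = cell i := by
        rw [Finset.one_lt_card_iff]
        simp only [Finset.mem_filter, Finset.mem_range]
        constructor
        · rintro ⟨a, b, ⟨ha, hac⟩, ⟨hb, hbc⟩, hab⟩
          rcases eq_or_ne a i with rfl | hai
          · exact ⟨b, hb, hab.symm, hbc⟩
          · exact ⟨a, ha, hai, hac⟩
        · rintro ⟨j, hj, hji, hjc⟩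
          exact ⟨j, i, ⟨hj, hjc⟩, ⟨hi, rfl⟩, hji⟩
      have e3 : run S (.assign (sr 20) (sv 14)) s' = s'.set (20, []) i := by simp [run, h14]
      by_cases hc : ∃ j < k, j ≠ i ∧ cell j = cell i
      · have hr : run S (scanInit d) s' = (s'.set (20, []) i).set (23, []) 1 := by
          rw [scanInit, run, e3, run, h3, if_pos]
          · simp [run]
          · rw [eval_nat]
            exact_mod_cast h4.2 hc
        rw [hr]
        exact ⟨(Keeps.set _ _ (by simp)).trans (Keeps.set _ _ (by simp)), by simp, by simpa using hc⟩
      · have hr : run S (scanInit d) s' = (s'.set (20, []) i).set (23, []) 0 := by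
          rw [scanInit, run, e3, run, h3, if_neg]
          · simp [run]
          · rw [eval_nat]
            exact fun h' => hc (h4.1 (by exact_mod_cast h'))
        rw [hr]
        exact ⟨(Keeps.set _ _ (by simp)).trans (Keeps.set _ _ (by simp)), by simp, by simpa using hc⟩
    obtain ⟨hs2, h20, h23⟩ := e2
    refine Tri.seq ((scan_spec (hE.keeps hs2 (by simp)) hi h20
      (fun z => by rw [hs2.1 _ (by simp), hN]) h23).mono ?_)
    rintro s3 T3 ⟨hT3, hs3, h23'⟩
    have hs3' : Keeps [15, 20, 23] [] s' s3 :=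
      (hs2.mono (by simp) (by simp)).trans (hs3.mono (by simp) (by simp))
    have hE3 : Env s3 P k L K (g + 1) side idx := hE.keeps hs3' (by simp)
    have h143 : s3.m (14, []) = i := by rw [hs3'.1 _ (by simp), h14]
    have hnl3 : NewList S s3 (g + 1) c (idx ∘ ctr) (A ∘ ctr) :=
      hnl.congr (fun a ha => hs3'.1 a (by rcases ha with ha | ha <;> rw [ha] <;> simp))
        fun a ha => hs3'.2 a (by simp)
    refine Tri.straight (by simp [emit, Prog.Straight]) fun T4 hT4 => ?_
    have htime : 1 + T2 + (1 + T3 + T4) ≤ B * Ts + (scanInit d).cost τ + Te + 2 := by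
      have h5 : T3 ≤ B * Ts := by
        refine hT3.trans ?_
        rw [← hB]
        simp only [Ts]
        nlinarith
      omega
    have hend : ∀ s4 : St σ, Keeps [10, 22] [1] s3 s4 → KeepsLists (g + 1) s3 s4 →
        (∃ c, ∃ ctr : ℕ → ℕ,
          NewList S s4 (g + 1) c (idx ∘ ctr) (A ∘ ctr) ∧
          (∀ a < c, ∀ b < c, ctr a = ctr b → a = b) ∧
          ∀ j, (∃ a < c, ctr a = j) ↔ j < i + 1 ∧ HasNb k K cell j) →
        s4.m (14, []) = i ∧ (s4.set (14, []) (i + 1)).m (14, []) = (i + 1 : ℕ) ∧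
        Keeps X [1] s1 (s4.set (14, []) (i + 1)) ∧
        KeepsLists (g + 1) s1 (s4.set (14, []) (i + 1)) ∧
        ∃ c, ∃ ctr : ℕ → ℕ,
          NewList S (s4.set (14, []) (i + 1)) (g + 1) c (idx ∘ ctr) (A ∘ ctr) ∧
          (∀ a < c, ∀ b < c, ctr a = ctr b → a = b) ∧
          ∀ j, (∃ a < c, ctr a = j) ↔ j < i + 1 ∧ HasNb k K cell j := by
      rintro s4 hs4 hl4 ⟨c', ctr', hnl', hinj', hmem'⟩
      have hs5 : Keeps [14] [] s4 (s4.set (14, []) (i + 1)) := Keeps.set _ _ (by simp)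
      refine ⟨by rw [hs4.1 _ (by simp), h143], by simp, ?_, ?_, c', ctr', ?_, hinj', hmem'⟩
      · exact ((hs.trans (hs3'.mono (by simp [X]) (by simp))).trans
          (hs4.mono (by simp [X]) (by simp))).trans (hs5.mono (by simp [X]) (by simp))
      · exact ((hl.trans (hs3'.keepsLists (by simp) (by simp))).trans hl4).trans
          (hs5.keepsLists (by simp) (by simp))
      · exact hnl'.congr (fun a ha => hs5.1 a (by rcases ha with ha | ha <;> rw [ha] <;> simp))
          fun a ha => hs5.2 a (by simp)
    refine ⟨htime, ?_⟩
    by_cases hnb : HasNb k K cell i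
    · have hr : run S (.ite (nat 0) (sv 23) (emit (ref2 1 (sv 5) (sv 14))) .skip) s3 =
          run S (emit (ref2 1 (sv 5) (sv 14))) s3 := by
        rw [run, if_pos]
        simpa using h23'.2 hnb
      rw [hr]
      obtain ⟨hs4, hl4, hnl4⟩ := hE3.run_emit (src := ref2 1 (sv 5) (sv 14))
        (a := (1, [(L : ℤ), (i : ℤ)])) (X := A i) hi h143 hnl3
        (fun m hm => by simp [hm, hE3.list, h143])
        (by rw [hs3'.2 _ (by simp), (hl L (by push_cast; omega) _).2, hsk1 i hi])
      refine hend _ hs4 hl4 ⟨c + 1, Function.update ctr c i, ?_, ?_, fun j => ?_⟩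
      · rwa [Function.comp_update, Function.comp_update]
      · intro a ha b hb hab
        -- Only positions below `i` have been appended so far.
        have hctr : ∀ a < c, ctr a ≠ i := fun a ha h' =>
          absurd ((hmem i).1 ⟨a, ha, h'⟩).1 (lt_irrefl _)
        rcases eq_or_ne a c with hac | hac <;> rcases eq_or_ne b c with hbc | hbc
        · rw [hac, hbc]
        · rw [hac, Function.update_self, Function.update_of_ne hbc] at hab
          exact absurd hab.symm (hctr b (by omega))
        · rw [hbc, Function.update_self, Function.update_of_ne hac] at hab
          exact absurd hab (hctr a (by omega))
        · rw [Function.update_of_ne hac, Function.update_of_ne hbc] at hab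
          exact hinj a (by omega) b (by omega) hab
      · constructor
        · rintro ⟨a, ha, haj⟩
          rcases eq_or_ne a c with rfl | hac
          · rw [Function.update_self] at haj
            subst haj
            exact ⟨by omega, hnb⟩
          · rw [Function.update_of_ne hac] at haj
            have := (hmem j).1 ⟨a, by omega, haj⟩
            exact ⟨by omega, this.2⟩
        · rintro ⟨hj, hjn⟩
          rcases Nat.lt_succ_iff_lt_or_eq.1 hj with h5 | rfl
          · obtain ⟨a, ha, haj⟩ := (hmem j).2 ⟨h5, hjn⟩
            exact ⟨a, by omega, by rw [Function.update_of_ne ha.ne, haj]⟩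
          · exact ⟨c, by omega, by simp⟩
    · have hr : run S (.ite (nat 0) (sv 23) (emit (ref2 1 (sv 5) (sv 14))) .skip) s3 = s3 := by
        rw [run, if_neg]
        · rfl
        · simpa using fun h' => hnb (h23'.1 h')
      rw [hr]
      refine hend _ (Keeps.refl _ _ _) (KeepsLists.refl _ _) ⟨c, ctr, hnl3, hinj, fun j => ?_⟩
      rw [hmem]
      refine and_congr_left fun hjn => ⟨fun h' => by omega, fun h' => ?_⟩
      rcases Nat.lt_succ_iff_lt_or_eq.1 h' with h5 | rfl
      · exact h5
      · exact absurd hjn hnb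
  · have hs2 : Keeps [14] [] s1 (s1.set (14, []) 0) := Keeps.set _ _ (by simp)
    exact ⟨by simp, hs2.mono (by simp [X]) (by simp), hs2.keepsLists (by simp) (by simp), 0,
      fun _ => 0, ⟨by simp [hs1def], by simp, by simp⟩, by simp, by simp⟩
  · rintro s2 T2 ⟨⟨-, hs2, hl2, c, ctr, hnl, hinj, hmem⟩, hT2⟩
    refine Tri.straight (by simp [commit, Prog.Straight]) fun T3 hT3 => ?_
    have hT3' : T3 ≤ 10 := by
      refine hT3.trans ?_
      simp [commit, Prog.cost]
    obtain ⟨hs3, hE3, hsk3⟩ := (hEX hs2 hl2).run_commit (S := S) hnl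
    refine ⟨?_, ?_, ?_, ?_, c, ctr, hE3, hsk3, hinj, hmem⟩
    · simp only [size_sv] at hT2
      have h1 : k + 1 ≤ (k + 1) * B := Nat.le_mul_of_pos_right _ hB1
      have h2 : (k + 1) * B * pruneC d τ = (k + 1) * B * ((buildBody d).cost τ + 30) +
          (k + 1) * B * Ts + (k + 1) * B * ((scanInit d).cost τ + Te + 90) := by
        rw [pruneC]; ring
      have h3 := Nat.mul_le_mul_right ((buildBody d).cost τ + 30) h1
      have h4 := Nat.mul_le_mul_right ((scanInit d).cost τ + Te + 90) h1
      have h5 : (k + 1) * (B * Ts + (scanInit d).cost τ + Te + 2 + 20 + 1) + 60 ≤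
          (k + 1) * B * Ts + (k + 1) * ((scanInit d).cost τ + Te + 90) := by
        nlinarith
      omega
    · exact ((hs0.mono (by simp) (by simp)).trans (hs1.mono (by simp) (by simp))).trans
        ((hs2.mono (by simp [X]) (by simp)).trans (hs3.mono (by simp) (by simp)))
    · exact ((hs0.keepsLists (by simp) (by simp)).trans (hs1.keepsLists (by simp) (by simp))).trans
        (hl2.trans (hs3.keepsLists (by simp) (by simp)))
    · refine hf0.congr fun a ha => ?_
      rw [hs3.1 a (by rcases ha with ha | ha <;> rw [ha] <;> simp),
        hs2.1 a (by rcases ha with ha | ha <;> rw [ha] <;> simp [X]),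
        hs1.1 a (by rcases ha with ha | ha <;> rw [ha] <;> simp)]

end Prune

end RealRAM

namespace RealRAM

/-! ### Greedy construction of a net. -/

section Net

variable {V σ : Type*} {n d : ℕ} {S : SketchableFamily V σ} {τ : ℕ}
  {P : Fin n → EuclideanSpace ℝ (Fin d)} {k L K g : ℕ} {side : ℝ} {idx : ℕ → Fin n}
  {A : ℕ → Set V}

/-- If the cell of the point in `14` is still in the hash table, merge it with all its neighbours
that are still there, and append the point to the new list. -/
def netBody (d : ℕ) : Prog :=
  .ite (nat 0) (own d 12).get
    (.seq (.seq (startCluster d) (.assign (sr 20) (sv 14))) (.seq (expand d) (emit (sr 3)))) .skip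

/-- Replace the list by a net. -/
def net (d : ℕ) : Prog :=
  .seq (build d) (.seq (.seq (.assign (sr 22) (nat 0)) (.assign (sr 17) (nat 0)))
    (.seq (forP 14 (sv 4) (netBody d)) commit))

/-- The state of the greedy construction of a net: `W` are the cells not yet covered, and for
`a < c` the cells in `Z a` have been merged with the cell of the position `ctr a`. -/
structure Net (K k : ℕ) (cell : ℕ → Fin d → ℤ) (cells W : Finset (Fin d → ℤ)) (c : ℕ)
    (ctr : ℕ → ℕ) (Z : ℕ → Finset (Fin d → ℤ)) (i : ℕ) : Prop where
  mem : ∀ z, z ∈ cells ↔ z ∈ W ∨ ∃ a < c, z ∈ Z a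
  disjW : ∀ a < c, Disjoint W (Z a)
  disj : ∀ a < c, ∀ b < c, a ≠ b → Disjoint (Z a) (Z b)
  self : ∀ a < c, cell (ctr a) ∈ Z a
  adj : ∀ a < c, ∀ z ∈ Z a, CellAdj K (cell (ctr a)) z
  far : ∀ a < c, ∀ z ∈ W, ¬ CellAdj K (cell (ctr a)) z
  sep : ∀ a < c, ∀ b < c, a ≠ b → ¬ CellAdj K (cell (ctr a)) (cell (ctr b))
  lt : ∀ a < c, ctr a < k
  seen : ∀ j < i, cell j ∉ W

theorem Net.skip {cell : ℕ → Fin d → ℤ} {cells W : Finset (Fin d → ℤ)} {c i : ℕ} {ctr : ℕ → ℕ}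
    {Z : ℕ → Finset (Fin d → ℤ)} (H : Net K k cell cells W c ctr Z i) (hi : cell i ∉ W) :
    Net K k cell cells W c ctr Z (i + 1) :=
  { H with
    seen := fun j hj => by
      rcases Nat.lt_succ_iff_lt_or_eq.1 hj with h1 | rfl
      · exact H.seen j h1
      · exact hi }

theorem forall_update {α : Type*} {c : ℕ} (f : ℕ → α) (x : α) (p : ℕ → α → Prop)
    (h : ∀ a < c, p a (f a)) (hc : p c x) :
    ∀ a < c + 1, p a (Function.update f c x a) := by
  intro a ha
  rcases Nat.lt_succ_iff_lt_or_eq.1 ha with h1 | rfl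
  · rw [Function.update_of_ne h1.ne]
    exact h a h1
  · rw [Function.update_self]
    exact hc

/-- A centre absorbs every uncovered cell adjacent to its own. Thus `far` for the old centres,
applied to the still uncovered cell of the new one, gives `sep`, and `hna` restores `far`. -/
theorem Net.step {cell : ℕ → Fin d → ℤ} {cells W : Finset (Fin d → ℤ)} {c i : ℕ} {ctr : ℕ → ℕ}
    {Z : ℕ → Finset (Fin d → ℤ)} (H : Net K k cell cells W c ctr Z i) (hi : cell i ∈ W)
    (hik : i < k) {W' C' : Finset (Fin d → ℤ)} {t t' : ℕ} {q q' : ℕ → ℕ}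
    (hx : Expanded K cell i (W.erase (cell i)) {cell i} W' C' t t' q q')
    (hna : ∀ z ∈ W', ¬ CellAdj K (cell i) z) :
    Net K k cell cells W' (c + 1) (Function.update ctr c i) (Function.update Z c C') (i + 1) := by
  have hW'W : W' ⊆ W := hx.sub.trans (Finset.erase_subset _ _)
  have hC'W : C' ⊆ W := by
    intro z hz
    rcases (hx.union z).1 hz with h1 | h1
    · rw [Finset.mem_singleton] at h1
      exact h1 ▸ hi
    · exact Finset.mem_of_mem_erase h1.1
  have hiC : cell i ∈ C' := (hx.union _).2 (.inl (by simp))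
  have hadjC : ∀ z ∈ C', CellAdj K (cell i) z := by
    intro z hz
    rcases (hx.union z).1 hz with h1 | h1
    · rw [Finset.mem_singleton] at h1
      rw [h1]
      exact CellAdj.refl _ _
    · exact hx.adj z h1.1 h1.2
  have hlt : ∀ {a}, a < c + 1 → a ≠ c → a < c := fun h h' => by omega
  refine ⟨fun z => ?_, ?_, ?_, ?_, ?_, ?_, ?_, ?_, ?_⟩
  · have h1 : (∃ a < c + 1, z ∈ Function.update Z c C' a) ↔ (∃ a < c, z ∈ Z a) ∨ z ∈ C' := by
      constructor
      · rintro ⟨a, ha, hz⟩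
        rcases eq_or_ne a c with rfl | hac
        · exact .inr (by simpa using hz)
        · exact .inl ⟨a, by omega, by simpa [hac] using hz⟩
      · rintro (⟨a, ha, hz⟩ | hz)
        · exact ⟨a, by omega, by simpa [ha.ne] using hz⟩
        · exact ⟨c, by omega, by simpa using hz⟩
    rw [h1, H.mem, hx.union]
    have h2 := @hx.sub z
    rw [Finset.mem_singleton, Finset.mem_erase] at *
    by_cases hz : z = cell i
    · subst hz; simp [hi]
    · by_cases hz' : z ∈ W'
      · simp [hz', h2 hz']
      · simp only [hz, hz', not_false_eq_true, and_true, true_and, ne_eq, false_or]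
        exact or_comm
  · refine forall_update Z C' (fun _ z => Disjoint W' z)
      (fun a ha => (H.disjW a ha).mono_left hW'W) (hx.disjoint (by simp))
  · intro a ha b hb hab
    rcases eq_or_ne a c with hac | hac <;> rcases eq_or_ne b c with hbc | hbc
    · exact absurd (hac.trans hbc.symm) hab
    · rw [hac, Function.update_self, Function.update_of_ne hbc]
      exact (H.disjW b (hlt hb hbc)).mono_left hC'W
    · rw [hbc, Function.update_self, Function.update_of_ne hac]
      exact ((H.disjW a (hlt ha hac)).mono_left hC'W).symm
    · rw [Function.update_of_ne hac, Function.update_of_ne hbc]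
      exact H.disj a (hlt ha hac) b (hlt hb hbc) hab
  · intro a ha
    rcases eq_or_ne a c with hac | hac
    · rw [hac, Function.update_self, Function.update_self]
      exact hiC
    · rw [Function.update_of_ne hac, Function.update_of_ne hac]
      exact H.self a (hlt ha hac)
  · intro a ha
    rcases eq_or_ne a c with hac | hac
    · rw [hac, Function.update_self, Function.update_self]
      exact hadjC
    · rw [Function.update_of_ne hac, Function.update_of_ne hac]
      exact H.adj a (hlt ha hac)
  · exact forall_update ctr i (fun _ j => ∀ z ∈ W', ¬ CellAdj K (cell j) z)
      (fun a ha z hz => H.far a ha z (hW'W hz)) hna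
  · intro a ha b hb hab
    rcases eq_or_ne a c with hac | hac <;> rcases eq_or_ne b c with hbc | hbc
    · exact absurd (hac.trans hbc.symm) hab
    · rw [hac, Function.update_self, Function.update_of_ne hbc]
      exact fun h' => H.far b (hlt hb hbc) _ hi h'.symm
    · rw [hbc, Function.update_self, Function.update_of_ne hac]
      exact H.far a (hlt ha hac) _ hi
    · rw [Function.update_of_ne hac, Function.update_of_ne hbc]
      exact H.sep a (hlt ha hac) b (hlt hb hbc) hab
  · exact forall_update ctr i (fun _ j => j < k) H.lt hik
  · intro j hj
    rcases Nat.lt_succ_iff_lt_or_eq.1 hj with h1 | rfl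
    · exact fun h' => H.seen j h1 (hW'W h')
    · exact fun h' => Finset.notMem_erase _ _ (hx.sub h')

theorem Grid.erase {s : St σ} {cell : ℕ → Fin d → ℤ} {W : Finset (Fin d → ℤ)}
    (h : Grid S s k g cell A W) (z : Fin d → ℤ) :
    Grid S (s.set (12, (g : ℤ) :: List.ofFn z) 0) k g cell A (W.erase z) := by
  refine ⟨fun w hw => ?_, fun w hw => ?_, fun w hw => ?_⟩
  · rw [Finset.mem_erase] at hw
    obtain ⟨j, hj, hc, hm⟩ := h.mem w hw.2
    exact ⟨j, hj, hc, by simp [hm, List.ofFn_inj, hw.1]⟩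
  · by_cases hwz : w = z
    · simp [hwz]
    · have := h.not_mem w fun h' => hw (Finset.mem_erase.2 ⟨hwz, h'⟩)
      simp [this]
  · rw [Finset.mem_erase] at hw
    simpa using h.sketch w hw.2

/-- The time of `net`, up to the numbers of points and offsets. -/
def netC (d τ : ℕ) : ℕ :=
  (buildBody d).cost τ + 2 * ((expandBody d).cost τ + 20 + (powE (boxB d) d).size) +
    (Prog.seq (startCluster d) (.assign (sr 20) (sv 14))).cost τ + (emit (sr 3)).cost τ +
    (own d 12).get.size + 150

/-- Each centre is expanded once only, so the queue that `expand` fills is never read here. No cell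
stays uncovered, as each is the cell of a position that has been seen. -/
theorem net_spec (hA : DisjointSets k A) {s : St σ} (h : Env s P k L K g side idx)
    (hsk : ListSketches S s k L A) (hfr : Fresh s g) (hL : L ≤ g) :
    Tri S τ (net d) s fun s' T =>
      T ≤ (k + 1) * (2 * (K + d) + 1) ^ d * netC d τ ∧
      Keeps [4, 5, 10, 11, 12, 13, 14, 15, 17, 18, 20, 22] [1, 2, 3] s s' ∧
      KeepsLists (g + 1) s s' ∧ Fresh s' (g + 1) ∧
      ∃ c, ∃ ctr : ℕ → ℕ, ∃ Z : ℕ → Finset (Fin d → ℤ),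
        Env s' P c (g + 1) K (g + 1) side (idx ∘ ctr) ∧
        ListSketches S s' c (g + 1) (fun a => unionOf k (cellOf P side idx) A (Z a)) ∧
        Net K k (cellOf P side idx) ((Finset.range k).image (cellOf P side idx)) ∅ c ctr Z k := by
  set cell := cellOf P side idx with hcell
  set cells := (Finset.range k).image cell with hcells
  set B := (2 * (K + d) + 1) ^ d with hB
  have hB1 : 1 ≤ B := Nat.one_le_pow _ _ (by omega)
  refine Tri.seq ((build_spec hA h hsk hfr).mono ?_)
  rintro s0 T0 ⟨hT0, hs0, hE0, hf0, hG0, -⟩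
  refine Tri.seq (Tri.straight (by simp [Prog.Straight]) fun T1 hT1 => ?_)
  have hT1' : T1 ≤ 7 := by simpa [Prog.cost] using hT1
  have e1 : run S (.seq (.assign (sr 22) (nat 0)) (.assign (sr 17) (nat 0))) s0 =
      (s0.set (22, []) 0).set (17, []) 0 := by simp [run]
  rw [e1]
  set s1 := (s0.set (22, []) 0).set (17, []) 0 with hs1def
  have hs1 : Keeps [17, 22] [] s0 s1 :=
    (Keeps.set _ _ (by simp)).trans (Keeps.set _ _ (by simp))
  have hE1 : Env s1 P k L K (g + 1) side idx := hE0.keeps hs1 (by simp)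
  have hG1 : Grid S s1 k (g + 1) cell A cells := hG0.congr
    (fun a ha => hs1.1 a (by rw [ha]; simp)) (fun a ha => hs1.2 a (by simp))
  let X : List ℕ := [10, 12, 14, 15, 17, 18, 20, 22]
  have hEX : ∀ {s' : St σ}, Keeps X [1, 3] s1 s' → KeepsLists (g + 1) s1 s' →
      Env s' P k L K (g + 1) side idx :=
    fun hs hl => hE1.keepsLists hs (by simp [X]) hl (by omega)
  set Ts := 2 * ((expandBody d).cost τ + 20 + (powE (boxB d) d).size)
  set Te := (emit (sr 3)).cost τ
  set Ti := (Prog.seq (startCluster d) (.assign (sr 20) (sv 14))).cost τ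
  refine Tri.seq ((Tri.forP k (B * Ts + Ti + Te + (own d 12).get.size + 10)
    (fun i s' => s'.m (14, []) = i ∧
      Keeps X [1, 3] s1 s' ∧ KeepsLists (g + 1) s1 s' ∧
      (∀ g' ≠ ((g + 1 : ℕ) : ℤ), ∀ z, s'.m (12, g' :: z) = s1.m (12, g' :: z)) ∧
      ∃ c ctr Z W t q,
      NewList S s' (g + 1) c (idx ∘ ctr) (fun a => unionOf k cell A (Z a)) ∧
      Net K k cell cells W c ctr Z i ∧ Grid S s' k (g + 1) cell A W ∧ Queue s' k t q)
      ?_ (fun i s' hs => hs.1) ?_ s1 ?_).mono ?_)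
  · rintro i s' ⟨-, hs, hl, -⟩
    rw [eval_sv, (hEX hs hl).size]
  · rintro i hi s' ⟨h14, hs, hl, hg, c, ctr, Z, W, t, q, hnl, hN, hG, hQ⟩
    have hE := hEX hs hl
    set key : List ℤ := ((g + 1 : ℕ) : ℤ) :: List.ofFn (cell i) with hkey
    have hown : (own d 12).get.eval s'.m = s'.m (12, key) := by
      rw [eval_get, hE.addr_own hi h14, hkey]
    refine Tri.ite (fun hc => ?_) (fun hc => ?_)
    · rw [hown, eval_nat, Nat.cast_zero] at hc
      have hiW : cell i ∈ W := by
        by_contra h'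
        rw [hkey, hG.not_mem _ h'] at hc
        exact lt_irrefl _ hc
      refine Tri.seq (Tri.straight (by simp [startCluster, Prog.Straight]) fun T2 hT2 => ?_)
      have e2 : run S (.seq (startCluster d) (.assign (sr 20) (sv 14))) s' =
          ((s'.sset (3, []) (some (S.sketch (unionOf k cell A {cell i})))).set (12, key) 0).set
            (20, []) i := by
        rw [run, hE.run_startCluster hi h14 hkey, hkey, hG.sketch _ hiW]
        simp [run, h14]
      rw [e2]
      set s2 := ((s'.sset (3, []) (some (S.sketch (unionOf k cell A {cell i})))).set
        (12, key) 0).set (20, []) i with hs2def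
      have hs2 : Keeps [12, 20] [3] s' s2 := ((Keeps.sset _ _ (by simp)).trans
        (Keeps.set _ _ (by simp))).trans (Keeps.set _ _ (by simp))
      have hG2 : Grid S s2 k (g + 1) cell A (W.erase (cell i)) := by
        have h1 := (hG.congr (s' := s'.sset (3, [])
          (some (S.sketch (unionOf k cell A {cell i})))) (fun a _ => rfl) (fun a ha => by
          rw [St.sset_sm, if_neg]; rintro rfl; simp at ha)).erase (cell i)
        exact h1.congr (fun a ha => by rw [hs2def, St.set_m, if_neg]; rintro rfl; simp at ha)
          (fun a _ => rfl)
      have hQ2 : Queue s2 k t q := hQ.congr fun a ha => hs2.1 a (by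
        simp only [List.mem_cons, List.not_mem_nil, or_false] at ha ⊢
        omega)
      refine Tri.seq ((expand_spec (C := {cell i}) hA (hE.keeps hs2 (by simp)) (by simp) hi
        (by simp [hs2def]) ⟨hG2, by simp [hs2def, hcell], hQ2⟩).mono ?_)
      rintro s3 T3 ⟨hs3, hT3, hg3, W', C', t', q', hw3, hx, hna⟩
      have hs23 : Keeps [12, 15, 17, 18, 20] [3] s' s3 :=
        (hs2.mono (by simp) (by simp)).trans (hs3.mono (by simp) (by simp))
      have hE3 : Env s3 P k L K (g + 1) side idx := hE.keeps hs23 (by simp)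
      have hnl3 := hnl.congr (s' := s3)
        (fun a ha => hs23.1 a (by rcases ha with ha | ha <;> rw [ha] <;> simp))
        (fun a ha => hs23.2 a (by simp [ha]))
      refine Tri.straight (by simp [emit, Prog.Straight]) fun T4 hT4 => ⟨?_, ?_⟩
      · have h5 : T3 ≤ B * Ts := by
          refine hT3.trans ?_
          rw [← hB]
          simp only [Ts]
          nlinarith
        simp only [size_nat]
        omega
      obtain ⟨hs4, hl4, hnl4⟩ := hE3.run_emit (src := sr 3) (a := (3, []))
        (X := unionOf k cell A C') hi (by rw [hs23.1 _ (by simp), h14]) hnl3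
        (fun m hm => by simp) hw3.cluster
      set s4 := run S (emit (sr 3)) s3
      have hs5 : Keeps [14] [] s4 (s4.set (14, []) (i + 1)) := Keeps.set _ _ (by simp)
      have hs35 : Keeps [10, 14, 22] [1] s3 (s4.set (14, []) (i + 1)) :=
        (hs4.mono (by simp) (by simp)).trans (hs5.mono (by simp) (by simp))
      refine ⟨?_, by simp, ?_, ?_, fun g' hg' z => ?_, c + 1, Function.update ctr c i,
        Function.update Z c C', W', t', q', ?_, hN.step hiW hi hx hna, ?_, ?_⟩
      · rw [hs4.1 _ (by simp), hs23.1 _ (by simp), h14]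
      · exact (hs.trans (hs23.mono (by simp [X]) (by simp))).trans
          (hs35.mono (by simp [X]) (by simp))
      · exact ((hl.trans (hs23.keepsLists (by simp) (by simp))).trans hl4).trans
          (hs5.keepsLists (by simp) (by simp))
      · rw [hs35.1 _ (by simp), hg3 g' hg', ← hg g' hg' z]
        have hg'' := hg'
        push_cast at hg''
        simp [hs2def, hkey, hg'']
      · rw [Function.comp_update]
        have h6 : (fun a => unionOf k cell A (Function.update Z c C' a)) =
            Function.update (fun a => unionOf k cell A (Z a)) c (unionOf k cell A C') :=
          Function.comp_update (unionOf k cell A) Z c C'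
        rw [h6]
        exact hnl4.congr (fun a ha => hs5.1 a (by rcases ha with ha | ha <;> rw [ha] <;> simp))
          fun a ha => hs5.2 a (by simp)
      · exact hw3.grid.congr (fun a ha => hs35.1 a (by rw [ha]; simp))
          (fun a ha => hs35.2 a (by rw [ha]; simp))
      · exact hw3.queue.congr fun a ha => hs35.1 a (by
          simp only [List.mem_cons, List.not_mem_nil, or_false] at ha ⊢
          omega)
    · rw [hown, eval_nat, Nat.cast_zero] at hc
      have hiW : cell i ∉ W := by
        intro h'
        obtain ⟨r, -, -, hr⟩ := hG.mem _ h'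
        rw [hkey, hr] at hc
        exact hc (by positivity)
      refine Tri.straight (by simp [Prog.Straight]) fun T2 hT2 => ⟨?_, h14, ?_⟩
      · simp only [Prog.cost] at hT2
        simp only [size_nat]
        omega
      have hs5 : Keeps [14] [] s' (s'.set (14, []) (i + 1)) := Keeps.set _ _ (by simp)
      refine ⟨by simp [run], hs.trans (hs5.mono (by simp [X]) (by simp)),
        hl.trans (hs5.keepsLists (by simp) (by simp)), fun g' hg' z => ?_, c, ctr, Z, W, t, q, ?_,
        hN.skip hiW, ?_, ?_⟩
      · rw [run, hs5.1 _ (by simp), hg g' hg']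
      · exact hnl.congr (fun a ha => hs5.1 a (by rcases ha with ha | ha <;> rw [ha] <;> simp))
          fun a ha => hs5.2 a (by simp)
      · exact hG.congr (fun a ha => hs5.1 a (by rw [ha]; simp)) (fun a ha => hs5.2 a (by simp))
      · exact hQ.congr fun a ha => hs5.1 a (by
          simp only [List.mem_cons, List.not_mem_nil, or_false] at ha ⊢
          omega)
  · have hs2 : Keeps [14] [] s1 (s1.set (14, []) 0) := Keeps.set _ _ (by simp)
    refine ⟨by simp, hs2.mono (by simp [X]) (by simp), hs2.keepsLists (by simp) (by simp),
      fun g' _ z => hs2.1 _ (by simp), 0, fun _ => 0, fun _ => ∅, cells, 0, fun _ => 0,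
      ⟨by simp [hs1def], by simp, by simp⟩, ⟨by simp, by simp, by simp, by simp, by simp, by simp,
        by simp, by simp, by simp⟩,
      hG1.congr (fun a ha => hs2.1 a (by rw [ha]; simp)) (fun a ha => hs2.2 a (by simp)),
      ⟨by simp [hs1def], by simp, by simp⟩⟩
  · rintro s2 T2 ⟨⟨-, hs2, hl2, hg2, c, ctr, Z, W, t, q, hnl, hN, hG, hQ⟩, hT2⟩
    refine Tri.straight (by simp [commit, Prog.Straight]) fun T3 hT3 => ?_
    have hT3' : T3 ≤ 10 := by
      refine hT3.trans ?_
      simp [commit, Prog.cost]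
    obtain ⟨hs3, hE3, hsk3⟩ := (hEX hs2 hl2).run_commit (S := S) hnl
    have hW : W = ∅ := by
      rw [Finset.eq_empty_iff_forall_notMem]
      intro z hz
      have h1 := (hN.mem z).2 (.inl hz)
      rw [hcells, Finset.mem_image] at h1
      obtain ⟨j, hj, rfl⟩ := h1
      exact hN.seen j (Finset.mem_range.1 hj) hz
    subst hW
    refine ⟨?_, ?_, ?_, ?_, c, ctr, Z, hE3, hsk3, hN⟩
    · simp only [size_sv] at hT2
      have h1 : k + 1 ≤ (k + 1) * B := Nat.le_mul_of_pos_right _ hB1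
      have h2 : (k + 1) * B * netC d τ = (k + 1) * B * ((buildBody d).cost τ + 30) +
          (k + 1) * B * Ts + (k + 1) * B * (Ti + Te + (own d 12).get.size + 120) := by
        rw [netC]; ring
      have h3 := Nat.mul_le_mul_right ((buildBody d).cost τ + 30) h1
      have h4 := Nat.mul_le_mul_right (Ti + Te + (own d 12).get.size + 120) h1
      have h5 : (k + 1) * (B * Ts + Ti + Te + (own d 12).get.size + 10 + 20 + 1) + 60 ≤
          (k + 1) * B * Ts + (k + 1) * (Ti + Te + (own d 12).get.size + 120) := by
        nlinarith
      omega
    · exact ((hs0.mono (by simp) (by simp)).trans (hs1.mono (by simp) (by simp))).trans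
        ((hs2.mono (by simp [X]) (by simp)).trans (hs3.mono (by simp) (by simp)))
    · exact ((hs0.keepsLists (by simp) (by simp)).trans (hs1.keepsLists (by simp) (by simp))).trans
        (hl2.trans (hs3.keepsLists (by simp) (by simp)))
    · intro g' hg' z
      rw [hs3.1 _ (by simp), hs3.1 _ (by simp), hg2 g' hg'.ne', hs2.1 (13, _) (by simp [X]),
        hs1.1 _ (by simp), hs1.1 _ (by simp)]
      exact hf0 g' hg' z

end Net

end RealRAM

namespace RealRAM

/-! ### Geometry of the grid -/

section Geometry

variable {n d : ℕ} {P : Fin n → EuclideanSpace ℝ (Fin d)} {side : ℝ} {idx : ℕ → Fin n} {K : ℕ}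

/-- The norm is at most `√d`; the cruder bound `d` keeps the threshold `K + d` for adjacency an
integer. -/
theorem norm_le_of_abs_le_one (x : EuclideanSpace ℝ (Fin d)) (h : ∀ j, |x j| ≤ 1) :
    ‖x‖ ≤ d := by
  have h1 : ‖x‖ ^ 2 ≤ d := by
    rw [EuclideanSpace.norm_sq_eq]
    calc ∑ j, ‖x j‖ ^ 2 ≤ ∑ j : Fin d, (1 : ℝ) := Finset.sum_le_sum fun j _ => by
          rw [Real.norm_eq_abs]
          exact pow_le_one₀ (abs_nonneg _) (h j)
      _ = d := by simp
  refine abs_le_of_sq_le_sq (a := ‖x‖) (b := d) (h1.trans ?_) (Nat.cast_nonneg _) |> le_of_abs_le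
  have : d ≤ d ^ 2 := Nat.le_self_pow two_ne_zero d
  exact_mod_cast this

/-- The difference of two cells, as a vector. -/
noncomputable def cellDiff (z w : Fin d → ℤ) : EuclideanSpace ℝ (Fin d) :=
  WithLp.toLp 2 fun j => ((w j - z j : ℤ) : ℝ)

theorem cellAdj_iff {z w : Fin d → ℤ} : CellAdj K z w ↔ ‖cellDiff z w‖ ≤ (K + d : ℕ) := by
  rw [← abs_norm (cellDiff z w), ← abs_of_nonneg (Nat.cast_nonneg (α := ℝ) (K + d)),
    ← sq_le_sq, EuclideanSpace.norm_sq_eq, CellAdj]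
  simp only [cellDiff, Real.norm_eq_abs, sq_abs]
  rw [← Int.cast_le (R := ℝ)]
  push_cast
  simp only [sq]

/-- Both fractional parts lie in `[0, 1)`, so each coordinate of the error is at most `1` in
absolute value. -/
theorem norm_cellDiff_sub (side : ℝ) (a b : ℕ) :
    ‖cellDiff (cellOf P side idx a) (cellOf P side idx b) -
      side⁻¹ • (P (idx b) - P (idx a))‖ ≤ d := by
  refine norm_le_of_abs_le_one _ fun j => ?_
  have h1 := Int.floor_le (P (idx a) j / side)
  have h2 := Int.lt_floor_add_one (P (idx a) j / side)
  have h3 := Int.floor_le (P (idx b) j / side)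
  have h4 := Int.lt_floor_add_one (P (idx b) j / side)
  have h5 : (cellDiff (cellOf P side idx a) (cellOf P side idx b) -
      side⁻¹ • (P (idx b) - P (idx a))) j = ((⌊P (idx b) j / side⌋ : ℝ) - ⌊P (idx a) j / side⌋) -
        (P (idx b) j / side - P (idx a) j / side) := by
    simp only [cellDiff, cellOf, PiLp.sub_apply, PiLp.smul_apply, smul_eq_mul]
    push_cast
    ring
  rw [h5, abs_le]
  constructor <;> linarith

/-- Together with `dist_le_of_cellAdj` this is the whole geometry of the grid: the rounding error
`d` enters once in each direction, whence the gap between `K` and `K + 2 * d`. -/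
theorem cellAdj_of_dist_le (hs : 0 < side) {a b : ℕ}
    (h : dist (P (idx a)) (P (idx b)) ≤ side * K) :
    CellAdj K (cellOf P side idx a) (cellOf P side idx b) := by
  rw [cellAdj_iff]
  have h1 := norm_cellDiff_sub (P := P) (idx := idx) side a b
  have h2 : ‖side⁻¹ • (P (idx b) - P (idx a))‖ ≤ K := by
    rw [norm_smul, Real.norm_of_nonneg (inv_nonneg.2 hs.le), ← dist_eq_norm, dist_comm,
      inv_mul_le_iff₀ hs]
    exact h
  have h3 := norm_sub_norm_le (cellDiff (cellOf P side idx a) (cellOf P side idx b))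
    (side⁻¹ • (P (idx b) - P (idx a)))
  push_cast
  linarith

theorem dist_le_of_cellAdj (hs : 0 < side) {a b : ℕ}
    (h : CellAdj K (cellOf P side idx a) (cellOf P side idx b)) :
    dist (P (idx a)) (P (idx b)) ≤ side * (K + 2 * d) := by
  rw [cellAdj_iff] at h
  have h1 := norm_cellDiff_sub (P := P) (idx := idx) side a b
  have h2 : ‖side⁻¹ • (P (idx b) - P (idx a))‖ = side⁻¹ * dist (P (idx a)) (P (idx b)) := by
    rw [norm_smul, Real.norm_of_nonneg (inv_nonneg.2 hs.le), ← dist_eq_norm, dist_comm]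
  have h3 := norm_sub_norm_le (side⁻¹ • (P (idx b) - P (idx a)))
    (cellDiff (cellOf P side idx a) (cellOf P side idx b))
  rw [norm_sub_rev, h2] at h3
  push_cast at h
  have h4 : side⁻¹ * dist (P (idx a)) (P (idx b)) ≤ K + 2 * d := by linarith
  rwa [inv_mul_le_iff₀ hs] at h4

end Geometry

/-! ### Feasible radii -/

section Feasible

variable {V E σ : Type*} [PseudoMetricSpace E] {P : V → E} {F : Set (Set V)}

theorem reachable_of_dist_le {r : ℝ} {u v : V} (h : dist (P u) (P v) ≤ r) :
    (connectivityGraph P r).Reachable u v := by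
  by_cases huv : u = v
  · rw [huv]
  · exact SimpleGraph.Adj.reachable ⟨huv, h⟩

theorem mem_feasibleRadii {r : ℝ} :
    r ∈ feasibleRadii P F ↔ 0 ≤ r ∧ ∃ u, {v | (connectivityGraph P r).Reachable u v} ∈ F := by
  have h1 : ∀ u, ((connectivityGraph P r).connectedComponentMk u).supp =
      {v | (connectivityGraph P r).Reachable u v} := by
    intro u
    ext v
    rw [SimpleGraph.ConnectedComponent.mem_supp_iff, SimpleGraph.ConnectedComponent.eq]
    exact ⟨fun h => h.symm, fun h => h.symm⟩
  refine and_congr_right fun _ => ⟨?_, ?_⟩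
  · rintro ⟨_, ⟨K, rfl⟩, hF⟩
    induction K using SimpleGraph.ConnectedComponent.ind with
    | h u => exact ⟨u, h1 u ▸ hF⟩
  · rintro ⟨u, hu⟩
    exact ⟨_, ⟨(connectivityGraph P r).connectedComponentMk u, rfl⟩, by dsimp only; rwa [h1]⟩

theorem feasible_of_reachable (S : SketchableFamily V σ) {r : ℝ} (hr : 0 ≤ r)
    {X : Set V} (hX : X ∈ S.family) {u : V} (h : ∀ v ∈ X, (connectivityGraph P r).Reachable u v) :
    r ∈ feasibleRadii P S.family :=
  mem_feasibleRadii.2 ⟨hr, u, S.upward_closed X hX _ h⟩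

/-- The graph changes only at finitely many radii, the distances between points. Any feasible radius
can therefore be lowered to a candidate in `D`, and the largest candidate is feasible because its
graph is connected. -/
theorem exists_isLeast_feasibleRadii [Finite V] [Nonempty V] (S : SketchableFamily V σ)
    (hS : S.family.Nonempty) : ∃ r, IsLeast (feasibleRadii P S.family) r := by
  classical
  have := Fintype.ofFinite V
  -- The explicit `0` puts a candidate below every non-negative radius and makes `D` nonempty.
  let D : Finset ℝ := insert 0 ((Finset.univ : Finset (V × V)).image
    fun p => dist (P p.1) (P p.2))
  have hD0 : ∀ t ∈ D, 0 ≤ t := by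
    intro t ht
    rw [Finset.mem_insert, Finset.mem_image] at ht
    rcases ht with rfl | ⟨p, -, rfl⟩
    · exact le_rfl
    · exact dist_nonneg
  obtain ⟨X, hX⟩ := hS
  obtain ⟨u⟩ := ‹Nonempty V›
  have hmax : D.max' ⟨0, by simp [D]⟩ ∈ feasibleRadii P S.family := by
    refine feasible_of_reachable (u := u) S (hD0 _ (D.max'_mem _)) hX fun v _ => ?_
    refine reachable_of_dist_le (D.le_max' _ ?_)
    exact Finset.mem_insert_of_mem (Finset.mem_image.2 ⟨(u, v), Finset.mem_univ _, rfl⟩)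
  have hne : (D.filter (· ∈ feasibleRadii P S.family)).Nonempty :=
    ⟨_, Finset.mem_filter.2 ⟨D.max'_mem _, hmax⟩⟩
  refine ⟨_, (Finset.mem_filter.1 (Finset.min'_mem _ hne)).2, fun r hr => ?_⟩
  have hr0 := hr.1
  have hne' : (D.filter (· ≤ r)).Nonempty := ⟨0, by simp [D, hr0]⟩
  set t := (D.filter (· ≤ r)).max' hne' with ht
  have htm := Finset.mem_filter.1 ((D.filter (· ≤ r)).max'_mem hne')
  have hgraph : connectivityGraph P r = connectivityGraph P t := by
    ext a b
    refine and_congr_right fun _ => ⟨fun h => ?_, fun h => h.trans htm.2⟩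
    refine Finset.le_max' (D.filter (· ≤ r)) _ (Finset.mem_filter.2 ⟨?_, h⟩)
    exact Finset.mem_insert_of_mem (Finset.mem_image.2 ⟨(a, b), Finset.mem_univ _, rfl⟩)
  have htf : t ∈ feasibleRadii P S.family := by
    rw [mem_feasibleRadii] at hr ⊢
    rw [← hgraph]
    exact ⟨hD0 _ htm.1, hr.2⟩
  exact (Finset.min'_le _ _ (Finset.mem_filter.2 ⟨htm.1, htf⟩)).trans htm.2

end Feasible

/-! ### Lists of representatives -/

section Cover

variable {σ : Type*} {n d : ℕ} {P : Fin n → EuclideanSpace ℝ (Fin d)}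
  {S : SketchableFamily (Fin n) σ} {R D side : ℝ} {k K : ℕ} {idx : ℕ → Fin n}
  {A : ℕ → Set (Fin n)}

/-- The points in the list represent, up to the distance `D`, a set of points that is closed under
adjacency at the optimal radius `R`, and contains a positive cluster. -/
structure Cover (P : Fin n → EuclideanSpace ℝ (Fin d)) (S : SketchableFamily (Fin n) σ)
    (R D : ℝ) (k : ℕ) (idx : ℕ → Fin n) (A : ℕ → Set (Fin n)) : Prop where
  disj : DisjointSets k A
  self : ∀ j < k, idx j ∈ A j
  near : ∀ j < k, ∀ v ∈ A j, dist (P v) (P (idx j)) ≤ D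
  closed : ∀ j < k, ∀ v ∈ A j, ∀ w, dist (P v) (P w) ≤ R → ∃ j' < k, w ∈ A j'
  pos : ∃ j < k, ∃ v ∈ A j, {w | (connectivityGraph P R).Reachable v w} ∈ S.family

theorem Cover.idx_inj (H : Cover P S R D k idx A) {i j : ℕ} (hi : i < k) (hj : j < k)
    (h : idx i = idx j) : i = j := by
  by_contra hij
  exact Set.disjoint_left.1 (H.disj i hi j hj hij) (H.self i hi) (h ▸ H.self j hj)

/-- Representatives in adjacent cells are within `side * (K + 2 * d)`, and each point is within `D`
of its representative. The positive union of cells is thus contained in a single cluster at the sum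
of the two radii. -/
theorem Cover.le_of_pos (H : Cover P S R D k idx A) (hR : IsLeast (feasibleRadii P S.family) R)
    (hs : 0 < side) (hD : 0 ≤ D) {j : ℕ}
    (h : unionOf k (cellOf P side idx) A (compOf K ((Finset.range k).image (cellOf P side idx))
      (cellOf P side idx j)) ∈ S.family) : R ≤ side * (K + 2 * d) + D := by
  have h0 : 0 ≤ side * (K + 2 * d) := by positivity
  refine hR.2 (feasible_of_reachable (u := idx j) S (by positivity) h ?_)
  have key : ∀ z, CellReach K ((Finset.range k).image (cellOf P side idx))
      (cellOf P side idx j) z → ∀ j' < k, cellOf P side idx j' = z →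
      (connectivityGraph P (side * (K + 2 * d) + D)).Reachable (idx j) (idx j') := by
    intro z hz
    induction hz with
    | refl =>
      intro j' hj' hc
      refine reachable_of_dist_le ((dist_le_of_cellAdj hs (K := K) ?_).trans (by linarith))
      rw [hc]
      exact CellAdj.refl _ _
    | tail _ h2 ih =>
      intro j' hj' hc
      obtain ⟨j'', hj'', hc''⟩ := Finset.mem_image.1 h2.1.1
      refine (ih j'' (Finset.mem_range.1 hj'') hc'').trans
        (reachable_of_dist_le ((dist_le_of_cellAdj hs (K := K) ?_).trans (by linarith)))
      rw [hc, hc'']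
      exact h2.2
  rintro v ⟨j', hj', hz, hv⟩
  refine (key _ (mem_compOf.1 hz).2 j' hj' rfl).trans (reachable_of_dist_le ?_)
  rw [dist_comm]
  exact (H.near j' hj' v hv).trans (by linarith)

theorem Cover.dist_idx_le (H : Cover P S R D k idx A) {i j : ℕ} (hi : i < k) (hj : j < k)
    {v w : Fin n} (hv : v ∈ A i) (hw : w ∈ A j) :
    dist (P (idx i)) (P (idx j)) ≤ dist (P v) (P w) + 2 * D := by
  have h1 := H.near i hi v hv
  have h2 := H.near j hj w hw
  have h3 := dist_triangle4 (P (idx i)) (P v) (P w) (P (idx j))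
  rw [dist_comm (P (idx i)) (P v)] at h3
  linarith

/-- If `R + 2 * D ≤ side * K`, every edge of the optimal graph joins points whose representatives
lie in adjacent cells. The positive cluster, which by `closed` stays within the represented points,
would then lie inside one component of cells. -/
theorem Cover.lt_of_neg (H : Cover P S R D k idx A) (hs : 0 < side)
    (h : ¬ ∃ j < k, unionOf k (cellOf P side idx) A
      (compOf K ((Finset.range k).image (cellOf P side idx)) (cellOf P side idx j)) ∈ S.family) :
    side * K < R + 2 * D := by
  by_contra hlt
  rw [not_lt] at hlt
  obtain ⟨j, hj, v, hv, hF⟩ := H.pos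
  refine h ⟨j, hj, S.upward_closed _ hF _ ?_⟩
  have hmem : ∀ i < k, cellOf P side idx i ∈ (Finset.range k).image (cellOf P side idx) :=
    fun i hi => Finset.mem_image_of_mem _ (Finset.mem_range.2 hi)
  intro w hw
  rw [Set.mem_ofPred_eq, SimpleGraph.reachable_iff_reflTransGen] at hw
  have key : ∃ j' < k, w ∈ A j' ∧ CellReach K ((Finset.range k).image (cellOf P side idx))
      (cellOf P side idx j) (cellOf P side idx j') := by
    induction hw with
    | refl => exact ⟨j, hj, hv, .refl⟩
    | @tail b c _ h2 ih =>
      obtain ⟨i, hi, hbi, hreach⟩ := ih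
      obtain ⟨j', hj', hcj⟩ := H.closed i hi _ hbi _ h2.2
      refine ⟨j', hj', hcj, hreach.tail ⟨⟨hmem i hi, hmem j' hj'⟩, ?_⟩⟩
      refine cellAdj_of_dist_le hs ((H.dist_idx_le hi hj' hbi hcj).trans (le_trans ?_ hlt))
      linarith [h2.2]
  obtain ⟨j', hj', hwj, hreach⟩ := key
  exact ⟨j', hj', mem_compOf.2 ⟨hmem j' hj', hreach⟩, hwj⟩

/-- A set `A j` lies within distance `D < R` of its representative, so if it were positive, the
radius `D` would be feasible. -/
theorem Cover.not_mem (H : Cover P S R D k idx A) (hR : IsLeast (feasibleRadii P S.family) R)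
    (hR0 : 0 < R) (hD : 0 ≤ D) (hDR : 4 * D ≤ R) {j : ℕ} (hj : j < k) : A j ∉ S.family := by
  intro hF
  have := hR.2 (feasible_of_reachable (u := idx j) S hD hF fun v hv =>
    reachable_of_dist_le (by rw [dist_comm]; exact H.near j hj v hv))
  linarith

/-- Isolated points may be removed. -/
theorem Cover.prune (H : Cover P S R D k idx A) (hR : IsLeast (feasibleRadii P S.family) R)
    (hR0 : 0 < R) (hD : 0 ≤ D) (hDR : 4 * D ≤ R) (hs : 0 < side) (hsR : R + 2 * D ≤ side * K)
    {c : ℕ} {ctr : ℕ → ℕ} (hinj : ∀ a < c, ∀ b < c, ctr a = ctr b → a = b)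
    (hmem : ∀ i, (∃ a < c, ctr a = i) ↔ i < k ∧ HasNb k K (cellOf P side idx) i) :
    Cover P S R D c (idx ∘ ctr) (A ∘ ctr) := by
  have hlt : ∀ a < c, ctr a < k := fun a ha => ((hmem _).1 ⟨a, ha, rfl⟩).1
  have hadj : ∀ i < k, ∀ j < k, ∀ v ∈ A i, ∀ w ∈ A j, dist (P v) (P w) ≤ R →
      CellAdj K (cellOf P side idx i) (cellOf P side idx j) := by
    intro i hi j hj v hv w hw h
    refine cellAdj_of_dist_le hs ((H.dist_idx_le hi hj hv hw).trans (le_trans ?_ hsR))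
    linarith
  refine ⟨fun a ha b hb hab => H.disj _ (hlt a ha) _ (hlt b hb) fun h => hab (hinj a ha b hb h),
    fun a ha => H.self _ (hlt a ha), fun a ha => H.near _ (hlt a ha), fun a ha v hv w hw => ?_, ?_⟩
  -- The set containing `w` has the kept set as a neighbour, or is that set, and so it is kept too.
  · obtain ⟨j, hj, hwj⟩ := H.closed _ (hlt a ha) v hv w hw
    by_cases hja : j = ctr a
    · exact ⟨a, ha, by rw [Function.comp_apply, ← hja]; exact hwj⟩
    · obtain ⟨b, hb, rfl⟩ := (hmem j).2 ⟨hj, ctr a, hlt a ha, Ne.symm hja,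
        (hadj _ (hlt a ha) _ hj v hv w hwj hw).symm⟩
      exact ⟨b, hb, hwj⟩
  · obtain ⟨j, hj, v, hv, hF⟩ := H.pos
    by_cases hnb : HasNb k K (cellOf P side idx) j
    · obtain ⟨a, ha, rfl⟩ := (hmem j).2 ⟨hj, hnb⟩
      exact ⟨a, ha, v, hv, hF⟩
    -- An isolated set is closed under adjacency at radius `R`; it would contain the whole positive
    -- cluster and be positive itself.
    · refine absurd (S.upward_closed _ hF (A j) ?_) (H.not_mem hR hR0 hD hDR hj)
      intro w hw
      rw [Set.mem_ofPred_eq, SimpleGraph.reachable_iff_reflTransGen] at hw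
      induction hw with
      | refl => exact hv
      | @tail b c _ h2 ih =>
        obtain ⟨j', hj', hcj⟩ := H.closed j hj _ ih _ h2.2
        by_cases hjj : j' = j
        · exact hjj ▸ hcj
        · exact absurd ⟨j', hj', hjj, hadj j hj j' hj' _ ih _ hcj h2.2⟩ hnb

/-- Passing to a net. -/
theorem Cover.net (H : Cover P S R D k idx A) (hs : 0 < side) {c : ℕ} {ctr : ℕ → ℕ}
    {Z : ℕ → Finset (Fin d → ℤ)}
    (hN : Net K k (cellOf P side idx) ((Finset.range k).image (cellOf P side idx)) ∅ c ctr Z k) :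
    Cover P S R (D + side * (K + 2 * d)) c (idx ∘ ctr)
      (fun a => unionOf k (cellOf P side idx) A (Z a)) := by
  have hcov : ∀ j < k, ∀ v ∈ A j, ∃ a < c, v ∈ unionOf k (cellOf P side idx) A (Z a) := by
    intro j hj v hv
    have h1 := (hN.mem (cellOf P side idx j)).1
      (Finset.mem_image_of_mem _ (Finset.mem_range.2 hj))
    rcases h1 with h1 | ⟨a, ha, h1⟩
    · simp at h1
    · exact ⟨a, ha, j, hj, h1, hv⟩
  refine ⟨fun a ha b hb hab => ?_, fun a ha => ?_, fun a ha v hv => ?_, fun a ha v hv w hw => ?_, ?_⟩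
  · rw [Set.disjoint_left]
    rintro v ⟨i, hi, hz, hv⟩ ⟨j, hj, hz', hv'⟩
    have hij : i ≠ j := by
      rintro rfl
      exact Finset.disjoint_left.1 (hN.disj a ha b hb hab) hz hz'
    exact Set.disjoint_left.1 (H.disj i hi j hj hij) hv hv'
  · exact ⟨ctr a, hN.lt a ha, hN.self a ha, H.self _ (hN.lt a ha)⟩
  · obtain ⟨j, hj, hz, hv⟩ := hv
    have h1 := H.near j hj v hv
    have h2 := dist_le_of_cellAdj hs (hN.adj a ha _ hz)
    have h3 := dist_triangle (P v) (P (idx j)) (P (idx (ctr a)))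
    rw [dist_comm (P (idx j))] at h3
    simp only [Function.comp_apply]
    linarith
  · obtain ⟨j, hj, hz, hv⟩ := hv
    obtain ⟨j', hj', hw'⟩ := H.closed j hj v hv w hw
    exact hcov j' hj' w hw'
  · obtain ⟨j, hj, v, hv, hF⟩ := H.pos
    obtain ⟨a, ha, h1⟩ := hcov j hj v hv
    exact ⟨a, ha, v, h1, hF⟩

end Cover

end RealRAM

namespace RealRAM

/-! ### The number of points that are removed -/

section Counting

variable {d k K : ℕ}

theorem card_cellAdj_le (T : Finset (Fin d → ℤ)) (z : Fin d → ℤ)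
    (hT : ∀ w ∈ T, CellAdj K z w) : T.card ≤ (2 * (K + d) + 1) ^ d := by
  have h1 : T.card ≤ (Fintype.piFinset fun _ : Fin d =>
      Finset.Icc (-((K + d : ℕ) : ℤ)) (K + d : ℕ)).card := by
    refine Finset.card_le_card_of_injOn (fun w j => w j - z j) (fun w hw => ?_)
      fun w _ w' _ h => ?_
    · rw [Finset.mem_coe, Fintype.mem_piFinset]
      intro j
      rw [Finset.mem_Icc]
      exact abs_le.1 (abs_le_of_cellAdj (hT w hw) j)
    · funext j
      have := congrFun h j
      simp only at this
      omega
  refine h1.trans (le_of_eq ?_)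
  rw [Fintype.card_piFinset_const, Int.card_Icc]
  congr 1
  omega

-- A charging argument. Centres are pairwise non-adjacent, so a neighbour of a centre is among the
-- `k - c` removed positions. A removed position is charged by at most `(2 * (K + d) + 1) ^ d`
-- centres, which occupy distinct cells adjacent to its own. The additional `1` accounts for the
-- removed positions themselves.
open Classical in
theorem Net.card_le {cell : ℕ → Fin d → ℤ} {c : ℕ} {ctr : ℕ → ℕ} {Z : ℕ → Finset (Fin d → ℤ)}
    {cells W : Finset (Fin d → ℤ)} {i : ℕ} (H : Net K k cell cells W c ctr Z i) :
    c ≤ k ∧ ((Finset.range k).filter (HasNb k K cell)).card ≤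
      ((2 * (K + d) + 1) ^ d + 1) * (k - c) := by
  set E := (2 * (K + d) + 1) ^ d
  have hinj : ∀ a < c, ∀ b < c, cell (ctr a) = cell (ctr b) → a = b := by
    intro a ha b hb hab
    by_contra hne
    exact H.sep a ha b hb hne (hab ▸ CellAdj.refl _ _)
  set C := (Finset.range c).image ctr with hC
  have hCcard : C.card = c := by
    rw [hC, Finset.card_image_of_injOn, Finset.card_range]
    intro a ha b hb hab
    exact hinj a (Finset.mem_range.1 ha) b (Finset.mem_range.1 hb) (congrArg cell hab)
  have hCk : C ⊆ Finset.range k := by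
    intro j hj
    obtain ⟨a, ha, rfl⟩ := Finset.mem_image.1 hj
    exact Finset.mem_range.2 (H.lt a (Finset.mem_range.1 ha))
  have hck : c ≤ k := by simpa [hCcard] using Finset.card_le_card hCk
  have hsep : ∀ i ∈ C, ∀ j ∈ C, CellAdj K (cell i) (cell j) → i = j := by
    intro i hi j hj h
    obtain ⟨a, ha, rfl⟩ := Finset.mem_image.1 hi
    obtain ⟨b, hb, rfl⟩ := Finset.mem_image.1 hj
    by_contra hne
    exact H.sep a (Finset.mem_range.1 ha) b (Finset.mem_range.1 hb) (fun h => hne (h ▸ rfl)) h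
  set M := Finset.range k \ C with hM
  have hMcard : M.card = k - c := by
    rw [hM, Finset.card_sdiff_of_subset hCk, hCcard, Finset.card_range]
  refine ⟨hck, ?_⟩
  set N := (Finset.range k).filter (HasNb k K cell) with hN
  have hf : ∀ i, ∃ j, HasNb k K cell i → j < k ∧ j ≠ i ∧ CellAdj K (cell i) (cell j) := by
    intro i
    by_cases h : HasNb k K cell i
    · obtain ⟨j, hj⟩ := h
      exact ⟨j, fun _ => hj⟩
    · exact ⟨0, fun h' => absurd h' h⟩
  choose f hf using hf
  have h1 : (N ∩ C).card ≤ E * M.card := by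
    refine Finset.card_le_mul_card_image_of_maps_to (f := f) (fun i hi => ?_) E fun y _ => ?_
    · have hi' := Finset.mem_inter.1 hi
      have hfi := hf i (Finset.mem_filter.1 hi'.1).2
      rw [hM, Finset.mem_sdiff, Finset.mem_range]
      exact ⟨hfi.1, fun h => hfi.2.1 (hsep i hi'.2 _ h hfi.2.2).symm⟩
    · have h2 : ((N ∩ C).filter fun i => f i = y).card =
          (((N ∩ C).filter fun i => f i = y).image cell).card := by
        rw [Finset.card_image_of_injOn]
        intro i hi j hj hij
        refine hsep i (Finset.mem_inter.1 (Finset.mem_filter.1 hi).1).2 j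
          (Finset.mem_inter.1 (Finset.mem_filter.1 hj).1).2 ?_
        rw [hij]
        exact CellAdj.refl _ _
      rw [h2]
      refine card_cellAdj_le _ (cell y) fun w hw => ?_
      obtain ⟨i, hi, rfl⟩ := Finset.mem_image.1 hw
      have hi' := Finset.mem_filter.1 hi
      have hfi := hf i (Finset.mem_filter.1 (Finset.mem_inter.1 hi'.1).1).2
      rw [hi'.2] at hfi
      exact hfi.2.2.symm
  have h2 : N.card ≤ (N ∩ C).card + M.card := by
    rw [← Finset.card_inter_add_card_sdiff N C]
    refine Nat.add_le_add_left (Finset.card_le_card ?_) _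
    exact Finset.sdiff_subset_sdiff (Finset.filter_subset _ _) le_rfl
  calc N.card ≤ E * M.card + M.card := h2.trans (Nat.add_le_add_right h1 _)
    _ = (E + 1) * (k - c) := by rw [hMcard]; ring

/-- Every ordered pair satisfies `f i ≤ f j` or `f j ≤ f i`, and by symmetry both relations hold for
equally many pairs. -/
theorem sq_card_le_sum {α : Type*} (T : Finset α) (f : α → ℝ) :
    T.card ^ 2 ≤ 2 * ∑ i ∈ T, (T.filter fun j => f i ≤ f j).card := by
  classical
  have h1 : ∑ i ∈ T, (T.filter fun j => f i ≤ f j).card =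
      ∑ i ∈ T, (T.filter fun j => f j ≤ f i).card := by
    simp only [Finset.card_filter]
    exact Finset.sum_comm
  have h2 : T.card ^ 2 ≤ ∑ i ∈ T, ((T.filter fun j => f i ≤ f j).card +
      (T.filter fun j => f j ≤ f i).card) := by
    rw [sq, ← smul_eq_mul]
    refine Finset.card_nsmul_le_sum _ _ _ fun i _ => ?_
    refine le_trans (Finset.card_le_card fun j hj => ?_) (Finset.card_union_le _ _)
    rw [Finset.mem_union, Finset.mem_filter, Finset.mem_filter]
    exact (le_total (f i) (f j)).imp (fun h => ⟨hj, h⟩) fun h => ⟨hj, h⟩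
  rw [Finset.sum_add_distrib, ← h1] at h2
  omega

/-- On average over `i`, a constant fraction of the points is removed. -/
theorem sum_removed_ge (E : ℕ) (f : ℕ → ℝ) (c : ℕ → ℕ)
    (h : ∀ i < k, c i ≤ ((Finset.range k).filter fun j => f j < f i).card ∨
      ((Finset.range k).filter fun j => f j ≤ f i).card ≤ (E + 1) * (k - c i)) :
    k ^ 2 ≤ 4 * (E + 1) * ∑ i ∈ Finset.range k, (k - c i) := by
  classical
  set Pr : ℕ → Prop := fun i => c i ≤ ((Finset.range k).filter fun j => f j < f i).card
  set T := (Finset.range k).filter Pr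
  set U := (Finset.range k).filter fun i => ¬ Pr i
  -- An index of the first kind accounts for the removal of as many points as there are `j` with `f
  -- i ≤ f j`; only those `j` that are of the first kind as well are counted.
  have h1 : ∑ i ∈ T, (T.filter fun j => f i ≤ f j).card ≤ ∑ i ∈ T, (E + 1) * (k - c i) := by
    refine Finset.sum_le_sum fun i hi => ?_
    have hi' := Finset.mem_filter.1 hi
    have h2 : (T.filter fun j => f i ≤ f j).card ≤
        ((Finset.range k).filter fun j => ¬ f j < f i).card := by
      refine Finset.card_le_card fun j hj => ?_
      have hj' := Finset.mem_filter.1 hj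
      exact Finset.mem_filter.2 ⟨(Finset.mem_filter.1 hj'.1).1, not_lt.2 hj'.2⟩
    have h3 := Finset.card_filter_add_card_filter_not (s := Finset.range k) fun j => f j < f i
    rw [Finset.card_range] at h3
    have h4 : c i ≤ ((Finset.range k).filter fun j => f j < f i).card := hi'.2
    have h5 : k - c i ≤ (E + 1) * (k - c i) := Nat.le_mul_of_pos_left _ (by omega)
    omega
  have h2 : ∑ i ∈ U, (U.filter fun j => f j ≤ f i).card ≤ ∑ i ∈ U, (E + 1) * (k - c i) := by
    refine Finset.sum_le_sum fun i hi => ?_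
    have hi' := Finset.mem_filter.1 hi
    refine le_trans (Finset.card_le_card ?_)
      ((h i (Finset.mem_range.1 hi'.1)).resolve_left hi'.2)
    exact Finset.filter_subset_filter _ (Finset.filter_subset _ _)
  have h3 := sq_card_le_sum T f
  have h4 : U.card ^ 2 ≤ 2 * ∑ i ∈ U, (U.filter fun j => f j ≤ f i).card := by
    have := sq_card_le_sum U fun i => - f i
    simpa only [neg_le_neg_iff] using this
  have h5 : T.card + U.card = k := by
    rw [Finset.card_filter_add_card_filter_not, Finset.card_range]
  have h6 : ∑ i ∈ Finset.range k, (E + 1) * (k - c i) =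
      ∑ i ∈ T, (E + 1) * (k - c i) + ∑ i ∈ U, (E + 1) * (k - c i) :=
    (Finset.sum_filter_add_sum_filter_not _ _ _).symm
  rw [mul_assoc, Finset.mul_sum, h6]
  -- The two kinds are estimated separately; splitting the indices costs only this factor `2`.
  have h7 : k ^ 2 ≤ 2 * (T.card ^ 2 + U.card ^ 2) := by
    rw [← h5]
    exact add_sq_le
  omega

end Counting

/-! ### Nearest neighbour distances within a list. -/

section NearestNeighbour

variable {n d : ℕ} {P : Fin n → EuclideanSpace ℝ (Fin d)} {idx : ℕ → Fin n} {k : ℕ}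

/-- `r` is the distance of the `i`-th point of the list to the closest other one. -/
def IsNN (P : Fin n → EuclideanSpace ℝ (Fin d)) (idx : ℕ → Fin n) (k i : ℕ) (r : ℝ) : Prop :=
  (∃ j < k, j ≠ i ∧ dist (P (idx i)) (P (idx j)) = r) ∧
    ∀ j < k, j ≠ i → r ≤ dist (P (idx i)) (P (idx j))

theorem IsNN.unique {i : ℕ} {r r' : ℝ} (h : IsNN P idx k i r) (h' : IsNN P idx k i r') :
    r = r' := by
  obtain ⟨⟨j, hj, hji, rfl⟩, h2⟩ := h
  obtain ⟨⟨j', hj', hji', rfl⟩, h2'⟩ := h'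
  exact le_antisymm (h2 j' hj' hji') (h2' j hj hji)

end NearestNeighbour

end RealRAM

namespace RealRAM

section NearestNeighbour

variable {V σ : Type*} {n d : ℕ} {S : SketchableFamily V σ} {τ : ℕ}
  {P : Fin n → EuclideanSpace ℝ (Fin d)} {k L K g : ℕ} {side : ℝ} {idx : ℕ → Fin n}

/-- The square of the distance of two points of the list. -/
def distE (d : ℕ) (a b : RExpr) : RExpr :=
  sumE d fun j => .mul (.sub (coordE a j) (coordE b j)) (.sub (coordE a j) (coordE b j))

theorem Env.eval_distE {s : St σ} (h : Env s P k L K g side idx) {a b : RExpr} {i j : ℕ}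
    (ha : a.eval s.m = i) (hb : b.eval s.m = j) (hi : i < k) (hj : j < k) :
    (distE d a b).eval s.m = dist (P (idx i)) (P (idx j)) ^ 2 := by
  rw [distE, eval_sumE, EuclideanSpace.dist_eq, Real.sq_sqrt (Finset.sum_nonneg fun _ _ => sq_nonneg _)]
  refine Finset.sum_congr rfl fun l _ => ?_
  rw [eval_mul, eval_sub, h.eval_coordE ha hi, h.eval_coordE hb hj, Real.dist_eq, sq_abs, sq]

/-- The first candidate is position `0`, or `1` if the point itself has position `0`; the running
minimum thus always comes from another point. -/
def nnInit (d : ℕ) : Prog :=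
  .ite (nat 0) (sv 41) (.assign (sr 42) (distE d (sv 41) (nat 0)))
    (.assign (sr 42) (distE d (sv 41) (nat 1)))

/-- Different positions hold different points, so the test for a positive distance excludes exactly
the point itself. -/
def nnBody (d : ℕ) : Prog :=
  .seq (.assign (sr 43) (distE d (sv 41) (sv 14)))
    (.ite (nat 0) (sv 43) (.ite (sv 43) (sv 42) (.assign (sr 42) (sv 43)) .skip) .skip)

/-- Compute in `42` the distance of the point in `41` to the closest other point of the list. -/
def nnDist (d : ℕ) : Prog :=
  .seq (nnInit d) (.seq (forP 14 (sv 4) (nnBody d)) (.assign (sr 42) (.sqrt (sv 42))))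

/-- The time of `nnDist`, up to the number of points. -/
def nnC (d τ : ℕ) : ℕ := (nnInit d).cost τ + (nnBody d).cost τ + 50

theorem nnDist_spec (hP : Function.Injective P) {s : St σ} (h : Env s P k L K g side idx)
    (hidx : ∀ i < k, ∀ j < k, idx i = idx j → i = j) (hk : 2 ≤ k) {i : ℕ} (hi : i < k)
    (h41 : s.m (41, []) = i) :
    Tri S τ (nnDist d) s fun s' T => T ≤ (k + 1) * nnC d τ ∧ Keeps [14, 42, 43] [] s s' ∧
      ∃ r, s'.m (42, []) = r ∧ IsNN P idx k i r := by
  have hE : ∀ {s' : St σ}, Keeps [14, 42, 43] [] s s' → Env s' P k L K g side idx :=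
    fun hs => h.keeps hs (by simp)
  refine Tri.seq (Tri.straight (by simp [nnInit, Prog.Straight]) fun T1 hT1 => ?_)
  obtain ⟨j0, hj0, hj0i, hr⟩ : ∃ j0 < k, j0 ≠ i ∧ run S (nnInit d) s =
      s.set (42, []) (dist (P (idx i)) (P (idx j0)) ^ 2) := by
    rcases Nat.eq_zero_or_pos i with rfl | hi0
    · refine ⟨1, by omega, by simp, ?_⟩
      rw [nnInit, run, if_neg (by simp [h41]), run, addr_sr,
        h.eval_distE (i := 0) (j := 1) (by simp [h41]) (by simp) hi (by omega)]
    · refine ⟨0, by omega, by omega, ?_⟩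
      rw [nnInit, run, if_pos (by simpa [h41] using hi0), run, addr_sr,
        h.eval_distE (i := i) (j := 0) (by simp [h41]) (by simp) hi (by omega)]
  rw [hr]
  set s1 := s.set (42, []) (dist (P (idx i)) (P (idx j0)) ^ 2) with hs1def
  have hs1 : Keeps [14, 42, 43] [] s s1 := Keeps.set _ _ (by simp)
  refine Tri.seq ((Tri.forP k ((nnBody d).cost τ)
    (fun l s' => s'.m (14, []) = l ∧ Keeps [14, 42, 43] [] s s' ∧
      (∃ j < k, j ≠ i ∧ s'.m (42, []) = dist (P (idx i)) (P (idx j)) ^ 2) ∧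
      ∀ j < l, j ≠ i → s'.m (42, []) ≤ dist (P (idx i)) (P (idx j)) ^ 2)
    ?_ (fun l s' hs => hs.1) ?_ s1 ?_).mono ?_)
  · rintro l s' ⟨-, hs, -⟩
    rw [eval_sv, (hE hs).size]
  · rintro l hl s' ⟨h14, hs, ⟨j, hj, hji, h42⟩, hmin⟩
    have h41' : s'.m (41, []) = i := by rw [hs.1 _ (by simp), h41]
    refine Tri.straight (by simp [nnBody, Prog.Straight]) fun T hT => ⟨hT, ?_⟩
    set D := dist (P (idx i)) (P (idx l)) ^ 2 with hD
    have e1 : run S (.assign (sr 43) (distE d (sv 41) (sv 14))) s' = s'.set (43, []) D := by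
      rw [run, addr_sr, (hE hs).eval_distE (i := i) (j := l) (by simp [h41']) (by simp [h14]) hi hl]
    have hD0 : 0 < D ↔ l ≠ i := by
      rw [hD, sq_pos_iff, dist_ne_zero, hP.ne_iff]
      exact ⟨fun h' h'' => h' (h'' ▸ rfl), fun h' h'' => h' (hidx i hi l hl h'').symm⟩
    have e2 : run S (nnBody d) s' = if 0 < D ∧ D < s'.m (42, []) then
        (s'.set (43, []) D).set (42, []) D else s'.set (43, []) D := by
      rw [nnBody, run, e1]
      by_cases h1 : 0 < D <;> by_cases h2 : D < s'.m (42, []) <;> simp [run, h1, h2]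
    rw [e2]
    have hlast : ∀ j < l + 1, j ≠ i → j < l ∨ (j = l ∧ 0 < D) := by
      intro j hj hji
      rcases Nat.lt_succ_iff_lt_or_eq.1 hj with h3 | rfl
      · exact .inl h3
      · exact .inr ⟨rfl, hD0.2 hji⟩
    split_ifs with hc
    · refine ⟨by simp [h14], by simp, ((hs.trans (Keeps.set _ _ (by simp))).trans
        (Keeps.set _ _ (by simp))).trans (Keeps.set _ _ (by simp)),
        ⟨l, hl, hD0.1 hc.1, by simp [hD]⟩, fun j hj hji => ?_⟩
      simp only [St.set_m]
      rw [if_neg (by simp), if_pos trivial]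
      rcases hlast j hj hji with h3 | ⟨rfl, -⟩
      · exact hc.2.le.trans (hmin j h3 hji)
      · exact le_rfl
    · refine ⟨by simp [h14], by simp, (hs.trans (Keeps.set _ _ (by simp))).trans
        (Keeps.set _ _ (by simp)), ⟨j, hj, hji, by simp [h42]⟩, fun j hj hji => ?_⟩
      simp only [St.set_m]
      rw [if_neg (by simp), if_neg (by simp)]
      rcases hlast j hj hji with h3 | ⟨rfl, h3⟩
      · exact hmin j h3 hji
      · exact not_lt.1 fun h4 => hc ⟨h3, h4⟩
  · exact ⟨by simp, hs1.trans (Keeps.set _ _ (by simp)), ⟨j0, hj0, hj0i, by simp [hs1def]⟩, by simp⟩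
  · rintro s2 T2 ⟨⟨h14, hs, ⟨j, hj, hji, h42⟩, hmin⟩, hT2⟩
    refine Tri.straight (by simp [Prog.Straight]) fun T3 hT3 => ?_
    have e1 : run S (.assign (sr 42) (.sqrt (sv 42))) s2 =
        s2.set (42, []) (dist (P (idx i)) (P (idx j))) := by
      simp [run, h42, Real.sqrt_sq dist_nonneg]
    rw [e1]
    refine ⟨?_, hs.trans (Keeps.set _ _ (by simp)), _, rfl, ⟨j, hj, hji, by simp⟩,
      fun j' hj' hji' => ?_⟩
    · have hT3' : T3 ≤ 10 := by
        refine hT3.trans ?_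
        simp [Prog.cost, RExpr.size]
      rw [nnC]
      simp only [size_sv] at hT2
      nlinarith
    · have := hmin j' hj' hji'
      rw [h42] at this
      simpa using abs_le_of_sq_le_sq this dist_nonneg |> le_of_abs_le

end NearestNeighbour

end RealRAM

namespace RealRAM

/-! ### One round of the net-and-prune search. -/

section Round

variable {σ : Type*} {n d : ℕ} {S : SketchableFamily (Fin n) σ} {τ : ℕ}
  {P : Fin n → EuclideanSpace ℝ (Fin d)} {k L K g : ℕ} {side R ε μ : ℝ} {idx : ℕ → Fin n}
  {A : ℕ → Set (Fin n)}

/-- The parts of the memory that are never changed (the input, and the list of all points), and the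
counter of the grids. -/
structure Base (s : St σ) (P : Fin n → EuclideanSpace ℝ (Fin d)) (S : SketchableFamily (Fin n) σ)
    (ε : ℝ) (g : ℕ) : Prop where
  size : s.m (0, []) = n
  eps : s.m (1, []) = ε
  coord : ∀ (i : Fin n) (j : Fin d), s.m (2, [((i : ℕ) : ℤ), ((j : ℕ) : ℤ)]) = P i j
  grid : s.m (11, []) = g
  fresh : Fresh s g
  entry : ∀ j : Fin n, s.m (10, [0, ((j : ℕ) : ℤ)]) = (j : ℕ)
  sketch : ∀ j : Fin n, s.sm (1, [0, ((j : ℕ) : ℤ)]) = some (S.sketch {j})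

theorem Base.keepsLists {s s' : St σ} (h : Base s P S ε g) {X Y : List ℕ} (hs : Keeps X Y s s')
    (hX : ∀ x ∈ [0, 1, 2], x ∉ X) {g' g'' : ℕ} (hl : KeepsLists (g'' + 1) s s')
    (hg : s'.m (11, []) = g') (hf : Fresh s' g') : Base s' P S ε g' where
  size := by rw [hs.1 _ (hX _ (by simp)), h.size]
  eps := by rw [hs.1 _ (hX _ (by simp)), h.eps]
  coord i j := by rw [hs.1 _ (hX _ (by simp)), h.coord i j]
  grid := hg
  fresh := hf
  entry j := by rw [(hl 0 (by push_cast; omega) _).1, h.entry j]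
  sketch j := by rw [(hl 0 (by push_cast; omega) _).2, h.sketch j]

theorem Base.keeps {s s' : St σ} (h : Base s P S ε g) {X Y : List ℕ} (hs : Keeps X Y s s')
    (hX : ∀ x ∈ [0, 1, 2, 10, 11, 12, 13], x ∉ X) (hY : 1 ∉ Y) : Base s' P S ε g :=
  h.keepsLists (g'' := 0) hs (fun x hx => hX x (by
    simp only [List.mem_cons, List.not_mem_nil, or_false] at hx ⊢
    omega)) (hs.keepsLists (hX 10 (by simp)) hY)
    (by rw [hs.1 _ (hX 11 (by simp)), h.grid])
    (h.fresh.congr fun a ha => hs.1 a (hX _ (by rcases ha with ha | ha <;> rw [ha] <;> simp)))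

/-- The invariant of the main loop: the current list. -/
structure Current (s : St σ) (P : Fin n → EuclideanSpace ℝ (Fin d))
    (S : SketchableFamily (Fin n) σ) (ε : ℝ) (k L K g : ℕ) (side : ℝ) (idx : ℕ → Fin n)
    (A : ℕ → Set (Fin n)) : Prop where
  base : Base s P S ε g
  env : Env s P k L K g side idx
  sketches : ListSketches S s k L A
  le : L ≤ g

theorem Current.keeps {s s' : St σ} (h : Current s P S ε k L K g side idx A) {X Y : List ℕ}
    (hs : Keeps X Y s s') (hX : ∀ x ∈ [0, 1, 2, 4, 5, 6, 7, 10, 11, 12, 13], x ∉ X) (hY : 1 ∉ Y) :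
    Current s' P S ε k L K g side idx A where
  base := h.base.keeps hs (fun x hx => hX x (by
    simp only [List.mem_cons, List.not_mem_nil, or_false] at hx ⊢
    omega)) hY
  env := h.env.keeps hs fun x hx => hX x (by
    simp only [List.mem_cons, List.not_mem_nil, or_false] at hx ⊢
    omega)
  sketches j hj := by rw [hs.2 _ hY, h.sketches j hj]
  le := h.le

theorem Current.setSide {s : St σ} (h : Current s P S ε k L K g side idx A) (x : ℝ) :
    Current (s.set (6, []) x) P S ε k L K g x idx A where
  base := h.base.keeps (Keeps.set (X := [6]) (Y := []) s x (by simp)) (by simp) (by simp)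
  env := by
    have e := h.env
    refine ⟨?_, ?_, by simp, ?_, ?_, fun j hj => ?_, fun i j => ?_⟩
    · simpa using e.size
    · simpa using e.list
    · simpa using e.K
    · simpa using e.grid
    · simpa using e.entry j hj
    · simpa using e.coord i j
  sketches := h.sketches
  le := h.le

theorem Current.decide (hA : DisjointSets k A) {s : St σ}
    (h : Current s P S ε k L K g side idx A) :
    Tri S τ (decide d) s fun s' T => T ≤ (k + 1) * (2 * (K + d) + 1) ^ d * decideC d τ ∧
      Keeps [11, 12, 13, 14, 15, 16, 17, 18, 19, 20, 21] [2, 3] s s' ∧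
      Current s' P S ε k L K (g + 1) side idx A ∧
      (0 < s'.m (19, []) ↔ ∃ j < k, unionOf k (cellOf P side idx) A
        (compOf K ((Finset.range k).image (cellOf P side idx)) (cellOf P side idx j)) ∈
          S.family) := by
  refine (decide_spec hA h.env h.sketches h.base.fresh).mono ?_
  rintro s' T ⟨hT, hs, hE, hf, h19⟩
  refine ⟨hT, hs, ⟨?_, hE, fun j hj => ?_, by have := h.le; omega⟩, h19⟩
  · exact h.base.keepsLists (g'' := 0) hs (by simp) (hs.keepsLists (by simp) (by simp)) hE.grid hf
  · rw [hs.2 _ (by simp), h.sketches j hj]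

/-- A single set would contain the whole positive cluster, against `Cover.not_mem`. Hence nearest
neighbours exist in every round. -/
theorem Cover.two_le (H : Cover P S R μ k idx A) (hR : IsLeast (feasibleRadii P S.family) R)
    (hR0 : 0 < R) (hD : 0 ≤ μ) (hDR : 4 * μ ≤ R) : 2 ≤ k := by
  obtain ⟨j, hj, v, hv, hF⟩ := H.pos
  by_contra hk
  refine H.not_mem hR hR0 hD hDR hj (S.upward_closed _ hF _ ?_)
  intro w hw
  rw [Set.mem_ofPred_eq, SimpleGraph.reachable_iff_reflTransGen] at hw
  induction hw with
  | refl => exact hv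
  | @tail b c _ h2 ih =>
    obtain ⟨j', hj', hcj⟩ := H.closed j hj _ ih _ h2.2
    have : j' = j := by omega
    exact this ▸ hcj

theorem Cover.mono {D D' : ℝ} (H : Cover P S R D k idx A) (h : D ≤ D') :
    Cover P S R D' k idx A :=
  { H with near := fun j hj v hv => (H.near j hj v hv).trans h }

/-- The points of the current list represent the relevant points well: they have pairwise distances
at least `μ`, and represent the other points up to a small multiple of `μ`, where `μ` is much
smaller than the optimal radius. -/
structure Faithful (P : Fin n → EuclideanSpace ℝ (Fin d)) (S : SketchableFamily (Fin n) σ)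
    (R μ : ℝ) (k : ℕ) (idx : ℕ → Fin n) (A : ℕ → Set (Fin n)) : Prop where
  cover : Cover P S R (2 * (1 + 2 * d) * μ) k idx A
  nonneg : 0 ≤ μ
  le : 8 * (1 + 2 * d) * μ ≤ R
  sep : ∀ i < k, ∀ j < k, i ≠ j → μ ≤ dist (P (idx i)) (P (idx j))

/-- The number `1 + 2 d`, by which the radius of a cluster may be underestimated. -/
def cc (d : ℕ) : ℕ := 1 + 2 * d

/-- One round of the main loop, after the choice of the point in `41`. -/
def round (d : ℕ) : Prog :=
  .seq (nnDist d) (.seq (.assign (sr 6) (.div (sv 42) (nat (6 * cc d ^ 2)))) (.seq (decide d)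
    (.ite (nat 0) (sv 19)
      (.seq (.assign (sr 6) (.div (sv 42) (nat (2 * cc d)))) (prune d))
      (.seq (.assign (sr 6) (.mul (nat (24 * cc d)) (sv 42))) (.seq (decide d)
        (.ite (nat 0) (sv 19)
          (.seq (.assign (sr 8) (.div (sv 42) (nat (12 * cc d ^ 2)))) (.assign (sr 40) (nat 0)))
          (.seq (.assign (sr 6) (.mul (nat 2) (sv 42))) (net d))))))))

/-- The time of a round, up to the number of points. -/
def roundC (d τ : ℕ) : ℕ :=
  (nnC d τ + 2 * decideC d τ + pruneC d τ + netC d τ + 100) * (2 * (1 + d) + 1) ^ d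

/-- The main loop is over, and the lower bound in `8` is correct up to a constant factor. -/
def Finished (s : St σ) (P : Fin n → EuclideanSpace ℝ (Fin d)) (S : SketchableFamily (Fin n) σ)
    (ε R : ℝ) : Prop :=
  (∃ g, Base s P S ε g) ∧ s.m (40, []) = 0 ∧ 0 < s.m (8, []) ∧ s.m (8, []) ≤ R ∧
    R ≤ s.m (8, []) * (384 * (cc d : ℝ) ^ 4)

/-- The state between two rounds. -/
def Going (s : St σ) (P : Fin n → EuclideanSpace ℝ (Fin d)) (S : SketchableFamily (Fin n) σ)
    (ε R : ℝ) (k : ℕ) : Prop :=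
  s.m (40, []) = 1 ∧ ∃ L g side idx A μ, Current s P S ε k L 1 g side idx A ∧
    Faithful P S R μ k idx A

/-- Put `D = 2 * c * μ`, so `4 * D ≤ R`. The first test has mesh `r / (6 * c ^ 2)`. If it is
positive, `R ≤ r / (6 * c) + D`, which gives `R + 2 * D ≤ r / (2 * c)`, and pruning with mesh `r /
(2 * c)` is safe. If it is negative, `r / (12 * c ^ 2) ≤ R`. The second test has mesh `24 * c * r`.
If it is positive, `R ≤ 24 * c ^ 2 * r + D`, hence `R ≤ 32 * c ^ 2 * r`. If it is negative, `16 * c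
* r < R`, which is what `Faithful` requires of the new scale `2 * r`. -/
theorem round_spec (hP : Function.Injective P) (hR : IsLeast (feasibleRadii P S.family) R)
    (hR0 : 0 < R) {s : St σ} (h40 : s.m (40, []) = 1)
    (h : Current s P S ε k L 1 g side idx A) (hF : Faithful P S R μ k idx A)
    {i : ℕ} (hi : i < k) (h41 : s.m (41, []) = i) {nn : ℕ → ℝ}
    (hnn : ∀ i < k, IsNN P idx k i (nn i)) :
    Tri S τ (round d) s fun s' T => T ≤ (k + 1) * roundC d τ ∧
      (Finished s' P S ε R ∨ ∃ c, Going s' P S ε R c ∧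
        (c ≤ ((Finset.range k).filter fun j => nn j < nn i).card ∨ c ≤ k ∧
          ((Finset.range k).filter fun j => nn j ≤ nn i).card ≤
            ((2 * (1 + d) + 1) ^ d + 1) * (k - c))) := by
  classical
  have hμ := hF.nonneg
  set B := (2 * (1 + d) + 1) ^ d with hB
  have hB1 : 1 ≤ B := Nat.one_le_pow _ _ (by omega)
  have hcc : ((cc d : ℕ) : ℝ) = 1 + 2 * d := by simp [cc]
  set c := (1 + 2 * d : ℝ) with hc
  have hc1 : 1 ≤ c := by rw [hc]; linarith [Nat.cast_nonneg (α := ℝ) d]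
  have hc0 : 0 < c := by linarith
  have hD0 : 0 ≤ 2 * c * μ := by positivity
  have hDR : 4 * (2 * c * μ) ≤ R := by linarith [hF.le]
  have hk := hF.cover.two_le hR hR0 hD0 hDR
  have hidx : ∀ i < k, ∀ j < k, idx i = idx j → i = j :=
    fun i hi j hj => hF.cover.idx_inj hi hj
  refine Tri.seq ((nnDist_spec hP h.env hidx hk hi h41).mono ?_)
  rintro s1 T1 ⟨hT1, hs1, r, h42, hr⟩
  have hri : nn i = r := (hnn i hi).unique hr
  have hr0 : 0 < r := by
    obtain ⟨⟨j, hj, hji, rfl⟩, -⟩ := hr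
    exact dist_pos.2 fun h' => hji (hidx i hi j hj (hP h')).symm
  have hμr : μ ≤ r := by
    obtain ⟨⟨j, hj, hji, rfl⟩, -⟩ := hr
    exact hF.sep i hi j hj hji.symm
  have hC1 := h.keeps hs1 (by simp) (by simp)
  refine Tri.seq (Tri.straight (by simp [Prog.Straight]) fun T2 hT2 => ?_)
  have hT2' : T2 ≤ 10 := by refine hT2.trans ?_; simp [Prog.cost, RExpr.size]
  have e2 : run S (.assign (sr 6) (.div (sv 42) (nat (6 * cc d ^ 2)))) s1 =
      s1.set (6, []) (r / (6 * c ^ 2)) := by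
    simp [run, h42, hcc]
  rw [e2]
  refine Tri.seq (((hC1.setSide _).decide hF.cover.disj).mono ?_)
  rintro s3 T3 ⟨hT3, hs3, hC3, h19⟩
  rw [← hB] at hT3
  have h423 : s3.m (42, []) = r := by rw [hs3.1 _ (by simp), St.set_m, if_neg (by simp), h42]
  have h403 : s3.m (40, []) = 1 := by
    rw [hs3.1 _ (by simp), St.set_m, if_neg (by simp), hs1.1 _ (by simp), h40]
  have hkB : k + 1 ≤ (k + 1) * B := Nat.le_mul_of_pos_right _ hB1
  have hkB1 : 1 ≤ (k + 1) * B := le_trans (by omega) hkB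
  have htime : ∀ T, T ≤ (k + 1) * B * decideC d τ + (k + 1) * B * pruneC d τ +
      (k + 1) * B * netC d τ + 50 →
      1 + T1 + (1 + T2 + (1 + T3 + T)) ≤ (k + 1) * roundC d τ := by
    intro T hT
    have h1 := Nat.mul_le_mul_right (nnC d τ) hkB
    have h2 := Nat.mul_le_mul_right 100 hkB1
    have h3 : (k + 1) * roundC d τ = (k + 1) * B * nnC d τ + 2 * ((k + 1) * B * decideC d τ) +
        (k + 1) * B * pruneC d τ + (k + 1) * B * netC d τ + (k + 1) * B * 100 := by
      rw [roundC]; ring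
    omega
  refine Tri.ite (fun hpos => ?_) (fun hneg => ?_)
  · -- the optimal radius is much smaller than `r`
    rw [eval_nat, Nat.cast_zero, eval_sv, h19] at hpos
    obtain ⟨j, hj, hjF⟩ := hpos
    have hle := hF.cover.le_of_pos hR (by positivity) hD0 hjF
    rw [Nat.cast_one, ← hc] at hle
    have hle' : R + 2 * (2 * c * μ) ≤ r / (2 * c) := by
      have e3 : r / (6 * c ^ 2) * c = r / (2 * c) / 3 := by field_simp; ring
      rw [e3] at hle
      have h5 : 0 < r / (2 * c) := by positivity
      linarith
    refine Tri.seq (Tri.straight (by simp [Prog.Straight]) fun T4 hT4 => ?_)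
    have hT4' : T4 ≤ 10 := by refine hT4.trans ?_; simp [Prog.cost, RExpr.size]
    have e4 : run S (.assign (sr 6) (.div (sv 42) (nat (2 * cc d)))) s3 =
        s3.set (6, []) (r / (2 * c)) := by
      simp [run, h423, hcc]
    rw [e4]
    have hC4 := hC3.setSide (r / (2 * c))
    refine (prune_spec hF.cover.disj hC4.env hC4.sketches hC4.base.fresh hC4.le).mono ?_
    rintro s5 T5 ⟨hT5, hs5, hl5, hf5, c', ctr, hE5, hsk5, hinj, hmem⟩
    rw [← hB] at hT5
    refine ⟨htime _ (by simp only [size_nat, size_sv]; omega), .inr ⟨c', ⟨?_, _, _, _, _, _, μ,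
      ⟨hC4.base.keepsLists hs5 (by simp) hl5 hE5.grid hf5, hE5, hsk5, le_rfl⟩,
      hF.cover.prune hR hR0 hD0 hDR (by positivity) (by simpa using hle') hinj hmem, hμ, hF.le,
        fun a ha b hb hab => ?_⟩, .inl ?_⟩⟩
    · rw [hs5.1 _ (by simp), St.set_m, if_neg (by simp), h403]
    · exact hF.sep _ ((hmem _).1 ⟨a, ha, rfl⟩).1 _ ((hmem _).1 ⟨b, hb, rfl⟩).1
        fun h' => hab (hinj a ha b hb h')
    -- A survivor has another list point within `c * (r / (2 * c)) = r / 2`, so its nearest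
    -- neighbour distance is smaller than `r`.
    · have h6 : ((Finset.range c').image ctr).card = c' := by
        rw [Finset.card_image_of_injOn, Finset.card_range]
        intro a ha b hb hab
        exact hinj a (Finset.mem_range.1 ha) b (Finset.mem_range.1 hb) hab
      refine h6.symm.le.trans (Finset.card_le_card fun j hj => ?_)
      obtain ⟨a, ha, rfl⟩ := Finset.mem_image.1 hj
      obtain ⟨hlt, j', hj', hne, hadj⟩ := (hmem _).1 ⟨a, Finset.mem_range.1 ha, rfl⟩
      refine Finset.mem_filter.2 ⟨Finset.mem_range.2 hlt, ?_⟩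
      have h7 := dist_le_of_cellAdj (by positivity) hadj
      have h8 := (hnn _ hlt).2 j' hj' hne
      have e5 : r / (2 * c) * c = r / 2 := by field_simp
      rw [Nat.cast_one, ← hc, e5] at h7
      linarith
  · rw [eval_nat, Nat.cast_zero, eval_sv, h19] at hneg
    have hlt := hF.cover.lt_of_neg (by positivity) hneg
    rw [Nat.cast_one, mul_one] at hlt
    refine Tri.seq (Tri.straight (by simp [Prog.Straight]) fun T4 hT4 => ?_)
    have hT4' : T4 ≤ 10 := by refine hT4.trans ?_; simp [Prog.cost, RExpr.size]
    have e4 : run S (.assign (sr 6) (.mul (nat (24 * cc d)) (sv 42))) s3 =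
        s3.set (6, []) (24 * c * r) := by
      simp [run, h423, hcc]
    rw [e4]
    refine Tri.seq (((hC3.setSide _).decide hF.cover.disj).mono ?_)
    rintro s5 T5 ⟨hT5, hs5, hC5, h19'⟩
    rw [← hB] at hT5
    have h425 : s5.m (42, []) = r := by rw [hs5.1 _ (by simp), St.set_m, if_neg (by simp), h423]
    have h405 : s5.m (40, []) = 1 := by
      rw [hs5.1 _ (by simp), St.set_m, if_neg (by simp), h403]
    refine Tri.ite (fun hpos => ?_) (fun hneg' => ?_)
    · -- the optimal radius is about `r`
      rw [eval_nat, Nat.cast_zero, eval_sv, h19'] at hpos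
      obtain ⟨j, hj, hjF⟩ := hpos
      have hle := hF.cover.le_of_pos hR (by positivity) hD0 hjF
      rw [Nat.cast_one, ← hc] at hle
      refine Tri.straight (by simp [Prog.Straight]) fun T6 hT6 => ?_
      have hT6' : T6 ≤ 15 := by refine hT6.trans ?_; simp [Prog.cost, RExpr.size]
      refine ⟨htime _ (by simp only [size_nat, size_sv]; omega), .inl ?_⟩
      have e6 : run S (.seq (.assign (sr 8) (.div (sv 42) (nat (12 * cc d ^ 2))))
          (.assign (sr 40) (nat 0))) s5 =
          (s5.set (8, []) (r / (12 * c ^ 2))).set (40, []) 0 := by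
        simp [run, h425, hcc]
      rw [e6]
      have hs6 : Keeps [8, 40] [] s5 ((s5.set (8, []) (r / (12 * c ^ 2))).set (40, []) 0) :=
        (Keeps.set _ _ (by simp)).trans (Keeps.set _ _ (by simp))
      have h8 : ((s5.set (8, []) (r / (12 * c ^ 2))).set (40, []) 0).m (8, []) =
          r / (12 * c ^ 2) := by simp
      rw [Finished, h8, hcc]
      refine ⟨⟨_, hC5.base.keeps hs6 (by simp) (by simp)⟩, by simp, by positivity, ?_, ?_⟩
      · have e7 : r / (6 * c ^ 2) = 2 * (r / (12 * c ^ 2)) := by field_simp; ring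
        rw [e7] at hlt
        linarith
      -- The ratio of the upper to the lower bound is `(32 * c ^ 2) * (12 * c ^ 2)`.
      · have e7 : r / (12 * c ^ 2) * (384 * c ^ 4) = 32 * c ^ 2 * r := by field_simp; ring
        rw [e7]
        linarith
    · -- the optimal radius is much larger than `r`
      rw [eval_nat, Nat.cast_zero, eval_sv, h19'] at hneg'
      have hlt' := hF.cover.lt_of_neg (by positivity) hneg'
      rw [Nat.cast_one, mul_one] at hlt'
      refine Tri.seq (Tri.straight (by simp [Prog.Straight]) fun T6 hT6 => ?_)
      have hT6' : T6 ≤ 10 := by refine hT6.trans ?_; simp [Prog.cost, RExpr.size]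
      have e6 : run S (.assign (sr 6) (.mul (nat 2) (sv 42))) s5 = s5.set (6, []) (2 * r) := by
        simp [run, h425]
      rw [e6]
      have hC6 := hC5.setSide (2 * r)
      refine (net_spec hF.cover.disj hC6.env hC6.sketches hC6.base.fresh hC6.le).mono ?_
      rintro s7 T7 ⟨hT7, hs7, hl7, hf7, c', ctr, Z, hE7, hsk7, hN⟩
      rw [← hB] at hT7
      have hcard := hN.card_le
      refine ⟨htime _ (by simp only [size_nat, size_sv]; omega), .inr ⟨c', ⟨?_, _, _, _, _, _,
        2 * r, ⟨hC6.base.keepsLists hs7 (by simp) hl7 hE7.grid hf7, hE7, hsk7, le_rfl⟩,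
        (hF.cover.net (by positivity) hN).mono ?_, by positivity, ?_, fun a ha b hb hab => ?_⟩,
        .inr ⟨hcard.1, le_trans (Finset.card_le_card fun j hj => ?_) hcard.2⟩⟩⟩
      · rw [hs7.1 _ (by simp), St.set_m, if_neg (by simp), h405]
      -- The new error `2 * c * μ + 2 * r * c` is at most `2 * c * (2 * r)` because `μ ≤ r`: the
      -- growth of the scale absorbs all earlier errors.
      · rw [Nat.cast_one, ← hc]
        nlinarith
      · rw [← hc]
        nlinarith
      · have := hN.sep a ha b hb hab
        by_contra h'
        exact this (cellAdj_of_dist_le (by positivity) (by simpa using (not_le.1 h').le))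
      -- A nearest neighbour at distance at most `r` lies within the mesh `2 * r`, hence in an
      -- adjacent cell.
      · have hj' := Finset.mem_filter.1 hj
        have hjk := Finset.mem_range.1 hj'.1
        refine Finset.mem_filter.2 ⟨hj'.1, ?_⟩
        obtain ⟨⟨l, hl, hlj, hdist⟩, -⟩ := hnn j hjk
        refine ⟨l, hl, hlj, cellAdj_of_dist_le (by positivity) ?_⟩
        rw [hdist, Nat.cast_one, mul_one]
        linarith [hj'.2]

end Round

end RealRAM

namespace RealRAM

/-! ### Expected time of the main loop. -/

section MainLoop

variable {σ : Type*} {n d : ℕ} {S : SketchableFamily (Fin n) σ} {τ : ℕ}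
  {P : Fin n → EuclideanSpace ℝ (Fin d)} {R ε : ℝ}

/-- The main loop: it ends with a lower bound for the optimal radius that is correct up to a
constant factor. -/
def mainLoop (d : ℕ) : Prog :=
  .loop (nat 0) (sv 40) (.seq (.rand (sr 41) (.sub (sv 4) (nat 1))) (round d))

/-- The expected time of the main loop, up to the number of points. -/
def mainC (d τ : ℕ) : ℕ := 4 * ((2 * (1 + d) + 1) ^ d + 1) * (12 + 2 * roundC d τ)

theorem exists_isNN (P : Fin n → EuclideanSpace ℝ (Fin d)) (idx : ℕ → Fin n) {k : ℕ} (hk : 2 ≤ k)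
    (i : ℕ) : ∃ r, IsNN P idx k i r := by
  obtain ⟨j, hj, h⟩ := ((Finset.range k).erase i).exists_min_image
    (fun j => dist (P (idx i)) (P (idx j))) (Finset.card_pos.1 (by
      have := Finset.pred_card_le_card_erase (s := Finset.range k) (a := i)
      rw [Finset.card_range] at this
      omega))
  simp only [Finset.mem_erase, Finset.mem_range] at hj h
  exact ⟨_, ⟨j, hj.2, hj.1, rfl⟩, fun j' h1 h2 => h j' ⟨h2, h1⟩⟩

theorem tsum_uniformOfFinset_mul {α : Type*} (s : Finset α) (hs : s.Nonempty) (f : α → ENNReal) :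
    ∑' v, PMF.uniformOfFinset s hs v * f v = (s.card : ENNReal)⁻¹ * ∑ v ∈ s, f v := by
  rw [tsum_eq_sum (s := s), Finset.mul_sum]
  · exact Finset.sum_congr rfl fun v hv => by rw [PMF.uniformOfFinset_apply_of_mem _ hv]
  · intro v hv
    rw [PMF.uniformOfFinset_apply_of_notMem _ hv, zero_mul]

/-- The rule for random choices: it suffices that the expected time is small on average. -/
theorem Good.of_rand {Q : Config σ → Prop} {x : Ref} {e : RExpr} {rest : List Prog} {s : St σ}
    {T k : ℕ} (hk : 0 < k) (he : e.eval s.m = (k : ℝ) - 1) (F : ENNReal) (N : ℕ → ℕ) {M : ℕ}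
    (h : ∀ v < k, Good S τ Q ⟨rest, (s.set (x.addr s.m) v).m, s.sm, T + (1 + x.size + e.size)⟩
      (T + F + N v)) (hN : ∑ v ∈ Finset.range k, N v ≤ k * M) :
    Good S τ Q ⟨.rand x e :: rest, s.m, s.sm, T⟩ (T + F + M) := by
  have hfl : ⌊e.eval s.m⌋₊ + 1 = k := by
    rw [he, Nat.floor_sub_one, Nat.floor_natCast]
    omega
  have hne : (Finset.range (⌊e.eval s.m⌋₊ + 1)).Nonempty := Finset.nonempty_range_add_one
  refine Good.of_map (PMF.uniformOfFinset (Finset.range (⌊e.eval s.m⌋₊ + 1)) hne)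
    (fun v => ⟨rest, (s.set (x.addr s.m) v).m, s.sm, T + (1 + x.size + e.size)⟩) ?_ ?_
    (fun v => T + F + N v) ?_ ?_ ?_
  · simp only [step, St.set, ← add_assoc]
    -- The random real number is a uniform natural number followed by the cast.
    refine (PMF.map_bind (PMF.uniformOfFinset _ hne) (fun a : ℕ => PMF.pure (a : ℝ)) _).trans ?_
    simp only [PMF.pure_map]
    rfl
  · rw [PMF.support_uniformOfFinset]
    exact Finset.finite_toSet _
  · intro v hv
    rw [PMF.mem_support_uniformOfFinset_iff, hfl, Finset.mem_range] at hv
    exact h v hv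
  · rw [add_assoc]
    exact le_self_add
  · rw [tsum_uniformOfFinset_mul, hfl, Finset.card_range, Finset.sum_add_distrib, Finset.sum_const,
      Finset.card_range, nsmul_eq_mul, ← Nat.cast_sum]
    have hk0 : (k : ENNReal) ≠ 0 := by exact_mod_cast hk.ne'
    calc (k : ENNReal)⁻¹ * (k * (T + F) + (∑ v ∈ Finset.range k, N v : ℕ))
        ≤ (k : ENNReal)⁻¹ * (k * (T + F) + (k * M : ℕ)) := by gcongr
      _ = (k : ENNReal)⁻¹ * k * (T + F + M) := by push_cast; ring
      _ = T + F + M := by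
        rw [ENNReal.inv_mul_cancel hk0 (ENNReal.natCast_ne_top k), one_mul]

/-- The potential is `mainC d τ * k`, and `F` is the budget of the rest of the program. A round
costs a multiple of `k`, while by `sum_removed_ge` the length drops on average by a constant
fraction of `k`; `mainC` is large enough for the drop of the potential to pay for the round. -/
theorem mainLoop_good (hP : Function.Injective P) (hR : IsLeast (feasibleRadii P S.family) R)
    (hR0 : 0 < R) {Q : Config σ → Prop} {rest : List Prog} {F : ENNReal}
    (hfin : ∀ s : St σ, Finished s P S ε R → ∀ T : ℕ, Good S τ Q ⟨rest, s.m, s.sm, T⟩ (T + F))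
    (k : ℕ) : ∀ s : St σ, Going s P S ε R k → ∀ T : ℕ,
      Good S τ Q ⟨mainLoop d :: rest, s.m, s.sm, T⟩ (T + F + (mainC d τ * k : ℕ)) := by
  induction k using Nat.strong_induction_on with
  | _ k ih =>
    rintro s ⟨h40, L, g, side, idx, A, μ, hC, hF⟩ T
    have hμ := hF.nonneg
    have hk : 2 ≤ k := hF.cover.two_le hR hR0 (by positivity) (by linarith [hF.le])
    choose nn hnn using exists_isNN P idx hk
    have hround : ∀ v, ∃ c, v < k → (c ≤ ((Finset.range k).filter fun j => nn j < nn v).card ∨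
        ((Finset.range k).filter fun j => nn j ≤ nn v).card ≤
            ((2 * (1 + d) + 1) ^ d + 1) * (k - c)) ∧
        Good S τ Q ⟨round d :: mainLoop d :: rest, (s.set (41, []) v).m, s.sm, T + 4 + 5⟩
          ((T + 4 : ℕ) + F + (8 + (k + 1) * roundC d τ + mainC d τ * c : ℕ)) := by
      intro v
      by_cases hv : v < k
      swap
      · exact ⟨0, fun h => absurd h hv⟩
      have hs := Keeps.set (X := [41]) (Y := []) s (a := (41, [])) (v : ℝ) (by simp)
      obtain ⟨s', t, hex, ht, hor⟩ := round_spec (τ := τ) hP hR hR0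
        (s := s.set (41, []) v) (by simp [h40]) (hC.keeps hs (by simp) (by simp)) hF hv (by simp)
        fun i _ => hnn i
      rcases hor with hfi | ⟨c, hgo, hc⟩
      -- A round that ends the loop is treated as one that leaves an empty list.
      · refine ⟨0, fun _ => ⟨.inl (Nat.zero_le _), Good.of_exec hex _ _ _ ?_⟩⟩
        refine Good.of_exec (Exec.loopF _ _ _ s' ?_) _ _ _ ((hfin s' hfi _).mono ?_)
        · simp [hfi.2.1]
        · push_cast [size_nat, size_sv]
          have : (t : ENNReal) ≤ (k + 1) * roundC d τ := by exact_mod_cast ht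
          calc _ = (T : ENNReal) + F + (12 + t) := by ring
            _ ≤ (T : ENNReal) + F + (12 + (k + 1) * roundC d τ) := by gcongr
            _ = _ := by ring
      -- The chosen position `v` is missing from the first count and present in the second; in both
      -- cases the list gets strictly shorter.
      · have hck : c < k := by
          rcases hc with hc | hc
          · refine hc.trans_lt ?_
            conv_rhs => rw [← Finset.card_range k]
            refine Finset.card_lt_card (Finset.filter_ssubset.2 ⟨v, Finset.mem_range.2 hv, ?_⟩)
            exact lt_irrefl _
          · by_contra hck
            have h1 : 0 < ((Finset.range k).filter fun j => nn j ≤ nn v).card :=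
              Finset.card_pos.2 ⟨v, Finset.mem_filter.2 ⟨Finset.mem_range.2 hv, le_rfl⟩⟩
            have h2 : k - c = 0 := by omega
            rw [h2, mul_zero] at hc
            omega
        refine ⟨c, fun _ => ⟨hc.imp id And.right, Good.of_exec hex _ _ _ ?_⟩⟩
        refine (ih c hck s' hgo _).mono ?_
        push_cast
        have : (t : ENNReal) ≤ (k + 1) * roundC d τ := by exact_mod_cast ht
        calc _ = (T : ENNReal) + F + (9 + t) + mainC d τ * c := by ring
          _ ≤ (T : ENNReal) + F + (12 + (k + 1) * roundC d τ) + mainC d τ * c := by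
            gcongr
            norm_num
          _ = _ := by ring
    choose c hc using hround
    have hsum := sum_removed_ge (k := k) ((2 * (1 + d) + 1) ^ d) nn (fun v => min (c v) k)
      fun i hi => by
        rcases (hc i hi).1 with h | h
        · exact .inl ((min_le_left _ _).trans h)
        · exact .inr (by rwa [show k - min (c i) k = k - c i by omega])
    have hck : ∀ i < k, c i ≤ k := by
      intro i hi
      rcases (hc i hi).1 with h | h
      · exact h.trans ((Finset.card_filter_le _ _).trans (Finset.card_range k).le)
      · by_contra hlt
        have h1 : 0 < ((Finset.range k).filter fun j => nn j ≤ nn i).card :=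
          Finset.card_pos.2 ⟨i, Finset.mem_filter.2 ⟨Finset.mem_range.2 hi, le_rfl⟩⟩
        rw [show k - c i = 0 by omega, mul_zero] at h
        omega
    set rC := roundC d τ
    -- The summand `4 * k` averages to the four units of time spent on the loop test and on
    -- unfolding the body before the draw.
    have hN : ∑ v ∈ Finset.range k, (8 + (k + 1) * rC + mainC d τ * c v) + 4 * k ≤
        k * (mainC d τ * k) := by
      have h1 : ∑ i ∈ Finset.range k, (k - min (c i) k) + ∑ i ∈ Finset.range k, c i = k * k := by
        rw [← Finset.sum_add_distrib, Finset.sum_congr rfl (g := fun _ => k), Finset.sum_const,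
          Finset.card_range, smul_eq_mul]
        intro i hi
        have := hck i (Finset.mem_range.1 hi)
        omega
      have h2 := Nat.mul_le_mul_right (12 + 2 * rC) hsum
      have h3 : k * (8 + (k + 1) * rC) + 4 * k ≤ k ^ 2 * (12 + 2 * rC) := by
        have h4 : k * 1 ≤ k * k := Nat.mul_le_mul_left _ (by omega)
        have h5 := Nat.mul_le_mul_right rC h4
        nlinarith
      have h6 := congrArg (mainC d τ * ·) h1
      simp only [mul_add] at h6
      rw [Finset.sum_add_distrib, Finset.sum_const, Finset.card_range, smul_eq_mul,
        ← Finset.mul_sum]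
      have h7 : 4 * ((2 * (1 + d) + 1) ^ d + 1) * (∑ i ∈ Finset.range k, (k - min (c i) k)) *
          (12 + 2 * rC) = mainC d τ * ∑ i ∈ Finset.range k, (k - min (c i) k) := by
        rw [mainC]; ring
      have h8 : mainC d τ * (k * k) = k * (mainC d τ * k) := by ring
      omega
    refine Good.of_pure (c1 := ⟨.seq (.rand (sr 41) (.sub (sv 4) (nat 1))) (round d) ::
      mainLoop d :: rest, s.m, s.sm, T + 3⟩) ?_ (Nat.le_add_right _ _) ?_
    · simp [step, mainLoop, h40, add_assoc]
    refine Good.of_pure (c1 := ⟨.rand (sr 41) (.sub (sv 4) (nat 1)) :: round d ::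
      mainLoop d :: rest, s.m, s.sm, T + 4⟩) rfl (Nat.le_succ _) ?_
    refine (Good.of_rand (k := k) (M := mainC d τ * k - 4) (by omega) ?_ F
      (fun v => 8 + (k + 1) * rC + mainC d τ * c v) (fun v hv => ?_) ?_).mono ?_
    · simp [hC.env.size]
    · simpa [RExpr.size] using (hc v hv).2
    · rw [Nat.mul_sub]
      omega
    · have h9 : 4 ≤ mainC d τ * k := by
        have : 1 ≤ (2 * (1 + d) + 1) ^ d := Nat.one_le_pow _ _ (by omega)
        calc 4 = 4 * 1 * 1 * 1 := by norm_num
          _ ≤ mainC d τ * k := by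
            rw [mainC]
            gcongr <;> omega
      obtain ⟨q, hq⟩ : ∃ q, mainC d τ * k = 4 + q := ⟨_, (Nat.add_sub_of_le h9).symm⟩
      rw [hq, Nat.add_sub_cancel_left]
      push_cast
      exact le_of_eq (by ring)

end MainLoop

end RealRAM

namespace RealRAM

/-! ### Improving the approximation -/

section Improve

variable {σ : Type*} {n d : ℕ} {S : SketchableFamily (Fin n) σ} {τ : ℕ}
  {P : Fin n → EuclideanSpace ℝ (Fin d)} {R ε : ℝ}

/-- The list of all points. -/
def allPts (hn : 0 < n) (j : ℕ) : Fin n := if h : j < n then ⟨j, h⟩ else ⟨0, hn⟩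

theorem allPts_of_lt (hn : 0 < n) {j : ℕ} (h : j < n) : allPts hn j = ⟨j, h⟩ := dif_pos h

theorem disjoint_allPts (hn : 0 < n) : DisjointSets n fun j => ({allPts hn j} : Set (Fin n)) := by
  intro a ha b hb hab
  rw [Set.disjoint_singleton, allPts_of_lt hn ha, allPts_of_lt hn hb]
  simpa using hab

theorem cover_allPts (hn : 0 < n) (hR : IsLeast (feasibleRadii P S.family) R) :
    Cover P S R 0 n (allPts hn) fun j => {allPts hn j} where
  disj := disjoint_allPts hn
  self _ _ := rfl
  near j _ v hv := by rw [Set.mem_singleton_iff.1 hv, dist_self]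
  closed _ _ _ _ w _ := ⟨w, w.2, by simp [allPts_of_lt hn w.2]⟩
  pos := by
    obtain ⟨u, hu⟩ := (mem_feasibleRadii.1 hR.1).2
    exact ⟨u, u.2, u, by simp [allPts_of_lt hn u.2], hu⟩

theorem Base.current {s : St σ} {g K : ℕ} (h : Base s P S ε g) (hn : 0 < n)
    (h4 : s.m (4, []) = n) (h5 : s.m (5, []) = 0) (h7 : s.m (7, []) = K) :
    Current s P S ε n 0 K g (s.m (6, [])) (allPts hn) fun j => {allPts hn j} where
  base := h
  env := by
    refine ⟨h4, by simpa using h5, rfl, h7, h.grid, fun j hj => ?_, h.coord⟩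
    rw [allPts_of_lt hn hj]
    simpa using h.entry ⟨j, hj⟩
  sketches j hj := by
    dsimp only
    rw [allPts_of_lt hn hj]
    simpa using h.sketch ⟨j, hj⟩
  le := Nat.zero_le _

/-- The factor up to which the main loop approximates the optimal radius. -/
def startRatio (d : ℕ) : ℕ := 384 * cc d ^ 4

/-- One round of the binary search. -/
def halve (d : ℕ) : Prog :=
  .seq (.assign (sr 7) (.add (.floor (.div (nat (8 * d)) (sv 9))) (nat (4 * d + 1))))
    (.seq (.assign (sr 6) (.div (.mul (sv 8) (.add (nat 1) (.div (sv 9) (nat 2)))) (sv 7)))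
      (.seq (decide d)
        (.seq (.ite (nat 0) (sv 19) .skip
          (.assign (sr 8) (.mul (sv 8) (.add (nat 1) (.div (sv 9) (nat 2))))))
          (.assign (sr 9) (.mul (sv 9) (.const (3 / 4)))))))

/-- The binary search for the optimal radius. -/
def improve (d : ℕ) : Prog :=
  .seq (.assign (sr 5) (nat 0)) (.seq (.assign (sr 4) (sv 0))
    (.seq (.assign (sr 9) (nat (startRatio d))) (.seq (.loop (sv 1) (sv 9) (halve d))
      (.assign (sr 3) (.mul (sv 8) (.add (nat 1) (sv 9)))))))

/-- The invariant of the binary search: the optimal radius is known up to the factor `1 + δ`. -/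
def Bracket (s : St σ) (P : Fin n → EuclideanSpace ℝ (Fin d)) (S : SketchableFamily (Fin n) σ)
    (ε R δ : ℝ) : Prop :=
  (∃ g, Base s P S ε g) ∧ s.m (4, []) = n ∧ s.m (5, []) = 0 ∧ s.m (9, []) = δ ∧ 0 < s.m (8, []) ∧
    s.m (8, []) ≤ R ∧ R ≤ s.m (8, []) * (1 + δ)

/-- The number of cells adjacent to a cell, up to the factor `(1 / δ) ^ d`. -/
def cellsC (d : ℕ) : ℕ := 16 * d + (10 * d + 3) * startRatio d

/-- The time of a round, up to the factor `n * (1 / δ) ^ d`. -/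
def halveC (d τ : ℕ) : ℕ := 2 * cellsC d ^ d * decideC d τ + 60 * startRatio d ^ d

theorem startRatio_pos (d : ℕ) : 1 ≤ startRatio d := by
  have : 1 ≤ cc d ^ 4 := Nat.one_le_pow _ _ (by rw [cc]; omega)
  rw [startRatio]
  omega

/-- The test is made with `side * K = lo * (1 + δ / 2)`. A negative answer raises the lower bound to
this value, and `1 + δ ≤ (1 + δ / 2) * (1 + 3 / 4 * δ)`. A positive answer gives the upper bound `lo
* (1 + δ / 2) * (1 + 2 * d / K)`, which is at most `lo * (1 + 3 / 4 * δ)`. -/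
theorem halve_spec (hn : 0 < n) (hR : IsLeast (feasibleRadii P S.family) R) {δ : ℝ} (hδ : 0 < δ)
    (hδ' : δ ≤ startRatio d) {s : St σ} (h : Bracket s P S ε R δ) :
    Tri S τ (halve d) s fun s' t => Bracket s' P S ε R (3 / 4 * δ) ∧
      (t + 10 : ℝ) ≤ halveC d τ * n * (1 / δ) ^ d := by
  obtain ⟨⟨g, hB⟩, h4, h5, h9, h8, hlo, hhi⟩ := h
  set lo := s.m (8, []) with hlo_def
  set q := ⌊8 * d / δ⌋₊ with hq
  have hq0 : 0 ≤ 8 * d / δ := by positivity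
  have hq1 : (q : ℝ) ≤ 8 * d / δ := Nat.floor_le hq0
  have hq2 : 8 * d / δ < q + 1 := Nat.lt_floor_add_one _
  set K := q + (4 * d + 1) with hK
  have hK0 : (0 : ℝ) < K := by rw [hK]; positivity
  set s1 := (s.set (7, []) K).set (6, []) (lo * (1 + δ / 2) / K) with hs1
  have hk1 : Keeps [6, 7] [] s s1 := (Keeps.set _ _ (by simp)).trans (Keeps.set _ _ (by simp))
  have hC1 := (hB.keeps hk1 (by simp) (by simp)).current hn
    (by rw [hk1.1 _ (by simp), h4]) (by rw [hk1.1 _ (by simp), h5]) (K := K) (by simp [hs1])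
  have h16 : s1.m (6, []) = lo * (1 + δ / 2) / K := by simp [hs1]
  rw [h16] at hC1
  refine Tri.seq (Tri.straight (by simp [Prog.Straight]) fun T1 hT1 => ?_)
  refine Tri.seq (Tri.straight (by simp [Prog.Straight]) fun T2 hT2 => ?_)
  have hT1' : T1 ≤ 10 := by refine hT1.trans ?_; simp [Prog.cost, RExpr.size]
  have hT2' : T2 ≤ 15 := by refine hT2.trans ?_; simp [Prog.cost, RExpr.size]
  have e1 : run S (.assign (sr 6) (.div (.mul (sv 8) (.add (nat 1) (.div (sv 9) (nat 2)))) (sv 7)))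
      (run S (.assign (sr 7) (.add (.floor (.div (nat (8 * d)) (sv 9))) (nat (4 * d + 1)))) s) =
      s1 := by
    have e0 : ((⌊8 * d / δ⌋ : ℤ) : ℝ) = q := by
      rw [hq, ← Int.natCast_floor_eq_floor hq0]; simp
    have e2 : run S (.assign (sr 7) (.add (.floor (.div (nat (8 * d)) (sv 9)))
        (nat (4 * d + 1)))) s = s.set (7, []) K := by
      simp [run, h9, e0, hK]
    rw [e2, hs1]
    simp [run, h9, ← hlo_def]
  rw [e1]
  refine Tri.seq ((hC1.decide (disjoint_allPts hn)).mono ?_)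
  rintro s2 T3 ⟨hT3, hk2, hC2, h19⟩
  have hk12 := (hk1.mono (X' := [6, 7, 11, 12, 13, 14, 15, 16, 17, 18, 19, 20, 21]) (Y' := [2, 3])
    (by simp) (by simp)).trans (hk2.mono (by simp) (by simp))
  have h82 : s2.m (8, []) = lo := hk12.1 _ (by simp)
  have h92 : s2.m (9, []) = δ := by rw [hk12.1 _ (by simp), h9]
  set lo' := if 0 < s2.m (19, []) then lo else lo * (1 + δ / 2) with hlo'
  have hbr : 0 < lo' ∧ lo' ≤ R ∧ R ≤ lo' * (1 + 3 / 4 * δ) := by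
    have hδ2 : 0 ≤ lo * δ := by positivity
    by_cases hpos : 0 < s2.m (19, [])
    · rw [hlo', if_pos hpos]
      rw [h19] at hpos
      obtain ⟨j, -, hj⟩ := hpos
      have hle := (cover_allPts hn hR).le_of_pos hR (by positivity) le_rfl hj
      refine ⟨h8, hlo, hle.trans ?_⟩
      -- This amounts to `8 * d / δ + 4 * d ≤ K`, the reason for the choice of `K`.
      have h10 : 2 * d ≤ δ / 4 * K * (1 / (1 + δ / 2)) := by
        rw [mul_one_div, le_div_iff₀ (by positivity)]
        have h11 : 8 * d / δ + 4 * d ≤ K := by rw [hK]; push_cast; linarith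
        have h12 := mul_le_mul_of_nonneg_left h11 hδ.le
        have h13 : δ * (8 * d / δ + 4 * d) = 8 * d + 4 * d * δ := by field_simp
        linarith
      have h14 : lo * (1 + δ / 2) / K * (K + 2 * d) =
          lo * (1 + δ / 2) + lo * (1 + δ / 2) / K * (2 * d) := by field_simp
      have h15 : lo * (1 + δ / 2) / K * (δ / 4 * K * (1 / (1 + δ / 2))) = lo * δ / 4 := by
        field_simp
      have h17 := mul_le_mul_of_nonneg_left h10 (show 0 ≤ lo * (1 + δ / 2) / K by positivity)
      linarith
    · rw [hlo', if_neg hpos]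
      rw [h19] at hpos
      have hlt := (cover_allPts hn hR).lt_of_neg (by positivity) hpos
      rw [div_mul_cancel₀ _ hK0.ne'] at hlt
      refine ⟨by positivity, by linarith, hhi.trans ?_⟩
      nlinarith [mul_nonneg hδ2 hδ.le]
  refine Tri.straight (by simp [Prog.Straight]) fun T4 hT4 => ⟨?_, ?_⟩
  · have e3 : ∃ s3, Keeps [8] [] s2 s3 ∧ s3.m (8, []) = lo' ∧
        run S (.ite (nat 0) (sv 19) .skip
          (.assign (sr 8) (.mul (sv 8) (.add (nat 1) (.div (sv 9) (nat 2)))))) s2 = s3 := by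
      refine ⟨_, ?_, ?_, rfl⟩
      all_goals
        simp only [run, eval_nat, Nat.cast_zero, eval_sv, hlo']
        split_ifs with hpos
      · exact Keeps.refl _ _ _
      · exact Keeps.set _ _ (by simp)
      · exact h82
      · simp [h82, h92]
    obtain ⟨s3, hk3, h83, e3⟩ := e3
    have hk4 : Keeps [8, 9] [] s2 (s3.set (9, []) (3 / 4 * δ)) :=
      (hk3.mono (by simp) (by simp)).trans (Keeps.set _ _ (by simp))
    have e4 : run S (.assign (sr 9) (.mul (sv 9) (.const (3 / 4)))) s3 =
        s3.set (9, []) (3 / 4 * δ) := by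
      simp [run, hk3.1 (9, []) (by simp), h92, mul_comm]
    rw [run, e3, e4]
    refine ⟨⟨_, hC2.base.keeps hk4 (by simp) (by simp)⟩, ?_, ?_, by simp, ?_⟩
    · rw [hk4.1 _ (by simp), hk12.1 _ (by simp), h4]
    · rw [hk4.1 _ (by simp), hk12.1 _ (by simp), h5]
    · simpa [h83] using hbr
  · have hT4' : T4 ≤ 20 := by refine hT4.trans ?_; simp [Prog.cost, RExpr.size]
    have h20 : (1 + T1 + (1 + T2 + (1 + T3 + T4)) + 10 : ℕ) ≤
        2 * n * (2 * (K + d) + 1) ^ d * decideC d τ + 60 * n := by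
      have : (n + 1) * (2 * (K + d) + 1) ^ d * decideC d τ ≤
          2 * n * (2 * (K + d) + 1) ^ d * decideC d τ := by gcongr; omega
      omega
    have h21 : (((2 * (K + d) + 1 : ℕ) : ℝ)) ≤ cellsC d * (1 / δ) := by
      rw [mul_one_div, le_div_iff₀ hδ]
      have h22 := mul_le_mul_of_nonneg_right hq1 hδ.le
      rw [div_mul_cancel₀ _ hδ.ne'] at h22
      have h23 : (10 * d + 3) * δ ≤ (10 * d + 3) * startRatio d := by gcongr
      rw [hK, cellsC]
      push_cast
      nlinarith
    -- As `δ` never exceeds `startRatio d`, the costs that do not depend on `δ` are also bounded by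
    -- a multiple of `(1 / δ) ^ d`.
    have h24 : (1 : ℝ) ≤ startRatio d ^ d * (1 / δ) ^ d := by
      rw [← mul_pow]
      refine one_le_pow₀ ?_
      rw [mul_one_div, le_div_iff₀ hδ]
      linarith
    calc (((1 + T1 + (1 + T2 + (1 + T3 + T4)) : ℕ) : ℝ) + 10)
        ≤ 2 * n * ((2 * (K + d) + 1 : ℕ) : ℝ) ^ d * decideC d τ + 60 * n := by exact_mod_cast h20
      _ ≤ 2 * n * (cellsC d * (1 / δ)) ^ d * decideC d τ +
          60 * n * (startRatio d ^ d * (1 / δ) ^ d) := by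
        refine add_le_add ?_ (le_mul_of_one_le_right (by positivity) h24)
        gcongr
      _ = halveC d τ * n * (1 / δ) ^ d := by
        rw [halveC, mul_pow]
        push_cast
        ring

/-- The time of the binary search, up to the factor `n / ε ^ d`. -/
noncomputable def improveC (d τ : ℕ) : ℝ := 3 * halveC d τ * (4 / 3) ^ d + 40

/-- The cost bound grows by the factor `(4 / 3) ^ d` from one round to the next. For `1 ≤ d` this is
at least `4 / 3`, so the sum is of the order of the last round, where `δ` is still above `ε`. -/
theorem improve_spec (hd : 1 ≤ d) (hn : 0 < n) (hR : IsLeast (feasibleRadii P S.family) R)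
    (hε : 0 < ε) (hε1 : ε ≤ 1) {s : St σ} (h : Finished s P S ε R) :
    Tri S τ (improve d) s fun s' t => s'.m (3, []) ∈ Set.Icc R ((1 + ε) * R) ∧
      (t : ℝ) ≤ improveC d τ * (n / ε ^ d) := by
  obtain ⟨⟨g, hB⟩, -, h8, hlo, hhi⟩ := h
  have hsr := startRatio_pos d
  -- A telescoping potential: replacing `δ` by `3 / 4 * δ` lowers it by `3 * ((4 / 3) ^ d - 1) ≥ 1`
  -- times the bound for the round. It vanishes at `3 / 4 * ε`, below which `δ` never falls.
  set φ : ℝ → ℝ := fun δ => 3 * halveC d τ * n * ((4 / 3 * (1 / ε)) ^ d - (1 / δ) ^ d) with hφ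
  have hφ0 : ∀ δ, 3 / 4 * ε ≤ δ → 0 ≤ φ δ := by
    intro δ hδ
    have h1 : 1 / δ ≤ 4 / 3 * (1 / ε) := by
      calc 1 / δ ≤ 1 / (3 / 4 * ε) := one_div_le_one_div_of_le (by positivity) hδ
        _ = 4 / 3 * (1 / ε) := by field_simp
    have h0 : 0 < δ := lt_of_lt_of_le (by positivity) hδ
    have h2 := pow_le_pow_left₀ (by positivity) h1 d
    exact mul_nonneg (by positivity) (by linarith)
  have hφ1 : ∀ δ, 0 < δ → halveC d τ * n * (1 / δ) ^ d + φ (3 / 4 * δ) ≤ φ δ := by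
    intro δ hδ
    have h1 : (1 / (3 / 4 * δ)) ^ d = (4 / 3) ^ d * (1 / δ) ^ d := by
      rw [← mul_pow]; congr 1; field_simp
    have h2 : (4 / 3 : ℝ) ≤ (4 / 3) ^ d := le_self_pow₀ (by norm_num) (by omega)
    have h3 := mul_le_mul_of_nonneg_right h2
      (show 0 ≤ 3 * halveC d τ * n * (1 / δ) ^ d by positivity)
    simp only [hφ, h1]
    linarith
  set s3 := ((s.set (5, []) 0).set (4, []) n).set (9, []) (startRatio d) with hs3
  have hk3 : Keeps [4, 5, 9] [] s s3 := ((Keeps.set _ _ (by simp)).trans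
    (Keeps.set _ _ (by simp))).trans (Keeps.set _ _ (by simp))
  have h83 : s3.m (8, []) = s.m (8, []) := hk3.1 _ (by simp)
  have hbr : Bracket s3 P S ε R (startRatio d) := by
    refine ⟨⟨_, hB.keeps hk3 (by simp) (by simp)⟩, by simp [hs3], by simp [hs3], by simp [hs3],
      h83 ▸ h8, h83 ▸ hlo, ?_⟩
    have h1 : (startRatio d : ℝ) = 384 * (cc d : ℝ) ^ 4 := by
      rw [startRatio]
      push_cast
      rfl
    rw [h83, h1]
    linarith
  refine Tri.seq (Tri.straight (by simp [Prog.Straight]) fun T1 hT1 => ?_)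
  refine Tri.seq (Tri.straight (by simp [Prog.Straight]) fun T2 hT2 => ?_)
  refine Tri.seq (Tri.straight (by simp [Prog.Straight]) fun T3 hT3 => ?_)
  have hT1' : T1 ≤ 3 := by refine hT1.trans ?_; simp [Prog.cost]
  have hT2' : T2 ≤ 3 := by refine hT2.trans ?_; simp [Prog.cost]
  have hT3' : T3 ≤ 3 := by refine hT3.trans ?_; simp [Prog.cost]
  have e3 : run S (.assign (sr 9) (nat (startRatio d))) (run S (.assign (sr 4) (sv 0))
      (run S (.assign (sr 5) (nat 0)) s)) = s3 := by
    simp [run, hs3, hB.size]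
  rw [e3]
  refine Tri.seq ((Tri.loop (fun δ s => 3 / 4 * ε ≤ δ ∧ δ ≤ startRatio d ∧ Bracket s P S ε R δ)
    (fun δ => ⌊φ δ⌋₊) ?_ (startRatio d : ℝ) s3 ⟨?_, le_rfl, hbr⟩).mono ?_)
  · rintro δ s ⟨hδ1, hδ2, hb⟩ hc
    obtain ⟨⟨g, hB⟩, -, -, h9, -⟩ := id hb
    rw [eval_sv, eval_sv, hB.eps, h9] at hc
    have hδ0 : 0 < δ := hε.trans hc
    refine (halve_spec hn hR hδ0 hδ2 hb).mono ?_
    rintro s' t ⟨hb', ht⟩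
    refine ⟨3 / 4 * δ, ⟨by linarith, by linarith, hb'⟩, ?_⟩
    -- The loop rule needs a potential in `ℕ`. Taking floors loses nothing, since the time of a
    -- round is an integer.
    refine Nat.le_floor ?_
    have h1 := Nat.floor_le (hφ0 (3 / 4 * δ) (by linarith))
    have h2 := hφ1 δ hδ0
    push_cast [size_sv]
    linarith
  · have : (1 : ℝ) ≤ startRatio d := by exact_mod_cast hsr
    linarith
  · rintro s4 T4 ⟨δ, ⟨hδ1, -, ⟨g4, hB4⟩, -, -, h9, h84, hlo4, hhi4⟩, hc, hT4⟩
    rw [eval_sv, eval_sv, hB4.eps, h9, not_lt] at hc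
    refine Tri.straight (by simp [Prog.Straight]) fun T5 hT5 => ⟨?_, ?_⟩
    · have hδ0 : 0 < δ := lt_of_lt_of_le (by positivity) hδ1
      have e5 : (run S (.assign (sr 3) (.mul (sv 8) (.add (nat 1) (sv 9)))) s4).m (3, []) =
          s4.m (8, []) * (1 + δ) := by
        simp [run, h9]
      rw [e5]
      refine ⟨hhi4, ?_⟩
      rw [mul_comm]
      gcongr
    · have hT5' : T5 ≤ 10 := by refine hT5.trans ?_; simp [Prog.cost, RExpr.size]
      have h1 : (⌊φ (startRatio d)⌋₊ : ℝ) ≤ 3 * halveC d τ * n * (4 / 3 * (1 / ε)) ^ d := by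
        have hs0 : (1 : ℝ) ≤ startRatio d := by exact_mod_cast hsr
        refine (Nat.floor_le (hφ0 _ (by linarith))).trans ?_
        simp only [hφ]
        gcongr
        have : 0 ≤ (1 / (startRatio d : ℝ)) ^ d := by positivity
        linarith
      have h2 : 1 ≤ (n : ℝ) / ε ^ d := by
        rw [le_div_iff₀ (by positivity), one_mul]
        exact (pow_le_one₀ hε.le hε1).trans (by exact_mod_cast hn)
      have h3 : (T4 : ℝ) ≤ ⌊φ (startRatio d)⌋₊ + 3 := by
        simp only [size_sv] at hT4
        exact_mod_cast (by omega : T4 ≤ ⌊φ (startRatio d)⌋₊ + 3)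
      have h4 : (1 + T1 + (1 + T2 + (1 + T3 + (1 + T4 + T5))) : ℕ) ≤ T4 + 30 := by omega
      calc ((1 + T1 + (1 + T2 + (1 + T3 + (1 + T4 + T5))) : ℕ) : ℝ) ≤ T4 + 30 := by
            exact_mod_cast h4
        _ ≤ 3 * halveC d τ * n * (4 / 3 * (1 / ε)) ^ d + 40 * (n / ε ^ d) := by linarith
        _ = improveC d τ * (n / ε ^ d) := by
          rw [improveC, mul_pow, one_div, inv_pow]
          field_simp

end Improve

end RealRAM

namespace RealRAM

/-! ### The algorithm -/

section Algorithm

variable {σ : Type*} {n d : ℕ} {S : SketchableFamily (Fin n) σ} {τ : ℕ}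
  {P : Fin n → EuclideanSpace ℝ (Fin d)} {R ε : ℝ}

/-- The body of the initialisation. -/
def initBody : Prog :=
  .seq (.assign (ref2 10 (nat 0) (sv 14)) (sv 14))
    (.seq (.skCopy (ref2 1 (nat 0) (sv 14)) (ref1 0 (sv 14)))
      (.seq (.skTest (sr 41) (ref1 0 (sv 14)))
        (.ite (nat 0) (sv 41) (.assign (sr 44) (nat 1)) .skip)))

/-- The initialisation: it sets up the list of all points, and finds out whether a cluster with a
single point belongs to the family. -/
def init : Prog := forP 14 (sv 0) initBody

/-- The state after `i` rounds of the initialisation. -/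
def Initialised (P : Fin n → EuclideanSpace ℝ (Fin d)) (S : SketchableFamily (Fin n) σ) (ε : ℝ)
    (i : ℕ) (s : St σ) : Prop :=
  Keeps [10, 14, 41, 44] [1] ⟨inputMem P ε, inputSketches S⟩ s ∧ s.m (14, []) = i ∧
    (∀ j : Fin n, (j : ℕ) < i → s.m (10, [0, ((j : ℕ) : ℤ)]) = (j : ℕ) ∧
      s.sm (1, [0, ((j : ℕ) : ℤ)]) = some (S.sketch {j})) ∧
    (0 < s.m (44, []) ↔ ∃ j : Fin n, (j : ℕ) < i ∧ {j} ∈ S.family)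

theorem initBody_spec {i : ℕ} (hi : i < n) {s : St σ} (h : Initialised P S ε i s) :
    Initialised P S ε (i + 1) ((run S initBody s).set (14, []) (i + 1)) ∧
      (run S initBody s).m (14, []) = i := by
  obtain ⟨hs, h14, hl, h44⟩ := h
  have hsk : s.sm (0, [(i : ℤ)]) = some (S.sketch {⟨i, hi⟩}) := by
    rw [hs.2 _ (by simp)]
    simp [inputSketches, hi]
  set s1 := (((s.set (10, [0, (i : ℤ)]) i).sset (1, [0, (i : ℤ)])
    (some (S.sketch {⟨i, hi⟩}))).set (41, []) (if S.oracle (S.sketch {⟨i, hi⟩}) then 1 else 0))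
    with hs1
  have hk1 : Keeps [10, 14, 41, 44] [1] s s1 := ((Keeps.set _ _ (by simp)).trans
    (Keeps.sset _ _ (by simp))).trans (Keeps.set _ _ (by simp))
  have e : run S initBody s =
      if S.oracle (S.sketch {⟨i, hi⟩}) then s1.set (44, []) 1 else s1 := by
    have h0 : run S (.skTest (sr 41) (ref1 0 (sv 14))) (run S (.skCopy (ref2 1 (nat 0) (sv 14))
        (ref1 0 (sv 14))) (run S (.assign (ref2 10 (nat 0) (sv 14)) (sv 14)) s)) = s1 := by
      simp [run, h14, hsk, hs1]
    have h2 : run S initBody s =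
        run S (.ite (nat 0) (sv 41) (.assign (sr 44) (nat 1)) .skip) s1 := by rw [← h0]; rfl
    rw [h2]
    simp only [run, eval_nat, Nat.cast_zero, eval_sv, addr_sr, Nat.cast_one]
    have h41 : s1.m (41, []) = if S.oracle (S.sketch {⟨i, hi⟩}) then 1 else 0 := by simp [hs1]
    rw [h41]
    split_ifs <;> simp_all
  have hor : S.oracle (S.sketch {⟨i, hi⟩}) = true ↔ {⟨i, hi⟩} ∈ S.family := S.oracle_sketch _
  have hmem : (∃ j : Fin n, (j : ℕ) < i + 1 ∧ {j} ∈ S.family) ↔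
      (∃ j : Fin n, (j : ℕ) < i ∧ {j} ∈ S.family) ∨ {⟨i, hi⟩} ∈ S.family := by
    constructor
    · rintro ⟨j, hj, hF⟩
      by_cases h : (j : ℕ) = i
      · right
        have : j = ⟨i, hi⟩ := Fin.ext h
        rwa [← this]
      · exact .inl ⟨j, by omega, hF⟩
    · rintro (⟨j, hj, hF⟩ | hF)
      · exact ⟨j, by omega, hF⟩
      · exact ⟨⟨i, hi⟩, Nat.lt_succ_self i, hF⟩
  have hl1 : ∀ j : Fin n, (j : ℕ) < i + 1 → s1.m (10, [0, ((j : ℕ) : ℤ)]) = (j : ℕ) ∧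
      s1.sm (1, [0, ((j : ℕ) : ℤ)]) = some (S.sketch {j}) := by
    intro j hj
    by_cases h : (j : ℕ) = i
    · have : j = ⟨i, hi⟩ := Fin.ext h
      subst this
      simp [hs1]
    · have := hl j (by omega)
      simpa [hs1, h] using this
  have h141 : s1.m (14, []) = i := by simp [hs1, h14]
  have h441 : s1.m (44, []) = s.m (44, []) := by simp [hs1]
  rw [e]
  by_cases ho : S.oracle (S.sketch {⟨i, hi⟩})
  · simp only [ho, if_true]
    refine ⟨⟨((hs.trans hk1).trans (Keeps.set _ _ (by simp))).trans (Keeps.set _ _ (by simp)),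
      by simp, by simpa using hl1, ?_⟩, by simp [h141]⟩
    rw [hmem]
    simp [hor.1 ho]
  · simp only [ho, Bool.false_eq_true, if_false]
    refine ⟨⟨(hs.trans hk1).trans (Keeps.set _ _ (by simp)), by simp, by simpa using hl1, ?_⟩,
      h141⟩
    rw [hmem]
    simp [h441, h44, mt hor.2 ho]

/-- The time of the initialisation, up to the number of points. -/
def initC (τ : ℕ) : ℕ := 2 * (initBody.cost τ + 21)

theorem init_spec (hn : 0 < n) :
    Tri S τ init ⟨inputMem P ε, inputSketches S⟩ fun s t => Base s P S ε 0 ∧ t ≤ initC τ * n ∧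
      s.m (3, []) = 0 ∧ s.m (5, []) = 0 ∧ (0 < s.m (44, []) ↔ ∃ j, {j} ∈ S.family) := by
  refine (Tri.forP n (initBody.cost τ) (fun i s => Initialised P S ε i s) ?_ ?_ ?_ _ ?_).mono ?_
  · rintro i s ⟨hs, -⟩
    rw [eval_sv, hs.1 _ (by simp)]
    rfl
  · exact fun i s h => h.2.1
  · intro i hi s h
    refine Tri.straight (by simp [initBody, Prog.Straight]) fun t ht => ?_
    obtain ⟨h1, h2⟩ := initBody_spec hi h
    exact ⟨ht, h2, h1⟩
  · refine ⟨Keeps.set _ _ (by simp), by simp, by simp, ?_⟩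
    simp [inputMem]
  · rintro s t ⟨⟨hs, h14, hl, h44⟩, ht⟩
    refine ⟨⟨?_, ?_, fun i j => ?_, ?_, fun g hg z => ?_, fun j => (hl j j.2).1,
      fun j => (hl j j.2).2⟩, ht.trans ?_, ?_, ?_, ?_⟩
    · rw [hs.1 _ (by simp)]; rfl
    · rw [hs.1 _ (by simp)]; rfl
    · rw [hs.1 _ (by simp)]
      simp [inputMem]
    · rw [hs.1 _ (by simp)]
      simp [inputMem]
    · rw [hs.1 _ (by simp), hs.1 _ (by simp)]
      simp [inputMem]
    · rw [initC, size_sv]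
      calc (n + 1) * (initBody.cost τ + 20 + 1) ≤ 2 * n * (initBody.cost τ + 21) := by
            gcongr
            omega
        _ = _ := by ring
    · rw [hs.1 _ (by simp)]
      simp [inputMem]
    · rw [hs.1 _ (by simp)]
      simp [inputMem]
    · rw [h44]
      exact ⟨fun ⟨j, _, hj⟩ => ⟨j, hj⟩, fun ⟨j, hj⟩ => ⟨j, j.2, hj⟩⟩

/-- Distinct points have positive distance, so the clusters at radius `0` are the singletons. -/
theorem optimal_eq_zero_iff (hP : Function.Injective P)
    (hR : IsLeast (feasibleRadii P S.family) R) : R = 0 ↔ ∃ j, {j} ∈ S.family := by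
  constructor
  · rintro rfl
    obtain ⟨u, hu⟩ := (mem_feasibleRadii.1 hR.1).2
    refine ⟨u, S.upward_closed _ hu _ fun w hw => ?_⟩
    rw [Set.mem_ofPred_eq, SimpleGraph.reachable_iff_reflTransGen] at hw
    induction hw with
    | refl => rfl
    | @tail b c _ h2 ih =>
      exact absurd (hP (dist_le_zero.1 h2.2)) h2.1
  · rintro ⟨j, hj⟩
    refine le_antisymm (hR.2 (feasible_of_reachable (u := j) S le_rfl hj ?_)) hR.1.1
    rintro v rfl
    exact SimpleGraph.Reachable.refl _

/-- The algorithm. -/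
def algorithm (d : ℕ) : Prog :=
  .seq init (.seq (.seq (.assign (sr 4) (sv 0)) (.assign (sr 7) (nat 1)))
    (.ite (nat 0) (sv 44) .skip
      (.seq (.assign (sr 40) (nat 1)) (.seq (mainLoop d) (improve d)))))

/-- The constant in the running time of the algorithm. -/
noncomputable def algorithmC (d τ : ℕ) : ℝ := initC τ + mainC d τ + improveC d τ + 50

theorem Good.seq {Q : Config σ → Prop} {p q : Prog} {rest : List Prog} {s : St σ} {T : ℕ}
    {B : ENNReal} (h : Good S τ Q ⟨p :: q :: rest, s.m, s.sm, T + 1⟩ B) :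
    Good S τ Q ⟨.seq p q :: rest, s.m, s.sm, T⟩ B :=
  Good.of_pure rfl (Nat.le_succ _) h

theorem Good.iteF {Q : Config σ → Prop} {a b : RExpr} {p q : Prog} {rest : List Prog} {s : St σ}
    {T : ℕ} {B : ENNReal} (hc : ¬ a.eval s.m < b.eval s.m)
    (h : Good S τ Q ⟨q :: rest, s.m, s.sm, T + (1 + a.size + b.size)⟩ B) :
    Good S τ Q ⟨.ite a b p q :: rest, s.m, s.sm, T⟩ B := by
  refine Good.of_pure ?_ (Nat.le_add_right _ _) h
  simp only [step, hc, if_false, add_assoc]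

theorem algorithm_good (hd : 1 ≤ d) (hn : 0 < n) (hP : Function.Injective P)
    (hR : IsLeast (feasibleRadii P S.family) R) (hε : 0 < ε) (hε1 : ε ≤ 1) :
    Good S τ (fun c => c.output ∈ Set.Icc R ((1 + ε) * R)) (start (algorithm d) P S ε)
      (ENNReal.ofReal (algorithmC d τ * (n / ε ^ d))) := by
  have hnε : (n : ℝ) ≤ n / ε ^ d := by
    rw [le_div_iff₀ (by positivity)]
    exact mul_le_of_le_one_right (by positivity) (pow_le_one₀ hε.le hε1)
  have hn1 : (1 : ℝ) ≤ n := by exact_mod_cast hn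
  have himp : 0 ≤ improveC d τ := by rw [improveC]; positivity
  obtain ⟨s1, t1, hex1, hB1, ht1, h31, h51, h44⟩ :=
    init_spec (S := S) (τ := τ) (P := P) (ε := ε) hn
  have ht1' : (t1 : ℝ) ≤ initC τ * n := by exact_mod_cast ht1
  refine Good.seq (s := ⟨inputMem P ε, inputSketches S⟩) (Good.of_exec hex1 _ _ _ (Good.seq ?_))
  obtain ⟨t2, ht2, hex2⟩ := exec_run (S := S) (τ := τ)
    (.seq (.assign (sr 4) (sv 0)) (.assign (sr 7) (nat 1))) (by simp [Prog.Straight]) s1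
  have ht2' : t2 ≤ 10 := by refine ht2.trans ?_; simp [Prog.cost]
  set s2 := (s1.set (4, []) n).set (7, []) 1 with hs2
  have e2 : run S (.seq (.assign (sr 4) (sv 0)) (.assign (sr 7) (nat 1))) s1 = s2 := by
    simp [run, hB1.size, hs2]
  rw [e2] at hex2
  refine Good.of_exec hex2 _ _ _ ?_
  by_cases hfound : ∃ j, {j} ∈ S.family
  · have hR0 := (optimal_eq_zero_iff hP hR).2 hfound
    refine Good.of_exec (Exec.iteT _ _ _ _ s2 s2 _ ?_ (Exec.skip s2)) _ _ _ (Good.halted rfl ?_ ?_)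
    · simpa [hs2] using h44.2 hfound
    -- The output variable still holds its initial value `0`, which is the optimum.
    · simp [Config.output, hR0, hs2, h31]
    · rw [← ENNReal.ofReal_natCast]
      refine ENNReal.ofReal_le_ofReal ?_
      have h1 : (0 + 1 + t1 + 1 + t2 + (1 + (nat 0).size + (sv 44).size + 1) : ℕ) ≤ t1 + 20 := by
        simp only [size_nat, size_sv]; omega
      calc ((0 + 1 + t1 + 1 + t2 + (1 + (nat 0).size + (sv 44).size + 1) : ℕ) : ℝ)
          ≤ t1 + 20 := by exact_mod_cast h1
        _ ≤ (initC τ + 50) * n := by linarith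
        _ ≤ (initC τ + 50) * (n / ε ^ d) := by gcongr
        _ ≤ algorithmC d τ * (n / ε ^ d) := by
          rw [algorithmC]
          gcongr
          have : (0 : ℝ) ≤ mainC d τ := by positivity
          linarith
  · have hR0 : 0 < R :=
      lt_of_le_of_ne hR.1.1 fun h => hfound ((optimal_eq_zero_iff hP hR).1 h.symm)
    refine Good.iteF ?_ (Good.seq ?_)
    · simpa [hs2] using mt h44.1 hfound
    refine Good.of_exec (Exec.assign _ _ s2) _ _ _ (Good.seq ?_)
    set s3 := s2.set (40, []) 1 with hs3
    have e3 : s2.set ((sr 40).addr s2.m) ((nat 1).eval s2.m) = s3 := by simp [hs3]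
    rw [e3]
    have hk3 : Keeps [4, 7, 40] [] s1 s3 := ((Keeps.set _ _ (by simp)).trans
      (Keeps.set _ _ (by simp))).trans (Keeps.set _ _ (by simp))
    -- In the initial list every point represents only itself, so it is faithful at the scale `μ =
    -- 0`.
    have hgo : Going s3 P S ε R n := by
      refine ⟨by simp [hs3], _, _, _, _, _, 0, (hB1.keeps hk3 (by simp) (by simp)).current hn
        (by simp [hs3, hs2]) (by rw [hk3.1 _ (by simp), h51]) (by simp [hs3, hs2]), ?_, le_rfl,
        by simpa using hR0.le, fun _ _ _ _ _ => dist_nonneg⟩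
      simpa using cover_allPts hn hR
    refine (mainLoop_good hP hR hR0 (F := ENNReal.ofReal (improveC d τ * (n / ε ^ d))) ?_ n s3 hgo
      _).mono ?_
    · intro s hs T
      obtain ⟨s', t, hex, hout, ht⟩ := improve_spec (τ := τ) hd hn hR hε hε1 hs
      refine Good.of_exec hex _ _ _ (Good.halted rfl hout ?_)
      push_cast
      gcongr
      rw [← ENNReal.ofReal_natCast]
      exact ENNReal.ofReal_le_ofReal ht
    · rw [← ENNReal.ofReal_natCast, ← ENNReal.ofReal_natCast,
        ← ENNReal.ofReal_add (by positivity) (by positivity),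
        ← ENNReal.ofReal_add (by positivity) (by positivity)]
      refine ENNReal.ofReal_le_ofReal ?_
      have h1 : (0 + 1 + t1 + 1 + t2 + (1 + (nat 0).size + (sv 44).size) + 1 +
          (1 + (sr 40).size + (nat 1).size) + 1 : ℕ) ≤ t1 + 30 := by
        simp only [size_nat, size_sv, size_sr]; omega
      calc _ ≤ ((t1 + 30 : ℕ) : ℝ) + improveC d τ * (n / ε ^ d) + (mainC d τ * n : ℕ) := by
            gcongr
        _ ≤ (initC τ + mainC d τ + 50) * n + improveC d τ * (n / ε ^ d) := by
          push_cast
          linarith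
        _ ≤ (initC τ + mainC d τ + 50) * (n / ε ^ d) + improveC d τ * (n / ε ^ d) := by gcongr
        _ = algorithmC d τ * (n / ε ^ d) := by rw [algorithmC]; ring

end Algorithm

end RealRAM

theorem mainTheorem8 (d : ℕ) (hd : 1 ≤ d) :
    ∃ prog : RealRAM.Prog, ∀ τ : ℕ, ∃ C : ℝ,
      ∀ (σ : Type*) (n : ℕ) (P : Fin n → EuclideanSpace ℝ (Fin d))
        (S : SketchableFamily (Fin n) σ) (ε : ℝ),
        1 ≤ n → Function.Injective P → S.family.Nonempty → 0 < ε → ε ≤ 1 →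
        ∃ ropt : ℝ, IsLeast (feasibleRadii P S.family) ropt ∧
          RealRAM.probOutput S τ (RealRAM.start prog P S ε)
            (Set.Icc ropt ((1 + ε) * ropt)) = 1 ∧
          RealRAM.expectedTime S τ (RealRAM.start prog P S ε) ≤
            ENNReal.ofReal (C * (n / ε ^ d)) := by
  refine ⟨RealRAM.algorithm d, fun τ => ⟨RealRAM.algorithmC d τ, ?_⟩⟩
  intro σ n P S ε hn hP hS hε hε1
  have : Nonempty (Fin n) := ⟨⟨0, hn⟩⟩
  obtain ⟨R, hR⟩ := RealRAM.exists_isLeast_feasibleRadii (P := P) S hS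
  have h := RealRAM.algorithm_good (τ := τ) hd hn hP hR hε hε1
  exact ⟨R, hR, h.probOutput, h.expectedTime⟩
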